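/- **Quasisymmetric and symmetric functions.** Let $\mathcal R$ be the $\mathbb Q$-algebra of formal power series of bounded degree in commuting variables $x_1,x_2,\dots$ and anticommuting variables $\theta_1,\theta_2,\dots$ ($\theta_i\theta_j=-\theta_j\theta_i$, $\theta_i^2=0$). A *dotted composition* is a finite sequence $\alpha=(\alpha_1,\dots,\alpha_l)$ with entries in $\{1,2,\dots\}\cup\{\dot 0,\dot 1,\dot 2,\dots\}$; put $\eta_i=1$ if $\alpha_i$ is dotted and $\eta_i=0$ otherwise, and $$M_\alpha=\sum_{i_1<\dots<i_l}\theta_{i_1}^{\eta_1}\cdots\theta_{i_l}^{\eta_l}\,x_{i_1}^{\alpha_1}\cdots x_{i_l}^{\alpha_l}.$$ Let $\mathrm{sQSym}\subset\mathcal R$ be the algebra of those series in which, for each $\alpha$, all monomials $\theta_{i_1}^{\eta_1}\cdots\theta_{i_l}^{\eta_l}x_{i_1}^{\alpha_1}\cdots x_{i_l}^{\alpha_l}$ with $i_1<\dots<i_l$ have the same coefficient; the $M_\alpha$ form a basis. Let $\mathbf\Lambda\subset\mathrm{sQSym}$ be the subalgebra of the series that are invariant under simultaneous permutations of the $x_i$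 and the $\theta_i$, and $\iota:\mathbf\Lambda\to\mathrm{sQSym}$ the inclusion. Both $\mathrm{sQSym}$ and $\mathbf\Lambda$ are Hopf algebras, with coproduct $(\Delta f)(x,y;\theta,\phi)=f(x,y;\theta,\phi)$ (the variables $x,\theta$ preceding $y,\phi$, the $\theta$'s and $\phi$'s anticommuting, and $f\otimes g$ standing for $f(x;\theta)g(y;\phi)$) and with the constant term as counit. Here and below $A\otimes A$ carries the product $(f_1\otimes g_1)(f_2\otimes g_2)=(-1)^{ab}f_1f_2\otimes g_1g_2$, where $a,b$ are the fermionic degrees (numbers of $\theta$'s, or of dotted parts) of $g_1,f_2$. **Noncommutative symmetric functions.** Let $\mathrm{sNSym}$ be the Hopf dual of $\mathrm{sQSym}$, with basis $\{H_\alpha\}$ and dual pairing $\langle H_\alpha,M_\beta\rangle=\delta_{\alpha\beta}$. Explicitly, $\mathrm{sNSym}$ is the Hopf algebra with basis $\{H_\alpha\}$, product $H_\alpha H_\beta=H_{\alpha\cdot\beta}$ (concatenation), coproduct $\Delta H_\gamma=\sum_{\alpha,\beta}\langle H_\gamma,M_\alpha M_\beta\rangle\,H_\alpha\otimes H_\beta$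 and counit $\epsilon(H_\alpha)=\delta_{\alpha,\emptyset}$, and the pairing is nondegenerate and satisfies $$\langle FG,a\rangle=\langle F\otimes G,\Delta a\rangle,\quad \langle F,ab\rangle=\langle\Delta F,a\otimes b\rangle,\quad \langle 1,a\rangle=\epsilon(a),\quad \langle F,1\rangle=\epsilon(F),\quad \langle S(F),a\rangle=\langle F,S(a)\rangle,$$ where $\langle F\otimes G,a\otimes b\rangle=\langle F,a\rangle\langle G,b\rangle$. Write $H_m=H_{(m)}$ for $m\ge1$ and $\tilde H_n=H_{(\dot n)}$ for $n\ge0$. **Bases and scalar product of $\mathbf\Lambda$.** A superpartition is a pair $\Lambda=(\Lambda^a;\Lambda^s)=(\Lambda_1,\dots,\Lambda_m;\Lambda_{m+1},\dots,\Lambda_\ell)$ with $\Lambda_1>\dots>\Lambda_m\ge0$ and $\Lambda_{m+1}\ge\dots\ge\Lambda_\ell\ge1$; its total degree is $\sum\Lambda_i$ and its fermionic degree is $m$. Let $m_\Lambda\in\mathbf\Lambda$ be the sum of all distinct terms $\theta_{\sigma(1)}\cdots\theta_{\sigma(m)}x_{\sigma(1)}^{\Lambda_1}\cdots x_{\sigma(\ell)}^{\Lambda_\ell}$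 with $\sigma(1),\dots,\sigma(\ell)$ pairwise distinct. Let $h_r=\sum m_\Lambda$ over the $\Lambda$ of total degree $r$ and fermionic degree $0$, and $\tilde h_k=\sum(\Lambda_1+1)m_\Lambda$ over the $\Lambda$ of total degree $k$ and fermionic degree $1$. Let $p_r=\sum_i x_i^r$, $\tilde p_k=\sum_i\theta_ix_i^k$ and $p_\Lambda=\tilde p_{\Lambda_1}\cdots\tilde p_{\Lambda_m}p_{\Lambda_{m+1}}\cdots p_{\Lambda_\ell}$. The scalar product on $\mathbf\Lambda$ is the unique bilinear form with $\langle\!\langle p_\Lambda,p_\Omega\rangle\!\rangle=\delta_{\Lambda\Omega}\,z_{\Lambda^s}$, where $z_\lambda=\prod_i i^{n_i}n_i!$ and $n_i$ is the number of parts of $\lambda$ equal to $i$. **Corollary.** There is a unique algebra morphism $\pi:\mathrm{sNSym}\to\mathbf\Lambda$ with $\pi(H_m)=h_m$ for all $m\ge1$ and $\pi(\tilde H_n)=\tilde h_n$ for all $n\ge0$. It is surjective, it is a morphism of Hopf algebras (it respects coproducts, counits and antipodes), and $$\langle\!\langle\pi(F),g\rangle\!\rangle=\langle F,\iota(g)\rangle\qquad\text{for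 all }F\in\mathrm{sNSym},\ g\in\mathbf\Lambda.$$ -/

import Mathlib

namespace SuperSym

open Finset

/-- Formal power series over `ℚ` in commuting variables `x_n` and anticommuting variables `θ_n`
(`n : ℕ`). Every monomial is written uniquely as `θ_A x^e`, where `A` is a finite set of indices,
`θ_A` is the product of the `θ_n`, `n ∈ A`, with increasing indices, and `e` is a finitely supported
exponent vector. A series is the family, indexed by `A`, of the power series in `x` that multiply
`θ_A`. -/
def SSeries : Type := Finset ℕ → MvPowerSeries ℕ ℚ

namespace SSeries

instance : AddCommGroup SSeries := inferInstanceAs (AddCommGroup (Finset ℕ → MvPowerSeries ℕ ℚ))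
noncomputable instance : Module ℚ SSeries := inferInstanceAs (Module ℚ (Finset ℕ → MvPowerSeries ℕ ℚ))

/-- The coefficient of `θ_A x^e`. -/
def coeff (A : Finset ℕ) (e : ℕ →₀ ℕ) : SSeries →ₗ[ℚ] ℚ where
  toFun f := f A e
  map_add' _ _ := rfl
  map_smul' _ _ := rfl

/-- The series with prescribed coefficients. -/
def of (c : Finset ℕ → (ℕ →₀ ℕ) → ℚ) : SSeries := c

theorem coeff_of (c : Finset ℕ → (ℕ →₀ ℕ) → ℚ) (A : Finset ℕ) (e : ℕ →₀ ℕ) :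
    coeff A e (of c) = c A e := rfl

theorem ext {f g : SSeries} (h : ∀ A e, coeff A e f = coeff A e g) : f = g := by
  funext A; funext e; exact h A e

/-- For disjoint `B` and `C`, `θ_B θ_C = crossSign B C • θ_{B ∪ C}`; if `B` and `C` meet, then
`θ_B θ_C = 0`. -/
def crossSign (B C : Finset ℕ) : ℚ := ∏ b ∈ B, ∏ c ∈ C, if c < b then -1 else 1

theorem crossSign_union_left {B B' C : Finset ℕ} (h : Disjoint B B') :
    crossSign (B ∪ B') C = crossSign B C * crossSign B' C := by
  rw [crossSign, prod_union h]; rfl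

theorem crossSign_union_right {B C C' : Finset ℕ} (h : Disjoint C C') :
    crossSign B (C ∪ C') = crossSign B C * crossSign B C' := by
  simp only [crossSign, prod_union h, prod_mul_distrib]

noncomputable instance : Mul SSeries where
  mul f g := fun A => ∑ B ∈ A.powerset, crossSign B (A \ B) • (f B * g (A \ B))

theorem mul_apply (f g : SSeries) (A : Finset ℕ) :
    (f * g) A = ∑ B ∈ A.powerset, crossSign B (A \ B) • (f B * g (A \ B)) := rfl

noncomputable instance : One SSeries where
  one := fun A => if A = ∅ then 1 else 0

theorem one_apply (A : Finset ℕ) : (1 : SSeries) A = if A = ∅ then 1 else 0 := rfl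

theorem add_apply (f g : SSeries) (A : Finset ℕ) : (f + g) A = f A + g A := rfl
theorem smul_apply (r : ℚ) (f : SSeries) (A : Finset ℕ) : (r • f) A = r • f A := rfl
theorem zero_apply (A : Finset ℕ) : (0 : SSeries) A = 0 := rfl

theorem mul_assoc' (f g h : SSeries) : f * g * h = f * (g * h) := by
  funext A
  simp only [mul_apply, sum_mul, mul_sum, smul_sum]
  rw [sum_sigma', sum_sigma']
  refine sum_bij' (fun x _ => ⟨x.2, x.1 \ x.2⟩) (fun y _ => ⟨y.1 ∪ y.2, y.1⟩) ?_ ?_ ?_ ?_ ?_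
  · rintro ⟨B, C⟩ hx
    simp only [mem_sigma, mem_powerset] at hx ⊢
    exact ⟨hx.2.trans hx.1, sdiff_subset_sdiff hx.1 le_rfl⟩
  · rintro ⟨B, C⟩ hx
    simp only [mem_sigma, mem_powerset] at hx ⊢
    exact ⟨union_subset hx.1 (hx.2.trans sdiff_subset), subset_union_left⟩
  · rintro ⟨B, C⟩ hx
    simp only [mem_sigma, mem_powerset] at hx
    simp [hx.2]
  · rintro ⟨B, C⟩ hx
    simp only [mem_sigma, mem_powerset] at hx
    have : Disjoint B C := (disjoint_sdiff).mono_right hx.2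
    simp only [Sigma.mk.injEq, heq_eq_eq, true_and]
    rw [union_sdiff_left, sdiff_eq_self_of_disjoint this.symm]
  · rintro ⟨B, C⟩ hx
    simp only [mem_sigma, mem_powerset] at hx
    obtain ⟨hB, hC⟩ := hx
    have e1 : (A \ C) \ (B \ C) = A \ B := by
      ext x; simp only [mem_sdiff]; have := @hC x; tauto
    have e2 : A \ C = (B \ C) ∪ (A \ B) := by
      ext x; simp only [mem_sdiff, mem_union]; have := @hC x; have := @hB x; tauto
    have d : Disjoint (B \ C) (A \ B) := disjoint_sdiff.mono_left sdiff_subset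
    simp only [e1, smul_mul_assoc, mul_smul_comm, smul_smul, mul_assoc]
    congr 1
    rw [e2, crossSign_union_right d]
    conv_lhs => rw [← union_sdiff_of_subset hC, crossSign_union_left disjoint_sdiff]
    rw [union_sdiff_of_subset hC]
    ring

theorem one_mul' (f : SSeries) : 1 * f = f := by
  funext A
  rw [mul_apply, sum_eq_single ∅]
  · simp [one_apply, crossSign]
  · intro B _ hB; simp [one_apply, hB]
  · intro h; simp at h

theorem mul_one' (f : SSeries) : f * 1 = f := by
  funext A
  rw [mul_apply, sum_eq_single A]
  · simp [one_apply, crossSign]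
  · intro B hB hne
    have : A \ B ≠ ∅ := by
      intro h; exact hne (subset_antisymm (mem_powerset.1 hB) (sdiff_eq_empty_iff_subset.1 h))
    simp [one_apply, this]
  · intro h; simp at h

noncomputable instance : Ring SSeries :=
  { (inferInstance : AddCommGroup SSeries) with
    mul := (· * ·)
    one := 1
    mul_assoc := mul_assoc'
    one_mul := one_mul'
    mul_one := mul_one'
    zero_mul := fun f => by
      funext A; simp [mul_apply, zero_apply]
    mul_zero := fun f => by
      funext A; simp [mul_apply, zero_apply]
    left_distrib := fun f g h => by
      funext A; simp [mul_apply, add_apply, mul_add, sum_add_distrib]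
    right_distrib := fun f g h => by
      funext A; simp [mul_apply, add_apply, add_mul, sum_add_distrib] }

noncomputable instance : Algebra ℚ SSeries :=
  Algebra.ofModule
    (fun r f g => by funext A; simp only [mul_apply, smul_apply, smul_sum, smul_mul_assoc, smul_comm r])
    (fun r f g => by funext A; simp only [mul_apply, smul_apply, smul_sum, mul_smul_comm, smul_comm r])

theorem coeff_mul (f g : SSeries) (A : Finset ℕ) (e : ℕ →₀ ℕ) :
    coeff A e (f * g) = ∑ B ∈ A.powerset, ∑ p ∈ antidiagonal e,
      crossSign B (A \ B) * (coeff B p.1 f * coeff (A \ B) p.2 g) := by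
  change MvPowerSeries.coeff e ((f * g) A) = _
  rw [mul_apply, map_sum]
  refine sum_congr rfl fun B _ => ?_
  rw [map_smul, MvPowerSeries.coeff_mul, smul_eq_mul, mul_sum]
  rfl

theorem coeff_one (A : Finset ℕ) (e : ℕ →₀ ℕ) :
    coeff A e (1 : SSeries) = if A = ∅ ∧ e = 0 then 1 else 0 := by
  change MvPowerSeries.coeff e ((1 : SSeries) A) = _
  rw [one_apply]
  by_cases h : A = ∅ <;> simp [h, MvPowerSeries.coeff_one]


/-- The pairs `i < j` of elements of `A`. -/
def pairs (A : Finset ℕ) : Finset (ℕ × ℕ) := (A ×ˢ A).filter fun p => p.1 < p.2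

theorem mem_pairs {A : Finset ℕ} {p : ℕ × ℕ} : p ∈ pairs A ↔ p.1 ∈ A ∧ p.2 ∈ A ∧ p.1 < p.2 := by
  simp [pairs, and_assoc]

/-- If `i_1 < ... < i_k` are the elements of `A`, then
`θ_{φ i_1} ⋯ θ_{φ i_k} = relabelSign φ A • θ_{φ A}`. -/
def relabelSign (φ : ℕ ↪ ℕ) (A : Finset ℕ) : ℚ :=
  ∏ p ∈ pairs A, if φ p.1 < φ p.2 then 1 else -1

theorem relabelSign_sq (φ : ℕ ↪ ℕ) (A : Finset ℕ) : relabelSign φ A * relabelSign φ A = 1 := by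
  rw [relabelSign, ← prod_mul_distrib]
  exact prod_eq_one fun p _ => by split_ifs <;> norm_num

theorem crossSign_eq_prod (B C : Finset ℕ) :
    crossSign B C = ∏ p ∈ B ×ˢ C, if p.2 < p.1 then -1 else 1 := by
  rw [crossSign, prod_product]

theorem relabelSign_eq_one {φ : ℕ ↪ ℕ} (h : StrictMono φ) (A : Finset ℕ) :
    relabelSign φ A = 1 :=
  prod_eq_one fun _ hp => if_pos (h (mem_pairs.1 hp).2.2)

/-- Splitting a product over the pairs of a disjoint union. -/
theorem prod_pairs_union {B C : Finset ℕ} (hd : Disjoint B C) (F : ℕ × ℕ → ℚ) :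
    ∏ p ∈ pairs (B ∪ C), F p = (∏ p ∈ pairs B, F p) * (∏ p ∈ pairs C, F p) *
      ∏ p ∈ B ×ˢ C, F (if p.1 < p.2 then p else p.swap) := by
  have hne : ∀ b ∈ B, ∀ c ∈ C, b ≠ c := fun b hb c hc h => disjoint_left.1 hd hb (h ▸ hc)
  have e : pairs (B ∪ C) = (pairs B ∪ pairs C) ∪
      (B ×ˢ C).image (fun p => if p.1 < p.2 then p else p.swap) := by
    ext ⟨i, j⟩
    simp only [mem_pairs, mem_union, mem_image, mem_product, Prod.exists]
    constructor
    · rintro ⟨hi | hi, hj | hj, hij⟩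
      · exact Or.inl (Or.inl ⟨hi, hj, hij⟩)
      · exact Or.inr ⟨i, j, ⟨hi, hj⟩, if_pos hij⟩
      · exact Or.inr ⟨j, i, ⟨hj, hi⟩, by rw [if_neg (not_lt.2 hij.le)]; rfl⟩
      · exact Or.inl (Or.inr ⟨hi, hj, hij⟩)
    · rintro ((⟨hi, hj, h⟩ | ⟨hi, hj, h⟩) | ⟨b, c, ⟨hb, hc⟩, h⟩)
      · exact ⟨Or.inl hi, Or.inl hj, h⟩
      · exact ⟨Or.inr hi, Or.inr hj, h⟩
      · split_ifs at h with hlt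
        · obtain ⟨rfl, rfl⟩ := Prod.mk.inj h
          exact ⟨Or.inl hb, Or.inr hc, hlt⟩
        · obtain ⟨rfl, rfl⟩ := Prod.mk.inj h
          exact ⟨Or.inr hc, Or.inl hb, lt_of_le_of_ne (not_lt.1 hlt) (hne _ hb _ hc).symm⟩
  rw [e, prod_union, prod_union, prod_image]
  · rintro ⟨b, c⟩ hb ⟨b', c'⟩ hb' h
    simp only [coe_product, Set.mem_prod, mem_coe] at hb hb'
    simp only at h
    have h1 := hne _ hb.1 _ hb'.2
    have h2 := hne _ hb'.1 _ hb.2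
    split_ifs at h <;> simp_all [Prod.ext_iff, eq_comm]
  · rw [disjoint_left]
    rintro ⟨i, j⟩ h h'
    exact disjoint_left.1 hd (mem_pairs.1 h).1 (mem_pairs.1 h').1
  · rw [disjoint_left]
    rintro ⟨i, j⟩ h h'
    simp only [mem_image, mem_product, Prod.exists] at h'
    obtain ⟨b, c, ⟨hb, hc⟩, h'⟩ := h'
    simp only [mem_union, mem_pairs] at h
    have h1 := disjoint_left.1 hd
    split_ifs at h' <;> obtain ⟨rfl, rfl⟩ := Prod.mk.inj h' <;> (try simp only at h) <;> tauto

theorem relabelSign_union (φ : ℕ ↪ ℕ) {B C : Finset ℕ} (hd : Disjoint B C) :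
    relabelSign φ (B ∪ C) * crossSign (B.map φ) (C.map φ) =
      crossSign B C * (relabelSign φ B * relabelSign φ C) := by
  have hne : ∀ b ∈ B, ∀ c ∈ C, b ≠ c := fun b hb c hc h => disjoint_left.1 hd hb (h ▸ hc)
  have key : (∏ p ∈ B ×ˢ C, (if φ (if p.1 < p.2 then p else p.swap).1 <
      φ (if p.1 < p.2 then p else p.swap).2 then (1 : ℚ) else -1)) *
      (∏ p ∈ B ×ˢ C, if φ p.2 < φ p.1 then (-1 : ℚ) else 1) =
      ∏ p ∈ B ×ˢ C, if p.2 < p.1 then (-1 : ℚ) else 1 := by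
    rw [← prod_mul_distrib]
    refine prod_congr rfl ?_
    rintro ⟨b, c⟩ h
    rw [mem_product] at h
    have h1 := hne b h.1 c h.2
    have h2 : φ b ≠ φ c := fun h => h1 (φ.injective h)
    rcases lt_or_gt_of_ne h1 with h3 | h3 <;> rcases lt_or_gt_of_ne h2 with h4 | h4 <;>
      simp [h3, h4, h3.not_gt, h4.not_gt]
  have e2 : crossSign (B.map φ) (C.map φ) =
      ∏ p ∈ B ×ˢ C, if φ p.2 < φ p.1 then (-1 : ℚ) else 1 := by
    rw [prod_product]
    simp only [crossSign, prod_map]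
  rw [relabelSign, prod_pairs_union hd, e2, mul_assoc, key, crossSign_eq_prod]
  simp only [relabelSign]
  ring

/-- The coefficient of `θ_A x^e` in `relabel φ f` is the coefficient in `f` of
`θ_{φ i_1} ⋯ θ_{φ i_k} x^{φ e}`, where `i_1 < ... < i_k` are the elements of `A` and `φ e` is `e`
transported along `φ`. For a permutation `φ`, `relabel φ f` arises from `f` by substituting
`x_{φ⁻¹ n}` for `x_n` and `θ_{φ⁻¹ n}` for `θ_n`. -/
noncomputable def relabel (φ : ℕ ↪ ℕ) (f : SSeries) : SSeries :=
  of fun A e => relabelSign φ A * coeff (A.map φ) (e.embDomain φ) f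

theorem coeff_relabel (φ : ℕ ↪ ℕ) (f : SSeries) (A : Finset ℕ) (e : ℕ →₀ ℕ) :
    coeff A e (relabel φ f) = relabelSign φ A * coeff (A.map φ) (e.embDomain φ) f := rfl

theorem relabel_add (φ : ℕ ↪ ℕ) (f g : SSeries) :
    relabel φ (f + g) = relabel φ f + relabel φ g :=
  ext fun A e => by simp only [coeff_relabel, map_add, mul_add]

theorem relabel_smul (φ : ℕ ↪ ℕ) (r : ℚ) (f : SSeries) :
    relabel φ (r • f) = r • relabel φ f :=
  ext fun A e => by rw [coeff_relabel, map_smul, map_smul, coeff_relabel]; simp only [smul_eq_mul]; ring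

theorem relabel_one (φ : ℕ ↪ ℕ) : relabel φ 1 = 1 :=
  ext fun A e => by
    rw [coeff_relabel, coeff_one, coeff_one]
    by_cases h : A = ∅
    · subst h; simp [relabelSign, pairs, Finsupp.embDomain_eq_zero]
    · simp [h]

theorem relabel_mul (φ : ℕ ↪ ℕ) (f g : SSeries) :
    relabel φ (f * g) = relabel φ f * relabel φ g :=
  ext fun A e => by
    have e1 : (A.map φ).powerset = A.powerset.image (fun B => B.map φ) := by
      ext D
      simp only [mem_powerset, mem_image, subset_map_iff, eq_comm]
    rw [coeff_relabel, coeff_mul, coeff_mul, mul_sum, e1,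
      sum_image ((map_injective φ).injOn)]
    refine sum_congr rfl fun B hB => ?_
    rw [mem_powerset] at hB
    have e2 : A.map φ \ B.map φ = (A \ B).map φ := by
      simp only [map_eq_image, image_sdiff _ _ φ.injective]
    rw [e2, ← Finsupp.image_prodMap_embDomain_antidiagonal, sum_image
      (((Finsupp.embDomain_injective φ).prodMap (Finsupp.embDomain_injective φ)).injOn), mul_sum]
    refine sum_congr rfl fun p _ => ?_
    have h := relabelSign_union φ (disjoint_sdiff (s := B) (t := A))
    rw [union_sdiff_of_subset hB] at h
    simp only [coeff_relabel, Prod.map_fst, Prod.map_snd]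
    rw [← mul_assoc, h]
    ring

/-- All monomials of `f` have degree at most `d`. -/
def Bounded (f : SSeries) (d : ℕ) : Prop :=
  ∀ A e, coeff A e f ≠ 0 → A.card + e.degree ≤ d

theorem Bounded.mono {f : SSeries} {d d' : ℕ} (h : Bounded f d) (hd : d ≤ d') : Bounded f d' :=
  fun A e hA => (h A e hA).trans hd

theorem Bounded.add {f g : SSeries} {d : ℕ} (hf : Bounded f d) (hg : Bounded g d) :
    Bounded (f + g) d := fun A e h => by
  by_contra hc
  apply h
  rw [map_add, not_imp_comm.1 (hf A e) hc, not_imp_comm.1 (hg A e) hc, add_zero]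

theorem Bounded.smul {f : SSeries} {d : ℕ} (hf : Bounded f d) (r : ℚ) :
    Bounded (r • f) d := fun A e h => by
  by_contra hc
  apply h
  rw [map_smul, not_imp_comm.1 (hf A e) hc, smul_zero]

theorem Bounded.mul {f g : SSeries} {d d' : ℕ} (hf : Bounded f d) (hg : Bounded g d') :
    Bounded (f * g) (d + d') := fun A e h => by
  rw [coeff_mul] at h
  obtain ⟨B, hB, h⟩ := exists_ne_zero_of_sum_ne_zero h
  obtain ⟨p, hp, h⟩ := exists_ne_zero_of_sum_ne_zero h
  rw [mem_powerset] at hB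
  rw [HasAntidiagonal.mem_antidiagonal] at hp
  have h1 := hf _ _ (left_ne_zero_of_mul (right_ne_zero_of_mul h))
  have h2 := hg _ _ (right_ne_zero_of_mul (right_ne_zero_of_mul h))
  have h3 : e.degree = p.1.degree + p.2.degree := by rw [← hp, map_add]
  have h4 := card_sdiff_add_card_eq_card hB
  omega

theorem bounded_one : Bounded 1 0 := fun A e h => by
  rw [coeff_one] at h
  split_ifs at h with h'
  · simp [h'.1, h'.2]
  · exact absurd rfl h

theorem coeff_relabel_congr {φ ψ : ℕ ↪ ℕ} {A : Finset ℕ} {e : ℕ →₀ ℕ}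
    (h : ∀ n ∈ A ∪ e.support, φ n = ψ n) (f : SSeries) :
    coeff A e (relabel φ f) = coeff A e (relabel ψ f) := by
  have h1 : A.map φ = A.map ψ := by
    simp only [map_eq_image]
    exact image_congr fun n hn => h n (mem_union_left _ hn)
  have h2 : e.embDomain φ = e.embDomain ψ := by
    simp only [Finsupp.embDomain_eq_mapDomain]
    exact Finsupp.mapDomain_congr fun n hn => h n (mem_union_right _ hn)
  have h3 : relabelSign φ A = relabelSign ψ A := by
    refine prod_congr rfl fun p hp => ?_
    rw [mem_pairs] at hp
    rw [h _ (mem_union_left _ hp.1), h _ (mem_union_left _ hp.2.1)]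
  rw [coeff_relabel, coeff_relabel, h1, h2, h3]

end SSeries

/-- The parts of a dotted composition: `Sum.inl n` is an undotted part `n ≥ 1`, and `Sum.inr n` is a
dotted part `n ≥ 0`. -/
abbrev DPart : Type := ℕ+ ⊕ ℕ

/-- The integer underlying a part. -/
def DPart.val : DPart → ℕ := Sum.elim (fun n => (n : ℕ)) id

namespace SSeries

/-- The indices of the `θ`'s in `θ_{i_1}^{η_1} ⋯ θ_{i_l}^{η_l} x_{i_1}^{a_1} ⋯ x_{i_l}^{a_l}`, where
`i_1 < ... < i_l` and `η_k = 1` exactly if `a_k` is dotted. -/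
def thetaSet {l : ℕ} (a : Fin l → DPart) (i : Fin l ↪o ℕ) : Finset ℕ :=
  (univ.filter fun k => (a k).isRight).map i.toEmbedding

/-- The exponents of the `x`'s in `θ_{i_1}^{η_1} ⋯ θ_{i_l}^{η_l} x_{i_1}^{a_1} ⋯ x_{i_l}^{a_l}`. -/
noncomputable def expo {l : ℕ} (a : Fin l → DPart) (i : Fin l ↪o ℕ) : ℕ →₀ ℕ :=
  ∑ k, Finsupp.single (i k) (DPart.val (a k))

/-- For every dotted composition `a = (a_1, ..., a_l)`, all monomials
`θ_{i_1}^{η_1} ⋯ θ_{i_l}^{η_l} x_{i_1}^{a_1} ⋯ x_{i_l}^{a_l}` with `i_1 < ... < i_l` have the same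
coefficient in `f`. -/
def IsQuasi (f : SSeries) : Prop :=
  ∀ (l : ℕ) (a : Fin l → DPart) (i j : Fin l ↪o ℕ),
    coeff (thetaSet a i) (expo a i) f = coeff (thetaSet a j) (expo a j) f

/-- `f` is invariant under simultaneous permutations of the `x`'s and the `θ`'s. -/
def IsSymm (f : SSeries) : Prop :=
  ∀ σ : Equiv.Perm ℕ, relabel σ.toEmbedding f = f

theorem thetaSet_map {l : ℕ} (a : Fin l → DPart) (i : Fin l ↪o ℕ) (φ : ℕ ↪o ℕ) :
    (thetaSet a i).map φ.toEmbedding = thetaSet a (i.trans φ) := by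
  rw [thetaSet, map_map]; rfl

theorem expo_map {l : ℕ} (a : Fin l → DPart) (i : Fin l ↪o ℕ) (φ : ℕ ↪o ℕ) :
    (expo a i).embDomain φ.toEmbedding = expo a (i.trans φ) := by
  rw [expo, Finsupp.embDomain_eq_mapDomain, Finsupp.mapDomain_finsetSum]
  simp only [Finsupp.mapDomain_single]
  rfl

theorem exists_eq_expo (A : Finset ℕ) (e : ℕ →₀ ℕ) :
    ∃ (l : ℕ) (a : Fin l → DPart) (i : Fin l ↪o ℕ),
      l = (A ∪ e.support).card ∧ thetaSet a i = A ∧ expo a i = e := by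
  classical
  set s := A ∪ e.support with hs
  let i : Fin s.card ↪o ℕ := s.orderEmbOfFin rfl
  let a : Fin s.card → DPart := fun k =>
    if i k ∈ A then Sum.inr (e (i k)) else Sum.inl (e (i k)).toPNat'
  have hi : univ.map i.toEmbedding = s := by
    rw [map_eq_image]; exact image_orderEmbOfFin_univ s rfl
  refine ⟨s.card, a, i, rfl, ?_, ?_⟩
  · ext n
    simp only [thetaSet, mem_map, mem_filter, mem_univ, true_and]
    constructor
    · rintro ⟨k, hk, rfl⟩
      by_contra h
      simp only [a] at hk
      rw [if_neg (show i k ∉ A from h)] at hk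
      simp at hk
    · intro hn
      have : n ∈ univ.map i.toEmbedding := by rw [hi]; exact mem_union_left _ hn
      obtain ⟨k, -, rfl⟩ := mem_map.1 this
      refine ⟨k, ?_, rfl⟩
      have h2 : i k ∈ A := hn
      simp [a, h2]
  · have hv : ∀ k, DPart.val (a k) = e (i k) := by
      intro k
      simp only [a]
      split_ifs with h
      · rfl
      · have : i k ∈ s := orderEmbOfFin_mem s rfl k
        have : i k ∈ e.support := (mem_union.1 this).resolve_left h
        have : 0 < e (i k) := Nat.pos_of_ne_zero (Finsupp.mem_support_iff.1 this)
        simp [DPart.val, Nat.toPNat'_coe, this]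
    simp only [expo, hv]
    have h1 := sum_map univ i.toEmbedding (fun n => Finsupp.single n (e n))
    rw [hi] at h1
    refine h1.symm.trans ?_
    exact Finsupp.sum_of_support_subset e (subset_union_right) (fun n m => Finsupp.single n m)
      (by simp) |>.symm.trans (Finsupp.sum_single e)

/-- An increasing sequence of length `l` is the image of `0 < 1 < ... < l - 1` under a
strictly increasing map. -/
theorem exists_extend {l : ℕ} (i : Fin l ↪o ℕ) : ∃ φ : ℕ ↪o ℕ, (Fin.valOrderEmb l).trans φ = i := by
  let b := univ.sup (fun k => i k) + 1
  have hb : ∀ k, i k < b := fun k => Nat.lt_succ_of_le (le_sup (f := fun k => i k) (mem_univ k))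
  refine ⟨OrderEmbedding.ofStrictMono (fun n => if h : n < l then i ⟨n, h⟩ else b + n) ?_, ?_⟩
  · intro m n hmn
    simp only
    split_ifs with h1 h2 h2
    · exact i.strictMono hmn
    · have := hb ⟨m, h1⟩; omega
    · omega
    · omega
  · ext k
    exact dif_pos k.2

theorem isQuasi_iff {f : SSeries} :
    IsQuasi f ↔ ∀ φ : ℕ ↪o ℕ, relabel φ.toEmbedding f = f := by
  constructor
  · intro h φ
    refine ext fun A e => ?_
    obtain ⟨l, a, i, -, rfl, rfl⟩ := exists_eq_expo A e
    rw [coeff_relabel, relabelSign_eq_one φ.strictMono, one_mul, thetaSet_map, expo_map]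
    exact h _ _ _ _
  · intro h l a
    have key : ∀ i : Fin l ↪o ℕ, coeff (thetaSet a i) (expo a i) f =
        coeff (thetaSet a (Fin.valOrderEmb l)) (expo a (Fin.valOrderEmb l)) f := by
      intro i
      obtain ⟨φ, rfl⟩ := exists_extend i
      conv_rhs => rw [← h φ]
      rw [coeff_relabel, relabelSign_eq_one φ.strictMono, one_mul, thetaSet_map, expo_map]
    exact fun i j => (key i).trans (key j).symm

theorem IsSymm.relabel_eq {f : SSeries} (hf : IsSymm f) (φ : ℕ ↪ ℕ) : relabel φ f = f := by
  refine ext fun A e => ?_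
  obtain ⟨σ, hσ⟩ := Equiv.Perm.exists_extending_pair
    (fun n : (A ∪ e.support : Finset ℕ) => (n : ℕ)) (fun n => φ n)
    Subtype.val_injective (φ.injective.comp Subtype.val_injective)
  rw [coeff_relabel_congr (ψ := σ.toEmbedding) (fun n hn => (hσ ⟨n, hn⟩).symm), hf σ]

theorem IsSymm.isQuasi {f : SSeries} (hf : IsSymm f) : IsQuasi f :=
  isQuasi_iff.2 fun φ => hf.relabel_eq φ.toEmbedding

theorem IsQuasi.mul {f g : SSeries} (hf : IsQuasi f) (hg : IsQuasi g) : IsQuasi (f * g) :=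
  isQuasi_iff.2 fun φ => by
    rw [relabel_mul, isQuasi_iff.1 hf φ, isQuasi_iff.1 hg φ]

end SSeries

open SSeries

/-- Quasisymmetric functions in superspace. -/
noncomputable def sQSym : Subalgebra ℚ SSeries where
  carrier := {f | (∃ d, Bounded f d) ∧ IsQuasi f}
  mul_mem' := by
    rintro f g ⟨⟨d, hd⟩, hf⟩ ⟨⟨d', hd'⟩, hg⟩
    exact ⟨⟨_, hd.mul hd'⟩, hf.mul hg⟩
  add_mem' := by
    rintro f g ⟨⟨d, hd⟩, hf⟩ ⟨⟨d', hd'⟩, hg⟩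
    refine ⟨⟨max d d', (hd.mono (le_max_left _ _)).add (hd'.mono (le_max_right _ _))⟩, ?_⟩
    intro l a i j
    rw [map_add, map_add, hf l a i j, hg l a i j]
  algebraMap_mem' r := by
    rw [Algebra.algebraMap_eq_smul_one]
    refine ⟨⟨0, bounded_one.smul r⟩, isQuasi_iff.2 fun φ => ?_⟩
    rw [relabel_smul, relabel_one]

/-- Symmetric functions in superspace (in infinitely many variables, of finite degree). -/
noncomputable def sSym : Subalgebra ℚ SSeries where
  carrier := {f | (∃ d, Bounded f d) ∧ IsSymm f}
  mul_mem' := by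
    rintro f g ⟨⟨d, hd⟩, hf⟩ ⟨⟨d', hd'⟩, hg⟩
    exact ⟨⟨_, hd.mul hd'⟩, fun σ => by rw [relabel_mul, hf σ, hg σ]⟩
  add_mem' := by
    rintro f g ⟨⟨d, hd⟩, hf⟩ ⟨⟨d', hd'⟩, hg⟩
    exact ⟨⟨max d d', (hd.mono (le_max_left _ _)).add (hd'.mono (le_max_right _ _))⟩,
      fun σ => by rw [relabel_add, hf σ, hg σ]⟩
  algebraMap_mem' r := by
    rw [Algebra.algebraMap_eq_smul_one]
    exact ⟨⟨0, bounded_one.smul r⟩, fun σ => by rw [relabel_smul, relabel_one]⟩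

theorem sSym_le_sQSym : sSym ≤ sQSym := fun _ hf => ⟨hf.1, hf.2.isQuasi⟩

namespace SSeries

/-- A pair `(A, e)` stands for the monomial `θ_A x^e`. -/
abbrev Mon : Type := Finset ℕ × (ℕ →₀ ℕ)

theorem degree_expo {l : ℕ} (a : Fin l → DPart) (i : Fin l ↪o ℕ) :
    (expo a i).degree = ∑ k, DPart.val (a k) := by
  rw [expo, map_sum]; simp

theorem card_support_le (e : ℕ →₀ ℕ) : e.support.card ≤ e.degree := by
  rw [Finsupp.degree_apply, card_eq_sum_ones]
  exact sum_le_sum fun n hn => Nat.pos_of_ne_zero (Finsupp.mem_support_iff.1 hn)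

/-- A finite set of monomials that determines a quasisymmetric series of degree at most `d`. -/
noncomputable def testSet (d : ℕ) : Finset Mon :=
  (range d).powerset ×ˢ Finset.finsupp (range d) (fun _ => range (d + 1))

theorem IsQuasi.eq_zero {f : SSeries} {d : ℕ} (hf : IsQuasi f) (hd : Bounded f d)
    (h : ∀ u ∈ testSet d, coeff u.1 u.2 f = 0) : f = 0 := by
  refine ext fun A e => ?_
  rw [map_zero]
  by_cases hw : A.card + e.degree ≤ d
  · obtain ⟨l, a, i, hl, rfl, rfl⟩ := exists_eq_expo A e
    have hld : l ≤ d := by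
      have h1 := card_union_le (thetaSet a i) (expo a i).support
      have h2 := card_support_le (expo a i)
      omega
    rw [hf l a i (Fin.valOrderEmb l)]
    refine h (thetaSet a (Fin.valOrderEmb l), expo a (Fin.valOrderEmb l)) ?_
    rw [testSet, mem_product]
    refine ⟨?_, ?_⟩
    · rw [mem_powerset]
      intro n hn
      obtain ⟨k, -, rfl⟩ := mem_map.1 hn
      exact mem_range.2 (lt_of_lt_of_le k.2 hld)
    · rw [Finset.mem_finsupp_iff]
      constructor
      · intro n hn
        have hn' := Finsupp.support_finsetSum hn
        obtain ⟨k, -, hk⟩ := mem_biUnion.1 hn'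
        have := mem_singleton.1 (Finsupp.support_single_subset hk)
        subst this
        exact mem_range.2 (lt_of_lt_of_le k.2 hld)
      · intro n _
        have h1 := Finsupp.le_degree n (expo a (Fin.valOrderEmb l))
        rw [degree_expo, ← degree_expo a i] at h1
        exact mem_range.2 (Nat.lt_succ_of_le (h1.trans (by omega)))
  · exact not_imp_comm.1 (hd A e) hw

open TensorProduct

/-- The identification of tensors with series in two alphabets, `f ⊗ g ↦ f(x; θ) g(y; φ)`. A series in
two alphabets, where `θ`'s and `φ`'s anticommute, is given by the coefficients of the monomials
`θ_A φ_B x^e y^e'`, indexed by `u = (A, e)` and `v = (B, e')`. -/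
noncomputable def twoAlphabet (V : Subalgebra ℚ SSeries) : V ⊗[ℚ] V →ₗ[ℚ] (Mon → Mon → ℚ) :=
  TensorProduct.lift <| LinearMap.mk₂ ℚ
    (fun (f g : V) (u v : Mon) => coeff u.1 u.2 (f : SSeries) * coeff v.1 v.2 (g : SSeries))
    (fun f f' g => by
      funext u v; simp only [Subalgebra.coe_add, map_add, Pi.add_apply, add_mul])
    (fun r f g => by
      funext u v; simp only [Subalgebra.coe_smul, map_smul, Pi.smul_apply, smul_eq_mul, mul_assoc])
    (fun f g g' => by
      funext u v; simp only [Subalgebra.coe_add, map_add, Pi.add_apply, mul_add])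
    (fun r f g => by
      funext u v
      simp only [Subalgebra.coe_smul, map_smul, Pi.smul_apply, smul_eq_mul, mul_left_comm])

theorem twoAlphabet_tmul (V : Subalgebra ℚ SSeries) (f g : V) (u v : Mon) :
    twoAlphabet V (f ⊗ₜ g) u v =
      coeff u.1 u.2 (f : SSeries) * coeff v.1 v.2 (g : SSeries) := rfl

theorem twoAlphabet_injective (V : Subalgebra ℚ SSeries) :
    Function.Injective (twoAlphabet V) := by
  rw [injective_iff_map_eq_zero]
  intro t ht
  let b := Module.Basis.ofVectorSpace ℚ V
  obtain ⟨c, rfl⟩ : ∃ c : _ →₀ V, (c.sum fun i g => b i ⊗ₜ[ℚ] g) = t := by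
    obtain ⟨c, hc⟩ := TensorProduct.eq_repr_basis_left b t
    exact ⟨c, hc⟩
  have hc : c = 0 := by
    ext1 i
    refine Subtype.ext (ext fun A e => ?_)
    have h0 : ∑ i ∈ c.support, coeff A e (c i : SSeries) • b i = 0 := by
      refine Subtype.ext (ext fun A' e' => ?_)
      have := congr_fun (congr_fun ht (A', e')) (A, e)
      rw [Finsupp.sum, map_sum, Finset.sum_apply, Finset.sum_apply] at this
      simp only [twoAlphabet_tmul] at this
      rw [AddSubmonoidClass.coe_finsetSum, map_sum]
      simp only [Subalgebra.coe_smul, map_smul, smul_eq_mul]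
      rw [Subalgebra.coe_zero, map_zero]
      simpa only [mul_comm, Pi.zero_apply] using this
    by_cases hi : i ∈ c.support
    · exact linearIndependent_iff'.1 b.linearIndependent _ _ h0 i hi
    · simp [Finsupp.notMem_support_iff.1 hi]
  rw [hc, Finsupp.sum_zero_index]

/-- A criterion for a series in two alphabets to come from a tensor. -/
theorem exists_twoAlphabet_eq (V : Subalgebra ℚ SSeries) (hV : V ≤ sQSym) (d : ℕ)
    (h : Mon → Mon → ℚ)
    (hl : ∀ v, ∃ g ∈ V, Bounded g d ∧ ∀ u, coeff u.1 u.2 g = h u v)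
    (hr : ∀ u, ∃ g ∈ V, ∀ v, coeff v.1 v.2 g = h u v) :
    ∃ t, twoAlphabet V t = h := by
  classical
  let F : Submodule ℚ V :=
    { carrier := {g | Bounded (g : SSeries) d}
      add_mem' := fun ha hb => ha.add hb
      zero_mem' := fun A e hne => absurd (map_zero _) hne
      smul_mem' := fun r g hg => Bounded.smul hg r }
  let ev : Mon → Module.Dual ℚ F := fun u =>
    (coeff u.1 u.2) ∘ₗ V.toSubmodule.subtype ∘ₗ F.subtype
  have hfin : Module.Finite ℚ F := by
    let T : F →ₗ[ℚ] (testSet d → ℚ) := LinearMap.pi fun u => ev u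
    refine Module.Finite.of_injective T ((injective_iff_map_eq_zero T).2 fun g hg => ?_)
    refine Subtype.ext (Subtype.ext ?_)
    refine IsQuasi.eq_zero (d := d) (hV g.1.2).2 g.2 fun u hu => ?_
    exact congr_fun hg ⟨u, hu⟩
  have hspan : Submodule.span ℚ (Set.range ev) = ⊤ := by
    have h1 : (Submodule.span ℚ (Set.range ev)).dualCoannihilator = ⊥ := by
      rw [eq_bot_iff]
      intro g hg
      rw [Submodule.mem_dualCoannihilator] at hg
      refine Subtype.ext (Subtype.ext (ext fun A e => ?_))
      exact hg (ev (A, e)) (Submodule.subset_span ⟨(A, e), rfl⟩)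
    rw [← Subspace.dualCoannihilator_dualAnnihilator_eq
      (W := Submodule.span ℚ (Set.range ev)), h1, Submodule.dualAnnihilator_bot]
  choose gl hglV hgld hgl using hl
  choose gr hgrV hgr using hr
  let b := Module.finBasis ℚ F
  let w : Mon → F := fun v => ⟨⟨gl v, hglV v⟩, hgld v⟩
  have hk : ∀ ξ : Module.Dual ℚ F, ∃ g ∈ V, ∀ v : Mon, coeff v.1 v.2 g = ξ (w v) := by
    intro ξ
    have hξ : ξ ∈ Submodule.span ℚ (Set.range ev) := by rw [hspan]; trivial
    induction hξ using Submodule.span_induction with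
    | mem x hx =>
      obtain ⟨u, rfl⟩ := hx
      exact ⟨gr u, hgrV u, fun v => (hgr u v).trans (hgl v u).symm⟩
    | zero => exact ⟨0, V.zero_mem, fun v => map_zero _⟩
    | add x y _ _ hx hy =>
      obtain ⟨g, hg, h1⟩ := hx
      obtain ⟨g', hg', h2⟩ := hy
      exact ⟨g + g', V.add_mem hg hg', fun v => by
        rw [map_add, h1, h2, LinearMap.add_apply]⟩
    | smul r x _ hx =>
      obtain ⟨g, hg, h1⟩ := hx
      exact ⟨r • g, V.smul_mem hg r, fun v => by rw [map_smul, h1, LinearMap.smul_apply]⟩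
  choose g hgV hg using fun k => hk (b.coord k)
  refine ⟨∑ k, (b k : V) ⊗ₜ[ℚ] ⟨g k, hgV k⟩, ?_⟩
  funext u v
  rw [map_sum, Finset.sum_apply, Finset.sum_apply]
  simp only [twoAlphabet_tmul, hg]
  have h1 := congrArg (ev u) (b.sum_repr (w v))
  rw [map_sum] at h1
  simp only [map_smul, smul_eq_mul] at h1
  refine Eq.trans ?_ (h1.trans (hgl v u))
  exact sum_congr rfl fun k _ => mul_comm _ _

/-- A number that exceeds all indices occurring in the monomial `u`. -/
def bound (u : Mon) : ℕ := (u.1 ∪ u.2.support).sup Nat.succ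

theorem lt_bound {u : Mon} {n : ℕ} (hn : n ∈ u.1 ∪ u.2.support) : n < bound u :=
  le_sup (f := Nat.succ) hn

/-- The monomial obtained from `u` and `v` after raising all indices in `v` by `N`. -/
noncomputable def juxt (N : ℕ) (u v : Mon) : Mon :=
  (u.1 ∪ v.1.map (addRightEmbedding N), u.2 + v.2.embDomain (addRightEmbedding N))

/-- The series `f(x, y; θ, φ)` in two alphabets, where all variables of the first alphabet precede those
of the second one: its coefficient at `θ_A φ_B x^e y^e'` is the coefficient in `f` of the monomial
in which the variables of the second alphabet are moved behind those occurring in `θ_A x^e`. For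
quasisymmetric `f` any order-preserving way to place the variables gives the same coefficient. -/
noncomputable def split : SSeries →ₗ[ℚ] (Mon → Mon → ℚ) where
  toFun f u v := coeff (juxt (bound u) u v).1 (juxt (bound u) u v).2 f
  map_add' f g := by funext u v; exact map_add _ _ _
  map_smul' r f := by funext u v; exact map_smul _ _ _

theorem split_apply (f : SSeries) (u v : Mon) :
    split f u v = coeff (juxt (bound u) u v).1 (juxt (bound u) u v).2 f := rfl

/-- `φ` on the numbers below `N`, and `χ`, suitably shifted, on the others. -/
def glue (φ χ : ℕ ↪ ℕ) (N M : ℕ) (h : ∀ n < N, φ n < M) : ℕ ↪ ℕ where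
  toFun n := if n < N then φ n else χ (n - N) + M
  inj' m n hmn := by
    simp only at hmn
    split_ifs at hmn with h1 h2 h2
    · exact φ.injective hmn
    · have := h m h1; omega
    · have := h n h2; omega
    · have := χ.injective (Nat.add_right_cancel hmn); omega

theorem glue_of_lt {φ χ : ℕ ↪ ℕ} {N M : ℕ} {h : ∀ n < N, φ n < M} {n : ℕ} (hn : n < N) :
    glue φ χ N M h n = φ n := if_pos hn

theorem glue_add {φ χ : ℕ ↪ ℕ} {N M : ℕ} {h : ∀ n < N, φ n < M} (n : ℕ) :
    glue φ χ N M h (n + N) = χ n + M := by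
  change (if n + N < N then _ else _) = _
  rw [if_neg (by omega), Nat.add_sub_cancel]

theorem glue_strictMono {φ χ : ℕ ↪ ℕ} {N M : ℕ} {h : ∀ n < N, φ n < M} (hφ : StrictMono φ)
    (hχ : StrictMono χ) : StrictMono (glue φ χ N M h) := by
  intro m n hmn
  by_cases h1 : m < N
  · by_cases h2 : n < N
    · rw [glue_of_lt h1, glue_of_lt h2]; exact hφ hmn
    · obtain ⟨k, rfl⟩ := Nat.exists_eq_add_of_le' (not_lt.1 h2)
      rw [glue_of_lt h1, glue_add]; have := h m h1; omega
  · obtain ⟨k, rfl⟩ := Nat.exists_eq_add_of_le' (not_lt.1 h1)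
    obtain ⟨k', rfl⟩ := Nat.exists_eq_add_of_le' (show N ≤ n by omega)
    rw [glue_add, glue_add]
    have := hχ (show k < k' by omega)
    omega

/-- The monomial `u` with its indices renamed along `φ`. -/
noncomputable def mapMon (φ : ℕ ↪ ℕ) (u : Mon) : Mon := (u.1.map φ, u.2.embDomain φ)

theorem embDomain_congr' {φ ψ : ℕ ↪ ℕ} {e : ℕ →₀ ℕ} (h : ∀ n ∈ e.support, φ n = ψ n) :
    e.embDomain φ = e.embDomain ψ := by
  simp only [Finsupp.embDomain_eq_mapDomain]
  exact Finsupp.mapDomain_congr h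

theorem mapMon_glue_juxt {φ χ : ℕ ↪ ℕ} {N M : ℕ} {h : ∀ n < N, φ n < M} {u v : Mon}
    (hu : bound u ≤ N) :
    mapMon (glue φ χ N M h) (juxt N u v) = juxt M (mapMon φ u) (mapMon χ v) := by
  have hlt : ∀ n ∈ u.1 ∪ u.2.support, n < N := fun n hn => (lt_bound hn).trans_le hu
  have hcomp : (addRightEmbedding N).trans (glue φ χ N M h) =
      χ.trans (addRightEmbedding M) := by
    ext n; exact glue_add (h := h) n
  refine Prod.ext ?_ ?_
  · simp only [mapMon, juxt, map_union, Finset.map_map, hcomp]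
    congr 1
    simp only [map_eq_image]
    exact image_congr fun n hn => glue_of_lt (hlt n (mem_union_left _ hn))
  · simp only [mapMon, juxt, Finsupp.embDomain_add, ← Finsupp.embDomain_trans_apply, hcomp]
    congr 1
    exact embDomain_congr' fun n hn => glue_of_lt (hlt n (mem_union_right _ hn))

theorem relabelSign_glue {φ χ : ℕ ↪ ℕ} {N M : ℕ} {h : ∀ n < N, φ n < M} {u v : Mon}
    (hu : bound u ≤ N) :
    relabelSign (glue φ χ N M h) (juxt N u v).1 = relabelSign φ u.1 * relabelSign χ v.1 := by
  have hlt : ∀ n ∈ u.1, n < N := fun n hn => (lt_bound (mem_union_left _ hn)).trans_le hu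
  have hd : Disjoint u.1 (v.1.map (addRightEmbedding N)) := by
    rw [disjoint_left]
    intro n hn hn'
    obtain ⟨m, -, rfl⟩ := mem_map.1 hn'
    have := hlt _ hn
    simp only [addRightEmbedding_apply] at this
    omega
  have key := relabelSign_union (glue φ χ N M h) hd
  have c1 : crossSign u.1 (v.1.map (addRightEmbedding N)) = 1 := by
    refine prod_eq_one fun b hb => prod_eq_one fun c hc => if_neg ?_
    obtain ⟨m, -, rfl⟩ := mem_map.1 hc
    have := hlt b hb
    simp only [addRightEmbedding_apply]
    omega
  have c2 : crossSign (u.1.map (glue φ χ N M h))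
      ((v.1.map (addRightEmbedding N)).map (glue φ χ N M h)) = 1 := by
    refine prod_eq_one fun b hb => prod_eq_one fun c hc => if_neg ?_
    obtain ⟨b, hb', rfl⟩ := mem_map.1 hb
    obtain ⟨m, hm, rfl⟩ := mem_map.1 hc
    obtain ⟨m, -, rfl⟩ := mem_map.1 hm
    have := h b (hlt b hb')
    rw [glue_of_lt (hlt b hb'), addRightEmbedding_apply, glue_add]
    omega
  have s1 : relabelSign (glue φ χ N M h) u.1 = relabelSign φ u.1 := by
    refine prod_congr rfl fun p hp => ?_
    rw [mem_pairs] at hp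
    rw [glue_of_lt (hlt _ hp.1), glue_of_lt (hlt _ hp.2.1)]
  have s2 : relabelSign (glue φ χ N M h) (v.1.map (addRightEmbedding N)) =
      relabelSign χ v.1 := by
    have e : pairs (v.1.map (addRightEmbedding N)) =
        (pairs v.1).map ((addRightEmbedding N).prodMap (addRightEmbedding N)) := by
      ext ⟨i, j⟩
      simp only [mem_pairs, mem_map, Prod.exists, Function.Embedding.prodMap, addRightEmbedding,
        Function.Embedding.coeFn_mk, Prod.map_apply, Prod.mk.injEq]
      constructor
      · rintro ⟨⟨i, hi, rfl⟩, ⟨j, hj, rfl⟩, hij⟩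
        exact ⟨i, j, ⟨hi, hj, by omega⟩, rfl, rfl⟩
      · rintro ⟨i, j, ⟨hi, hj, hij⟩, rfl, rfl⟩
        exact ⟨⟨i, hi, rfl⟩, ⟨j, hj, rfl⟩, by omega⟩
    rw [relabelSign, e, prod_map]
    refine prod_congr rfl fun p _ => ?_
    simp only [Function.Embedding.prodMap, Function.Embedding.coeFn_mk, Prod.map_fst,
      Prod.map_snd, addRightEmbedding_apply, glue_add, Nat.add_lt_add_iff_right]
  rw [c1, c2, s1, s2, mul_one, one_mul] at key
  exact key

theorem coeff_relabel' (φ : ℕ ↪ ℕ) (f : SSeries) (u : Mon) :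
    coeff u.1 u.2 (relabel φ f) =
      relabelSign φ u.1 * coeff (mapMon φ u).1 (mapMon φ u).2 f := rfl

theorem mapMon_refl (u : Mon) : mapMon (Function.Embedding.refl ℕ) u = u := by
  simp [mapMon, Finsupp.embDomain_refl]

/-- The coefficient of `f(x, y; θ, φ)` does not depend on how far the second alphabet is shifted. -/
theorem split_eq_of_le {f : SSeries} (hf : IsQuasi f) {u v : Mon} {N : ℕ} (hN : bound u ≤ N) :
    split f u v = coeff (juxt N u v).1 (juxt N u v).2 f := by
  let r := Function.Embedding.refl ℕ
  have hr : ∀ n < bound u, r n < N := fun n hn => hn.trans_le hN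
  have hm : StrictMono (glue r r (bound u) N hr) :=
    glue_strictMono strictMono_id strictMono_id
  have h := congrArg (coeff (juxt (bound u) u v).1 (juxt (bound u) u v).2)
    (isQuasi_iff.1 hf (OrderEmbedding.ofStrictMono _ hm))
  rw [split_apply, ← h, coeff_relabel', relabelSign_eq_one (OrderEmbedding.strictMono _), one_mul]
  have e : (OrderEmbedding.ofStrictMono _ hm).toEmbedding =
    glue r r (bound u) N hr := rfl
  rw [e, mapMon_glue_juxt le_rfl, mapMon_refl, mapMon_refl]

theorem split_mapMon {f : SSeries} (hf : IsQuasi f) {φ χ : ℕ ↪ ℕ}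
    (h : ∀ N M hh, relabel (glue φ χ N M hh) f = f) (u v : Mon) :
    relabelSign φ u.1 * relabelSign χ v.1 * split f (mapMon φ u) (mapMon χ v) = split f u v := by
  let N := bound u
  let M := max (bound (mapMon φ u)) ((range N).sup fun n => φ n + 1)
  have hM : ∀ n < N, φ n < M := fun n hn =>
    lt_of_lt_of_le (Nat.lt_succ_self _) ((le_sup (f := fun n => φ n + 1)
      (mem_range.2 hn)).trans (le_max_right _ _))
  rw [split_eq_of_le hf (N := M) (le_max_left _ _),
    ← mapMon_glue_juxt (h := hM) (le_refl (bound u)),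
    ← relabelSign_glue (h := hM) (le_refl (bound u)), ← coeff_relabel', h, split_apply]

/-- The coefficient of the monomial `v` of the second alphabet in `f(x, y; θ, φ)`. -/
noncomputable def leftSlice (f : SSeries) (v : Mon) : SSeries := of fun A e => split f (A, e) v
/-- The coefficient of the monomial `u` of the first alphabet in `f(x, y; θ, φ)`. -/
noncomputable def rightSlice (f : SSeries) (u : Mon) : SSeries := of fun A e => split f u (A, e)

theorem leftSlice_relabel {f : SSeries} (hf : IsQuasi f) {φ : ℕ ↪ ℕ}
    (h : ∀ N M hh, relabel (glue φ (Function.Embedding.refl ℕ) N M hh) f = f) (v : Mon) :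
    relabel φ (leftSlice f v) = leftSlice f v := ext fun A e => by
  have := split_mapMon hf h (A, e) v
  rw [mapMon_refl, relabelSign_eq_one (φ := Function.Embedding.refl ℕ) strictMono_id, mul_one] at this
  exact this

theorem rightSlice_relabel {f : SSeries} (hf : IsQuasi f) {χ : ℕ ↪ ℕ}
    (h : ∀ N M hh, relabel (glue (Function.Embedding.refl ℕ) χ N M hh) f = f) (u : Mon) :
    relabel χ (rightSlice f u) = rightSlice f u := ext fun A e => by
  have := split_mapMon hf h u (A, e)
  rw [mapMon_refl, relabelSign_eq_one (φ := Function.Embedding.refl ℕ) strictMono_id, one_mul] at this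
  exact this

theorem juxt_weight (u v : Mon) : (juxt (bound u) u v).1.card + (juxt (bound u) u v).2.degree =
    (u.1.card + u.2.degree) + (v.1.card + v.2.degree) := by
  have hd : Disjoint u.1 (v.1.map (addRightEmbedding (bound u))) := by
    rw [disjoint_left]
    intro n hn hn'
    obtain ⟨m, -, rfl⟩ := mem_map.1 hn'
    have := lt_bound (u := u) (mem_union_left _ hn)
    simp only [addRightEmbedding_apply] at this
    omega
  simp only [juxt, card_union_of_disjoint hd, card_map, map_add, Finsupp.embDomain_eq_mapDomain,
    Finsupp.degree_mapDomain]
  omega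

theorem leftSlice_bounded {f : SSeries} {d : ℕ} (hd : Bounded f d) (v : Mon) :
    Bounded (leftSlice f v) d := fun A e hne => by
  have h1 := hd _ _ (show coeff _ _ f ≠ 0 from hne)
  rw [juxt_weight] at h1
  exact le_of_add_le_left h1

theorem rightSlice_bounded {f : SSeries} {d : ℕ} (hd : Bounded f d) (u : Mon) :
    Bounded (rightSlice f u) d := fun A e hne => by
  have h1 := hd _ _ (show coeff _ _ f ≠ 0 from hne)
  rw [juxt_weight] at h1
  exact le_of_add_le_right h1

/-- A property that guarantees that `f(x, y; θ, φ)` lies in `V ⊗ V` for `f ∈ V`. -/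
def SplitClosed (V : Subalgebra ℚ SSeries) : Prop :=
  V ≤ sQSym ∧ ∀ f ∈ V, ∀ u, leftSlice f u ∈ V ∧ rightSlice f u ∈ V

theorem splitClosed_sQSym : SplitClosed sQSym := by
  refine ⟨le_rfl, ?_⟩
  rintro f ⟨⟨d, hd⟩, hf⟩ u
  have key : ∀ (φ χ : ℕ ↪ ℕ), StrictMono φ → StrictMono χ → ∀ N M hh,
      relabel (glue φ χ N M hh) f = f := fun φ χ hφ hχ N M hh =>
    isQuasi_iff.1 hf (OrderEmbedding.ofStrictMono _ (glue_strictMono (h := hh) hφ hχ))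
  exact ⟨⟨⟨d, leftSlice_bounded hd u⟩, isQuasi_iff.2 fun φ =>
      leftSlice_relabel hf (key _ _ φ.strictMono strictMono_id) u⟩,
    ⟨⟨d, rightSlice_bounded hd u⟩, isQuasi_iff.2 fun φ =>
      rightSlice_relabel hf (key _ _ strictMono_id φ.strictMono) u⟩⟩

theorem splitClosed_sSym : SplitClosed sSym := by
  refine ⟨sSym_le_sQSym, ?_⟩
  rintro f ⟨⟨d, hd⟩, hf⟩ u
  exact ⟨⟨⟨d, leftSlice_bounded hd u⟩, fun σ =>
      leftSlice_relabel hf.isQuasi (fun _ _ _ => hf.relabel_eq _) u⟩,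
    ⟨⟨d, rightSlice_bounded hd u⟩, fun σ =>
      rightSlice_relabel hf.isQuasi (fun _ _ _ => hf.relabel_eq _) u⟩⟩

theorem split_mem_range {V : Subalgebra ℚ SSeries} (hV : SplitClosed V) (f : V) :
    split (f : SSeries) ∈ LinearMap.range (twoAlphabet V) := by
  obtain ⟨⟨d, hd⟩, -⟩ := hV.1 f.2
  exact exists_twoAlphabet_eq V hV.1 d _
    (fun v => ⟨leftSlice f v, (hV.2 f f.2 v).1, leftSlice_bounded hd v, fun _ => rfl⟩)
    (fun u => ⟨rightSlice f u, (hV.2 f f.2 u).2, fun _ => rfl⟩)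

/-- The coproduct: `Δ f` is the element of `V ⊗ V` that corresponds to `f(x, y; θ, φ)`. -/
noncomputable def comul {V : Subalgebra ℚ SSeries} (hV : SplitClosed V) : V →ₗ[ℚ] V ⊗[ℚ] V :=
  (LinearEquiv.ofInjective (twoAlphabet V) (twoAlphabet_injective V)).symm.toLinearMap ∘ₗ
    LinearMap.codRestrict (LinearMap.range (twoAlphabet V)) (split ∘ₗ V.toSubmodule.subtype)
      (split_mem_range hV)

theorem twoAlphabet_comul {V : Subalgebra ℚ SSeries} (hV : SplitClosed V) (f : V) :
    twoAlphabet V (comul hV f) = split (f : SSeries) :=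
  congrArg Subtype.val ((LinearEquiv.ofInjective (twoAlphabet V)
    (twoAlphabet_injective V)).apply_symm_apply ⟨split (f : SSeries), split_mem_range hV f⟩)

/-- The counit: the constant term. -/
noncomputable def counit (V : Subalgebra ℚ SSeries) : V →ₗ[ℚ] ℚ :=
  coeff ∅ 0 ∘ₗ V.toSubmodule.subtype

/-- The parity map, `f ↦ (-1)^m f` for `f` of fermionic degree `m`. -/
noncomputable def parity : SSeries →ₗ[ℚ] SSeries where
  toFun f := of fun A e => (-1) ^ A.card * coeff A e f
  map_add' f g := ext fun A e => by simp only [coeff_of, map_add, mul_add]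
  map_smul' r f := ext fun A e => by
    simp only [coeff_of, map_smul, smul_eq_mul, RingHom.id_apply]; ring

theorem coeff_parity (f : SSeries) (A : Finset ℕ) (e : ℕ →₀ ℕ) :
    coeff A e (parity f) = (-1) ^ A.card * coeff A e f := rfl

theorem relabel_parity (φ : ℕ ↪ ℕ) (f : SSeries) : relabel φ (parity f) = parity (relabel φ f) :=
  ext fun A e => by simp only [coeff_relabel, coeff_parity, card_map]; ring

theorem Bounded.parity {f : SSeries} {d : ℕ} (hf : Bounded f d) : Bounded (parity f) d :=
  fun A e h => hf A e (right_ne_zero_of_mul h)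

theorem parity_mem_sQSym (f : SSeries) (hf : f ∈ sQSym) : parity f ∈ sQSym :=
  ⟨hf.1.imp fun _ hd => hd.parity, isQuasi_iff.2 fun φ => by
    rw [relabel_parity, isQuasi_iff.1 hf.2 φ]⟩

theorem parity_mem_sSym (f : SSeries) (hf : f ∈ sSym) : parity f ∈ sSym :=
  ⟨hf.1.imp fun _ hd => hd.parity, fun σ => by rw [relabel_parity, hf.2 σ]⟩

end SSeries

open TensorProduct

namespace SSeries

theorem mem_sQSym {f : SSeries} : f ∈ sQSym ↔ (∃ d, Bounded f d) ∧ IsQuasi f := Iff.rfl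

theorem expo_apply {l : ℕ} (a : Fin l → DPart) (i : Fin l ↪o ℕ) (k : Fin l) :
    expo a i (i k) = DPart.val (a k) := by
  rw [expo, Finsupp.finsetSum_apply, sum_eq_single k]
  · simp
  · intro k' _ hne
    exact Finsupp.single_eq_of_ne fun h => hne (i.injective h).symm
  · intro h; exact absurd (mem_univ k) h

/-- The indices occurring in a monomial of shape `a` at positions `i` are exactly the `i k`. -/
theorem mem_of_shape {l : ℕ} (a : Fin l → DPart) (i : Fin l ↪o ℕ) (k : Fin l) :
    i k ∈ thetaSet a i ∪ (expo a i).support := by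
  rw [mem_union]
  rcases h : a k with n | n
  · right
    rw [Finsupp.mem_support_iff, expo_apply, h]
    exact n.ne_zero
  · left
    exact mem_map.2 ⟨k, by simp [h], rfl⟩

open Classical in
/-- The monomial quasisymmetric series: the sum over `i_1 < ... < i_l` of
`θ_{i_1}^{η_1} ⋯ θ_{i_l}^{η_l} x_{i_1}^{a_1} ⋯ x_{i_l}^{a_l}`. -/
noncomputable def monoSeries {l : ℕ} (a : Fin l → DPart) : SSeries :=
  of fun A e => if ∃ i : Fin l ↪o ℕ, thetaSet a i = A ∧ expo a i = e then 1 else 0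

theorem monoSeries_mem {l : ℕ} (a : Fin l → DPart) : monoSeries a ∈ sQSym := by
  refine ⟨⟨l + ∑ k, DPart.val (a k), fun A e h => ?_⟩, isQuasi_iff.2 fun φ => ext fun A e => ?_⟩
  · rw [monoSeries, coeff_of] at h
    split_ifs at h with h'
    · obtain ⟨i, rfl, rfl⟩ := h'
      rw [degree_expo, thetaSet, card_map]
      have := card_filter_le (univ : Finset (Fin l)) fun k => (a k).isRight = true
      rw [card_univ, Fintype.card_fin] at this
      omega
    · exact absurd rfl h
  · rw [coeff_relabel, relabelSign_eq_one φ.strictMono, one_mul, monoSeries, coeff_of, coeff_of]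
    congr 1
    refine propext ⟨?_, ?_⟩
    · rintro ⟨i, hA, he⟩
      have hr : ∀ k, ∃ n, φ n = i k := by
        intro k
        have h := mem_of_shape a i k
        rw [hA, he, Finsupp.support_embDomain, ← map_union, mem_map] at h
        obtain ⟨n, -, hn⟩ := h
        exact ⟨n, hn⟩
      choose j hj using hr
      have hjm : StrictMono j := fun k k' hk => by
        rw [← φ.lt_iff_lt, hj, hj]; exact i.strictMono hk
      have hi : (OrderEmbedding.ofStrictMono j hjm).trans φ = i := by
        ext k; exact hj k
      refine ⟨OrderEmbedding.ofStrictMono j hjm, ?_, ?_⟩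
      · rw [← hi, ← thetaSet_map] at hA
        exact map_injective _ hA
      · rw [← hi, ← expo_map] at he
        exact Finsupp.embDomain_injective _ he
    · rintro ⟨i, rfl, rfl⟩
      exact ⟨i.trans φ, (thetaSet_map a i φ).symm, (expo_map a i φ).symm⟩

end SSeries

/-- A superpartition: the set `anti` of the (distinct) parts of `Λ^a`, and the multiset `sym` of the
(positive) parts of `Λ^s`. -/
structure SPar where
  anti : Finset ℕ
  sym : Multiset ℕ
  pos : ∀ n ∈ sym, 0 < n

namespace SSeries

open Classical in
/-- The monomial symmetric function: the sum of all distinct terms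
`θ_{σ 1} ⋯ θ_{σ m} x_{σ 1}^{Λ_1} x_{σ 2}^{Λ_2} ⋯`, where `Λ_1 > ... > Λ_m` are the parts of `Λ^a` and
`Λ_{m+1}, Λ_{m+2}, ...` those of `Λ^s`, followed by zeros. The term with monomial `θ_A x^e` is the one
where `A = {σ 1, ..., σ m}` and the exponents decrease along `σ 1, ..., σ m`; sorting its `θ`'s by
index gives the sign below. -/
noncomputable def symMono (Λ : SPar) : SSeries :=
  of fun A e => if A.val.map e = Λ.anti.val ∧ (e.support \ A).val.map e = Λ.sym then
    ∏ p ∈ pairs A, if e p.2 < e p.1 then 1 else -1 else 0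

theorem prod_pairs_map (φ : ℕ ↪ ℕ) (A : Finset ℕ) (F : ℕ × ℕ → ℚ) :
    ∏ p ∈ pairs (A.map φ), F p =
      ∏ p ∈ pairs A, F (if φ p.1 < φ p.2 then (φ p.1, φ p.2) else (φ p.2, φ p.1)) := by
  symm
  refine prod_bij (fun p _ => if φ p.1 < φ p.2 then (φ p.1, φ p.2) else (φ p.2, φ p.1))
    ?_ ?_ ?_ fun _ _ => rfl
  · rintro ⟨i, j⟩ h
    rw [mem_pairs] at h
    have hne : φ i ≠ φ j := fun he => h.2.2.ne (φ.injective he)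
    split_ifs with hlt
    · exact mem_pairs.2 ⟨mem_map_of_mem _ h.1, mem_map_of_mem _ h.2.1, hlt⟩
    · exact mem_pairs.2 ⟨mem_map_of_mem _ h.2.1, mem_map_of_mem _ h.1,
        lt_of_le_of_ne (not_lt.1 hlt) hne.symm⟩
  · rintro ⟨i, j⟩ h ⟨i', j'⟩ h' he
    rw [mem_pairs] at h h'
    simp only at h h' he
    split_ifs at he <;> simp only [Prod.mk.injEq, φ.injective.eq_iff] at he <;>
      obtain ⟨rfl, rfl⟩ := he
    · rfl
    · omega
    · omega
    · rfl
  · rintro ⟨i, j⟩ h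
    obtain ⟨hi, hj, hij⟩ := mem_pairs.1 h
    obtain ⟨i, hi', rfl⟩ := mem_map.1 hi
    obtain ⟨j, hj', rfl⟩ := mem_map.1 hj
    rcases lt_trichotomy i j with hlt | rfl | hlt
    · exact ⟨(i, j), mem_pairs.2 ⟨hi', hj', hlt⟩, if_pos hij⟩
    · exact absurd hij (lt_irrefl _)
    · exact ⟨(j, i), mem_pairs.2 ⟨hj', hi', hlt⟩, if_neg (not_lt.2 (le_of_lt hij))⟩

theorem symMono_mem (Λ : SPar) : symMono Λ ∈ sSym := by
  refine ⟨⟨Λ.anti.card + (Λ.anti.val.sum + Λ.sym.sum), fun A e h => ?_⟩,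
    fun σ => ext fun A e => ?_⟩
  · rw [symMono, coeff_of] at h
    split_ifs at h with h'
    · have h1 : A.card = Λ.anti.card := by
        have := congrArg Multiset.card h'.1
        rwa [Multiset.card_map] at this
      have h2 : e.degree = ∑ n ∈ A, e n + ∑ n ∈ e.support \ A, e n := by
        rw [Finsupp.degree_apply, ← sum_union disjoint_sdiff]
        refine sum_subset (fun n hn => by simp only [mem_union, mem_sdiff]; tauto) ?_
        intro n _ hn
        exact Finsupp.notMem_support_iff.1 hn
      rw [h1, h2, Finset.sum, Finset.sum, h'.1, h'.2]
    · exact absurd rfl h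
  · have e0 : ∀ n, (e.embDomain σ.toEmbedding) (σ n) = e n := fun n =>
      Finsupp.embDomain_apply_self σ.toEmbedding e n
    have e1 : (A.map σ.toEmbedding).val.map (e.embDomain σ.toEmbedding) = A.val.map e := by
      rw [map_val, Multiset.map_map]
      exact Multiset.map_congr rfl fun n _ => e0 n
    have e2 : ((e.embDomain σ.toEmbedding).support \ A.map σ.toEmbedding).val.map
        (e.embDomain σ.toEmbedding) = (e.support \ A).val.map e := by
      have : (e.embDomain σ.toEmbedding).support \ A.map σ.toEmbedding =
          (e.support \ A).map σ.toEmbedding := by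
        rw [Finsupp.support_embDomain]
        simp only [map_eq_image, image_sdiff _ _ σ.toEmbedding.injective]
      rw [this, map_val, Multiset.map_map]
      exact Multiset.map_congr rfl fun n _ => e0 n
    rw [coeff_relabel, symMono, coeff_of, coeff_of, e1, e2]
    split_ifs with h
    · have hinj : ∀ i ∈ A, ∀ j ∈ A, e i = e j → i = j := by
        have hn : (A.val.map e).Nodup := by rw [h.1]; exact Λ.anti.nodup
        exact Multiset.inj_on_of_nodup_map hn
      rw [prod_pairs_map, relabelSign, ← prod_mul_distrib]
      refine prod_congr rfl ?_
      rintro ⟨i, j⟩ hp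
      rw [mem_pairs] at hp
      have hne : e i ≠ e j := fun he => hp.2.2.ne (hinj i hp.1 j hp.2.1 he)
      simp only [Equiv.coe_toEmbedding]
      rcases lt_or_gt_of_ne hne with h3 | h3 <;> split_ifs with h4 h5 h6 <;>
        simp_all [h3.not_gt]
    · rw [mul_zero]

open Classical in
/-- `p_r = ∑ x_i^r` (for `r ≥ 1`). -/
noncomputable def psumSeries (r : ℕ) : SSeries :=
  of fun A e => if A = ∅ ∧ ∃ i, e = Finsupp.single i r then 1 else 0

open Classical in
/-- `p̃_k = ∑ θ_i x_i^k` (for `k ≥ 0`). -/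
noncomputable def psumTildeSeries (k : ℕ) : SSeries :=
  of fun A e => if ∃ i, A = {i} ∧ e = Finsupp.single i k then 1 else 0

theorem psumSeries_mem (r : ℕ) : psumSeries r ∈ sSym := by
  refine ⟨⟨r, fun A e h => ?_⟩, fun σ => ext fun A e => ?_⟩
  · rw [psumSeries, coeff_of] at h
    split_ifs at h with h'
    · obtain ⟨rfl, i, rfl⟩ := h'
      simp
    · exact absurd rfl h
  · rw [coeff_relabel, psumSeries, coeff_of, coeff_of]
    have hiff : (A.map σ.toEmbedding = ∅ ∧
        ∃ i, e.embDomain σ.toEmbedding = Finsupp.single i r) ↔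
        (A = ∅ ∧ ∃ i, e = Finsupp.single i r) := by
      refine and_congr map_eq_empty ⟨?_, ?_⟩
      · rintro ⟨i, hi⟩
        obtain ⟨j, rfl⟩ := σ.surjective i
        refine ⟨j, Finsupp.embDomain_injective σ.toEmbedding ?_⟩
        rw [hi, Finsupp.embDomain_single]; rfl
      · rintro ⟨i, rfl⟩
        exact ⟨σ i, by rw [Finsupp.embDomain_single]; rfl⟩
    by_cases h : A = ∅ ∧ ∃ i, e = Finsupp.single i r
    · rw [if_pos h, if_pos (hiff.2 h), h.1]; simp [relabelSign, pairs]
    · rw [if_neg h, if_neg (mt hiff.1 h), mul_zero]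

theorem psumTildeSeries_mem (k : ℕ) : psumTildeSeries k ∈ sSym := by
  refine ⟨⟨k + 1, fun A e h => ?_⟩, fun σ => ext fun A e => ?_⟩
  · rw [psumTildeSeries, coeff_of] at h
    split_ifs at h with h'
    · obtain ⟨i, rfl, rfl⟩ := h'
      simp [add_comm]
    · exact absurd rfl h
  · rw [coeff_relabel, psumTildeSeries, coeff_of, coeff_of]
    have hiff : (∃ i, A.map σ.toEmbedding = {i} ∧
        e.embDomain σ.toEmbedding = Finsupp.single i k) ↔
        (∃ i, A = {i} ∧ e = Finsupp.single i k) := by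
      constructor
      · rintro ⟨i, hA, hi⟩
        obtain ⟨j, rfl⟩ := σ.surjective i
        refine ⟨j, map_injective σ.toEmbedding ?_, Finsupp.embDomain_injective σ.toEmbedding ?_⟩
        · rw [hA, map_singleton]; rfl
        · rw [hi, Finsupp.embDomain_single]; rfl
      · rintro ⟨i, rfl, rfl⟩
        exact ⟨σ i, by rw [map_singleton]; rfl, by rw [Finsupp.embDomain_single]; rfl⟩
    by_cases h : ∃ i, A = {i} ∧ e = Finsupp.single i k
    · rw [if_pos h, if_pos (hiff.2 h)]
      obtain ⟨i, rfl, -⟩ := h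
      have : pairs {i} = ∅ := by
        ext ⟨a, b⟩; simp only [mem_pairs, mem_singleton, notMem_empty, iff_false]; omega
      simp [relabelSign, this]
    · rw [if_neg h, if_neg (mt hiff.1 h), mul_zero]

end SSeries

namespace sSym

/-- `m_Λ` -/
noncomputable def m (Λ : SPar) : sSym := ⟨symMono Λ, symMono_mem Λ⟩
/-- `p_r` -/
noncomputable def psum (r : ℕ) : sSym := ⟨psumSeries r, psumSeries_mem r⟩
/-- `p̃_k` -/
noncomputable def psumTilde (k : ℕ) : sSym := ⟨psumTildeSeries k, psumTildeSeries_mem k⟩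

/-- `h_r`, the sum of `m_Λ` over the superpartitions `Λ` of total degree `r` and fermionic
degree `0`. -/
noncomputable def h (r : ℕ) : sSym :=
  ∑ lam : Nat.Partition r, m ⟨∅, lam.parts, fun _ hn => lam.parts_pos hn⟩

/-- `h̃_k`, the sum of `(Λ_1 + 1) m_Λ` over the superpartitions `Λ = (Λ_1; λ)` of total degree `k` and
fermionic degree `1`. -/
noncomputable def hTilde (k : ℕ) : sSym :=
  ∑ q ∈ HasAntidiagonal.antidiagonal k, ∑ lam : Nat.Partition q.2,
    ((q.1 : ℚ) + 1) • m ⟨{q.1}, lam.parts, fun _ hn => lam.parts_pos hn⟩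

/-- `p_Λ = p̃_{Λ_1} ⋯ p̃_{Λ_m} p_{Λ_{m+1}} ⋯ p_{Λ_l}` with `Λ_1 > ... > Λ_m`. -/
noncomputable def p (Λ : SPar) : sSym :=
  ((Λ.anti.sort (· ≥ ·)).map psumTilde).prod * ((Λ.sym.sort (· ≥ ·)).map psum).prod

/-- `z_λ = ∏ i^{n_i} n_i!`, where `n_i` is the number of parts of `λ` equal to `i`. -/
def z (s : Multiset ℕ) : ℕ := ∏ i ∈ s.toFinset, i ^ s.count i * (s.count i).factorial

open Classical in
/-- The defining property of the scalar product: `⟪p_Λ, p_Ω⟫ = δ_{ΛΩ} z_{Λ^s}`. -/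
def IsHallForm (B : sSym →ₗ[ℚ] sSym →ₗ[ℚ] ℚ) : Prop :=
  ∀ Λ Ω : SPar, B (p Λ) (p Ω) = if Λ = Ω then (z Λ.sym : ℚ) else 0

noncomputable def comul : sSym →ₗ[ℚ] sSym ⊗[ℚ] sSym := SSeries.comul splitClosed_sSym
noncomputable def counit : sSym →ₗ[ℚ] ℚ := SSeries.counit sSym
noncomputable def parity : sSym →ₗ[ℚ] sSym :=
  (SSeries.parity ∘ₗ sSym.toSubmodule.subtype).codRestrict sSym.toSubmodule
    fun f => parity_mem_sSym f f.2
/-- The inclusion of symmetric into quasisymmetric functions in superspace. -/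
noncomputable def incl : sSym →ₐ[ℚ] sQSym := Subalgebra.inclusion sSym_le_sQSym

end sSym

/-- Dotted compositions; the product is concatenation. -/
abbrev DComp : Type := FreeMonoid DPart

instance : DecidableEq DComp := inferInstanceAs (DecidableEq (List DPart))

namespace sQSym

/-- `M_α` -/
noncomputable def M (α : DComp) : sQSym := ⟨monoSeries α.toList.get, monoSeries_mem _⟩

/-- The coefficient of the leading term of `M_α`, which is the coefficient of `M_α` in the expansion in
monomial quasisymmetric functions. -/
noncomputable def lead (α : DComp) : sQSym →ₗ[ℚ] ℚ :=
  coeff (thetaSet α.toList.get (Fin.valOrderEmb _)) (expo α.toList.get (Fin.valOrderEmb _)) ∘ₗ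
    sQSym.toSubmodule.subtype

noncomputable def comul : sQSym →ₗ[ℚ] sQSym ⊗[ℚ] sQSym := SSeries.comul splitClosed_sQSym
noncomputable def counit : sQSym →ₗ[ℚ] ℚ := SSeries.counit sQSym
noncomputable def parity : sQSym →ₗ[ℚ] sQSym :=
  (SSeries.parity ∘ₗ sQSym.toSubmodule.subtype).codRestrict sQSym.toSubmodule
    fun f => parity_mem_sQSym f f.2

end sQSym

/-- Noncommutative symmetric functions in superspace: the vector space with basis `H_α`, `α` a dotted
composition, with the product `H_α H_β = H_{α·β}`. It is made into the Hopf dual of `sQSym` by the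
pairing, coproduct and counit below; see `sNSym.IsHopfDual`. -/
abbrev sNSym : Type := MonoidAlgebra ℚ DComp

namespace sNSym

/-- `H_α` -/
noncomputable def H (α : DComp) : sNSym := MonoidAlgebra.single α 1

/-- The linear map with prescribed values on the basis `H_α`. -/
noncomputable def lin {V : Type} [AddCommGroup V] [Module ℚ V] (v : DComp → V) : sNSym →ₗ[ℚ] V :=
  Finsupp.linearCombination ℚ v ∘ₗ (MonoidAlgebra.coeffLinearEquiv ℚ).toLinearMap

theorem lin_H {V : Type} [AddCommGroup V] [Module ℚ V] (v : DComp → V) (α : DComp) :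
    lin v (H α) = v α := by
  simp [lin, H]

theorem H_mul_H (α β : DComp) : H α * H β = H (α * β) := by
  simp [H, MonoidAlgebra.single_mul_single]

/-- The dual pairing, `⟨H_α, f⟩` being the coefficient of `M_α` in `f`. -/
noncomputable def pairing : sNSym →ₗ[ℚ] sQSym →ₗ[ℚ] ℚ := lin sQSym.lead

/-- `⟨F ⊗ G, a ⊗ b⟩ = ⟨F, a⟩ ⟨G, b⟩` -/
noncomputable def tensorPairing : sNSym ⊗[ℚ] sNSym →ₗ[ℚ] sQSym ⊗[ℚ] sQSym →ₗ[ℚ] ℚ :=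
  TensorProduct.dualDistrib ℚ sQSym sQSym ∘ₗ TensorProduct.map pairing pairing

theorem tensorPairing_tmul (F G : sNSym) (a b : sQSym) :
    tensorPairing (F ⊗ₜ G) (a ⊗ₜ b) = pairing F a * pairing G b := rfl

/-- The coproduct dual to the product of `sQSym`: the coefficient of `H_α ⊗ H_β` in `Δ H_γ` is
`⟨H_γ, M_α M_β⟩`. -/
noncomputable def comul : sNSym →ₗ[ℚ] sNSym ⊗[ℚ] sNSym :=
  lin fun γ => ∑ᶠ q : DComp × DComp,
    pairing (H γ) (sQSym.M q.1 * sQSym.M q.2) • (H q.1 ⊗ₜ[ℚ] H q.2)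

/-- The counit: the coefficient of `H_∅ = 1`. -/
noncomputable def counit : sNSym →ₗ[ℚ] ℚ := lin fun α => if α = 1 then 1 else 0

/-- The parity map, given by the number of dotted parts. -/
noncomputable def parity : sNSym →ₗ[ℚ] sNSym :=
  lin fun α => (-1 : ℚ) ^ (α.toList.countP Sum.isRight) • H α

end sNSym

section Hopf

variable {A : Type} [Ring A] [Algebra ℚ A]

/-- The product `(f₁ ⊗ g₁)(f₂ ⊗ g₂) = (-1)^{ab} f₁ f₂ ⊗ g₁ g₂` on `A ⊗ A`, where `g₁` and `f₂` have
fermionic degrees `a` and `b`. Here `P` is the parity map of `A`, and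
`(-1)^{ab} = (1 + (-1)^a + (-1)^b - (-1)^a (-1)^b) / 2`. -/
noncomputable def superMul (P : A →ₗ[ℚ] A) (s t : A ⊗[ℚ] A) : A ⊗[ℚ] A :=
  (1 / 2 : ℚ) • (s * t + P.lTensor A s * t + s * P.rTensor A t
    - P.lTensor A s * P.rTensor A t)

/-- `A`, with parity map `P`, coproduct `Δ`, counit `ε` and antipode `S`, is a Hopf algebra, where
`A ⊗ A` carries the product with signs. -/
structure IsSuperHopf (P : A →ₗ[ℚ] A) (Δ : A →ₗ[ℚ] A ⊗[ℚ] A) (ε : A →ₗ[ℚ] ℚ)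
    (S : A →ₗ[ℚ] A) : Prop where
  coassoc : TensorProduct.assoc ℚ A A A ∘ₗ Δ.rTensor A ∘ₗ Δ = Δ.lTensor A ∘ₗ Δ
  counit_left : ∀ a, ε.rTensor A (Δ a) = 1 ⊗ₜ a
  counit_right : ∀ a, ε.lTensor A (Δ a) = a ⊗ₜ 1
  comul_one : Δ 1 = 1 ⊗ₜ 1
  comul_mul : ∀ a b, Δ (a * b) = superMul P (Δ a) (Δ b)
  counit_one : ε 1 = 1
  counit_mul : ∀ a b, ε (a * b) = ε a * ε b
  antipode_left : ∀ a, LinearMap.mul' ℚ A (S.rTensor A (Δ a)) = algebraMap ℚ A (ε a)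
  antipode_right : ∀ a, LinearMap.mul' ℚ A (S.lTensor A (Δ a)) = algebraMap ℚ A (ε a)

end Hopf

/-- A morphism of Hopf algebras: an algebra morphism that respects coproducts, counits and
antipodes. -/
structure IsHopfHom {A B : Type} [Ring A] [Algebra ℚ A] [Ring B] [Algebra ℚ B]
    (ΔA : A →ₗ[ℚ] A ⊗[ℚ] A) (εA : A →ₗ[ℚ] ℚ) (SA : A →ₗ[ℚ] A)
    (ΔB : B →ₗ[ℚ] B ⊗[ℚ] B) (εB : B →ₗ[ℚ] ℚ) (SB : B →ₗ[ℚ] B) (π : A →ₐ[ℚ] B) : Prop where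
  comul : ∀ a, ΔB (π a) = TensorProduct.map π.toLinearMap π.toLinearMap (ΔA a)
  counit : ∀ a, εB (π a) = εA a
  antipode : ∀ a, SB (π a) = π (SA a)

/-- The pairing makes `sNSym` the Hopf dual of `sQSym`, where `SN` and `SQ` are the antipodes. -/
structure sNSym.IsHopfDual (SN : sNSym →ₗ[ℚ] sNSym) (SQ : sQSym →ₗ[ℚ] sQSym) : Prop where
  mul : ∀ F G a, sNSym.pairing (F * G) a = sNSym.tensorPairing (F ⊗ₜ G) (sQSym.comul a)
  comul : ∀ F a b, sNSym.pairing F (a * b) = sNSym.tensorPairing (sNSym.comul F) (a ⊗ₜ b)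
  one : ∀ a, sNSym.pairing 1 a = sQSym.counit a
  counit : ∀ F, sNSym.pairing F 1 = sNSym.counit F
  antipode : ∀ F a, sNSym.pairing (SN F) a = sNSym.pairing F (SQ a)
  nondegenerate : sNSym.pairing.Nondegenerate

/-- `π(H_m) = h_m` for `m ≥ 1`, and `π(H̃_n) = h̃_n` for `n ≥ 0`. -/
def sNSym.SendsGenerators (π : sNSym →ₐ[ℚ] sSym) : Prop :=
  (∀ m : ℕ+, π (sNSym.H (FreeMonoid.of (Sum.inl m))) = sSym.h m) ∧
    ∀ n : ℕ, π (sNSym.H (FreeMonoid.of (Sum.inr n))) = sSym.hTilde n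

end SuperSym

open SuperSym

/-! As an algebra, `sNSym` is free on the `H_m` and `H̃_n`, so `π` exists and is unique. Almost
everything else follows from the adjunction `⟪π F, g⟫ = ⟨F, ι g⟩`, which is `sNSym.form_toSym`.

On a generator the right side is the coefficient of `x_0^m` or of `θ_0 x_0^n` in `g`. The adjunction
therefore begins with the fact that `h_m` and `h̃_n` represent these two functionals for the scalar
product (`sSym.form_h`, `sSym.form_hTilde`). It passes to products because both pairings turn a
product on the left into a coproduct on the right. For `sNSym` this holds because juxtaposing
monomials concatenates their shapes (`shape_juxt`, `sNSym.pairing_mul`); for the scalar product it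
is `sSym.form_mul`. Since `ι` respects coproducts, induction on the length of a composition finishes
the argument.

The heart of `sSym.form_mul` is that the power sums are primitive. Contracting one tensor factor of
a coproduct against `⟪p_r, ·⟫` or `⟪p̃_k, ·⟫` is then an even or odd derivation, namely `r ∂/∂p_r`
or `∂/∂p̃_k`. Comparison with `z` shows that it is adjoint to multiplication by the power sum, and
coassociativity lets one power sum after the other be split off. All this is computed in the basis
`p_Λ`. That the `p_Λ` form a basis is a triangularity statement: among the monomials with at least
as many variables as `Λ` has parts, those occurring in `p_Λ` are the ones whose exponents are the
parts of `Λ` (`sSym.linearIndependent_p`, `sSym.mem_span_p`).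

Compatibility of `π` with coproducts is the adjunction again: the scalar product is nondegenerate
and `ι` is multiplicative. Antipodes are convolution inverses, so a bialgebra morphism respects
them. Surjectivity holds because Newton's identity and its odd analogue express the power sums
through the `h_r` and `h̃_k`.

For the Hopf structures themselves, the coefficients of a coproduct are coefficients at juxtaposed
monomials. The axioms become identities between juxtapositions, with signs counting inversions, and
antipodes exist by connected grading (`exists_antipode`). The structure of `sNSym` is deduced from
that of `sQSym` through the pairing. -/

open SuperSym
namespace SuperSym

open Finset TensorProduct

/-! ### Functionals that separate the points of a tensor product. -/

section TensorSeparation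

variable {V W : Type} [AddCommGroup V] [Module ℚ V] [AddCommGroup W] [Module ℚ W]

/-- The functional `φ ⊗ ψ` on `V ⊗ W`. -/
noncomputable def tensorEval (φ : V →ₗ[ℚ] ℚ) (ψ : W →ₗ[ℚ] ℚ) : V ⊗[ℚ] W →ₗ[ℚ] ℚ :=
  TensorProduct.dualDistrib ℚ V W (φ ⊗ₜ ψ)

@[simp] theorem tensorEval_tmul (φ : V →ₗ[ℚ] ℚ) (ψ : W →ₗ[ℚ] ℚ) (v : V) (w : W) :
    tensorEval φ ψ (v ⊗ₜ w) = φ v * ψ w := rfl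

/-- If the functionals `φ i` separate the points of `V`, and the `ψ j` those of `W`, then the
`φ i ⊗ ψ j` separate the points of `V ⊗ W`. -/
theorem tensor_eq_zero {I J : Type} {φ : I → V →ₗ[ℚ] ℚ} {ψ : J → W →ₗ[ℚ] ℚ}
    (hφ : ∀ v, (∀ i, φ i v = 0) → v = 0) (hψ : ∀ w, (∀ j, ψ j w = 0) → w = 0)
    {t : V ⊗[ℚ] W} (h : ∀ i j, tensorEval (φ i) (ψ j) t = 0) : t = 0 := by
  let b := Module.Basis.ofVectorSpace ℚ V
  obtain ⟨c, rfl⟩ : ∃ c : _ →₀ W, (c.sum fun i g => b i ⊗ₜ[ℚ] g) = t := by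
    obtain ⟨c, hc⟩ := TensorProduct.eq_repr_basis_left b t
    exact ⟨c, hc⟩
  have hc : c = 0 := by
    ext1 k
    refine hψ _ fun j => ?_
    -- Contracting the second factor with `ψ j` leaves a vector killed by all `φ i`; its coordinates
    -- in the basis `b` are the numbers `ψ j (c k)`.
    have h0 : ∑ k ∈ c.support, ψ j (c k) • b k = 0 := by
      refine hφ _ fun i => ?_
      have := h i j
      rw [Finsupp.sum, map_sum] at this
      simpa only [tensorEval_tmul, map_sum, map_smul, smul_eq_mul, mul_comm] using this
    by_cases hk : k ∈ c.support
    · exact linearIndependent_iff'.1 b.linearIndependent _ _ h0 k hk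
    · simp [Finsupp.notMem_support_iff.1 hk]
  rw [hc, Finsupp.sum_zero_index]

theorem tensor_ext {I J : Type} {φ : I → V →ₗ[ℚ] ℚ} {ψ : J → W →ₗ[ℚ] ℚ}
    (hφ : ∀ v, (∀ i, φ i v = 0) → v = 0) (hψ : ∀ w, (∀ j, ψ j w = 0) → w = 0)
    {s t : V ⊗[ℚ] W} (h : ∀ i j, tensorEval (φ i) (ψ j) s = tensorEval (φ i) (ψ j) t) : s = t :=
  sub_eq_zero.1 (tensor_eq_zero hφ hψ fun i j => by rw [map_sub, h, sub_self])

end TensorSeparation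

/-! ### Convolution algebras: existence, preservation and adjointness of antipodes. -/

section Antipode

variable {A : Type} [Ring A] [Algebra ℚ A]

/-- The coalgebra with the given coproduct and counit. -/
noncomputable abbrev coalgebraOf {Δ : A →ₗ[ℚ] A ⊗[ℚ] A} {ε : A →ₗ[ℚ] ℚ}
    (coassoc : TensorProduct.assoc ℚ A A A ∘ₗ Δ.rTensor A ∘ₗ Δ = Δ.lTensor A ∘ₗ Δ)
    (counit_left : ∀ a, ε.rTensor A (Δ a) = 1 ⊗ₜ a)
    (counit_right : ∀ a, ε.lTensor A (Δ a) = a ⊗ₜ 1) : Coalgebra ℚ A where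
  comul := Δ
  counit := ε
  coassoc := coassoc
  rTensor_counit_comp_comul := LinearMap.ext counit_left
  lTensor_counit_comp_comul := LinearMap.ext counit_right

/-- A connected graded coalgebra that is also an algebra has an antipode, the geometric series of
`1 - id` in the convolution algebra. Here the `P k` are the projections to the homogeneous
components. -/
theorem exists_antipode {Δ : A →ₗ[ℚ] A ⊗[ℚ] A} {ε : A →ₗ[ℚ] ℚ}
    (coassoc : TensorProduct.assoc ℚ A A A ∘ₗ Δ.rTensor A ∘ₗ Δ = Δ.lTensor A ∘ₗ Δ)
    (counit_left : ∀ a, ε.rTensor A (Δ a) = 1 ⊗ₜ a)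
    (counit_right : ∀ a, ε.lTensor A (Δ a) = a ⊗ₜ 1)
    (P : ℕ → A →ₗ[ℚ] A)
    (hP : ∀ k a, Δ (P k a) = ∑ p ∈ antidiagonal k, TensorProduct.map (P p.1) (P p.2) (Δ a))
    (h0 : ∀ a, P 0 a = algebraMap ℚ A (ε (P 0 a)))
    (hsum : ∀ a, ∃ N, a = ∑ k ∈ range N, P k a) :
    ∃ S : A →ₗ[ℚ] A, (∀ a, LinearMap.mul' ℚ A (S.rTensor A (Δ a)) = algebraMap ℚ A (ε a)) ∧
      ∀ a, LinearMap.mul' ℚ A (S.lTensor A (Δ a)) = algebraMap ℚ A (ε a) := by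
  let _ := coalgebraOf coassoc counit_left counit_right
  -- The convolution unit is `a ↦ algebraMap (ε a)`, so `f` vanishes in degree zero by `h0`, and the
  -- inverse of the identity `1 - f` is the sum of the powers of `f`.
  let f : WithConv (A →ₗ[ℚ] A) := 1 - WithConv.toConv LinearMap.id
  have hf : ∀ a, f (P 0 a) = 0 := fun a => by
    change algebraMap ℚ A (ε (P 0 a)) - P 0 a = 0
    rw [← h0, sub_self]
  have hnil : ∀ n k, k < n → ∀ a, (f ^ n) (P k a) = 0 := by
    intro n
    induction n with
    | zero => intro k hk; omega
    | succ n ih =>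
      intro k hk a
      rw [pow_succ']
      change LinearMap.mul' ℚ A (TensorProduct.map f.ofConv (f ^ n).ofConv (Δ (P k a))) = 0
      rw [hP, map_sum, map_sum]
      refine sum_eq_zero fun p hp => ?_
      rw [← LinearMap.comp_apply (TensorProduct.map _ _), ← TensorProduct.map_comp]
      rw [HasAntidiagonal.mem_antidiagonal] at hp
      -- The total degree is at most `n`: either the left factor has degree zero and is killed by
      -- `f`, or the right factor has degree below `n` and is killed by `f ^ n`.
      rcases Nat.eq_zero_or_pos p.1 with h1 | h1
      · have : f.ofConv ∘ₗ P p.1 = 0 := LinearMap.ext fun a => by rw [h1]; exact hf a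
        rw [this, TensorProduct.map_zero_left, LinearMap.zero_apply, map_zero]
      · have : (f ^ n).ofConv ∘ₗ P p.2 = 0 := LinearMap.ext fun a => ih _ (by omega) a
        rw [this, TensorProduct.map_zero_right, LinearMap.zero_apply, map_zero]
  have hnil' : ∀ a, ∃ N, ∀ n, N ≤ n → (f ^ n) a = 0 := fun a => by
    obtain ⟨N, hN⟩ := hsum a
    refine ⟨N, fun n hn => ?_⟩
    rw [hN]
    change (f ^ n).ofConv _ = 0
    rw [map_sum]
    exact sum_eq_zero fun k hk => hnil n k (by have := mem_range.1 hk; omega) a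
  have hfin : ∀ a, (Function.support fun n => (f ^ n) a).Finite := fun a => by
    obtain ⟨N, hN⟩ := hnil' a
    refine (Set.finite_Iio N).subset fun n hn => ?_
    by_contra h
    exact hn (hN n (not_lt.1 h))
  -- The series is finite at each element, though not uniformly; `hfin` excludes the default value
  -- zero of `finsum`.
  let S : A →ₗ[ℚ] A :=
    { toFun := fun a => ∑ᶠ n, (f ^ n) a
      map_add' := fun a b => by
        rw [← finsum_add_distrib (hfin a) (hfin b)]
        exact finsum_congr fun n => map_add (f ^ n).ofConv a b
      map_smul' := fun r a => by
        rw [RingHom.id_apply, smul_finsum' r (hfin a)]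
        exact finsum_congr fun n => map_smul (f ^ n).ofConv r a }
  have hS : ∀ a N, (∀ n, N ≤ n → (f ^ n) a = 0) →
      S a = (∑ n ∈ range N, f ^ n).ofConv a := fun a N hN => by
    have h1 : S a = ∑ n ∈ range N, (f ^ n) a := by
      refine finsum_eq_sum_of_support_subset _ fun n hn => ?_
      rw [coe_range]
      by_contra h
      exact hn (hN n (not_lt.1 h))
    rw [h1, WithConv.ofConv_sum, LinearMap.sum_apply]
  -- A tensor involves only finitely many elements, so on it `S` may be replaced by a partial sum,
  -- for which the geometric series telescopes.
  have hST : ∀ t : A ⊗[ℚ] A, ∃ N₀, ∀ N, N₀ ≤ N →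
      S.rTensor A t = TensorProduct.map (∑ n ∈ range N, f ^ n).ofConv LinearMap.id t ∧
      S.lTensor A t = TensorProduct.map LinearMap.id (∑ n ∈ range N, f ^ n).ofConv t := fun t => by
    induction t with
    | zero => exact ⟨0, fun N _ => by simp only [map_zero, and_self]⟩
    | add x y hx hy =>
      obtain ⟨N, hN⟩ := hx
      obtain ⟨N', hN'⟩ := hy
      refine ⟨max N N', fun n hn => ?_⟩
      have h1 := hN n (by omega)
      have h2 := hN' n (by omega)
      simp only [map_add, h1, h2, and_self]
    | tmul x y =>
      obtain ⟨N, hN⟩ := hnil' x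
      obtain ⟨N', hN'⟩ := hnil' y
      refine ⟨max N N', fun n hn => ?_⟩
      rw [LinearMap.rTensor_tmul, LinearMap.lTensor_tmul, TensorProduct.map_tmul,
        TensorProduct.map_tmul, hS x n fun k hk => hN k (by omega),
        hS y n fun k hk => hN' k (by omega)]
      exact ⟨rfl, rfl⟩
  have hid : WithConv.toConv LinearMap.id = 1 - f := by simp [f]
  refine ⟨S, fun a => ?_, fun a => ?_⟩
  · obtain ⟨N, hN⟩ := hST (Δ a)
    obtain ⟨N', hN'⟩ := hnil' a
    rw [(hN (max N N') (le_max_left _ _)).1]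
    have h1 : (∑ n ∈ range (max N N'), f ^ n) * WithConv.toConv LinearMap.id =
        1 - f ^ max N N' := by rw [hid, geom_sum_mul_neg]
    have h2 := congrArg (fun g : WithConv (A →ₗ[ℚ] A) => g a) h1
    refine h2.trans ?_
    change algebraMap ℚ A (ε a) - (f ^ max N N') a = _
    rw [hN' _ (le_max_right _ _), sub_zero]
  · obtain ⟨N, hN⟩ := hST (Δ a)
    obtain ⟨N', hN'⟩ := hnil' a
    rw [(hN (max N N') (le_max_left _ _)).2]
    have h1 : WithConv.toConv LinearMap.id * (∑ n ∈ range (max N N'), f ^ n) =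
        1 - f ^ max N N' := by rw [hid, mul_neg_geom_sum]
    have h2 := congrArg (fun g : WithConv (A →ₗ[ℚ] A) => g a) h1
    refine h2.trans ?_
    change algebraMap ℚ A (ε a) - (f ^ max N N') a = _
    rw [hN' _ (le_max_right _ _), sub_zero]

/-- A morphism of bialgebras respects the antipodes. -/
theorem IsSuperHopf.antipode_map {B : Type} [Ring B] [Algebra ℚ B]
    {PA : A →ₗ[ℚ] A} {ΔA : A →ₗ[ℚ] A ⊗[ℚ] A} {εA : A →ₗ[ℚ] ℚ} {SA : A →ₗ[ℚ] A}
    {PB : B →ₗ[ℚ] B} {ΔB : B →ₗ[ℚ] B ⊗[ℚ] B} {εB : B →ₗ[ℚ] ℚ} {SB : B →ₗ[ℚ] B}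
    (hA : IsSuperHopf PA ΔA εA SA) (hB : IsSuperHopf PB ΔB εB SB) (π : A →ₐ[ℚ] B)
    (hΔ : ∀ a, ΔB (π a) = TensorProduct.map π.toLinearMap π.toLinearMap (ΔA a))
    (hε : ∀ a, εB (π a) = εA a) (a : A) : SB (π a) = π (SA a) := by
  let _ := coalgebraOf hA.coassoc hA.counit_left hA.counit_right
  -- In the convolution algebra of maps from `A` to `B`, `x` is a left inverse and `z` a right
  -- inverse of `π`, hence `x = z`.
  let x : WithConv (A →ₗ[ℚ] B) := WithConv.toConv (SB ∘ₗ π.toLinearMap)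
  let y : WithConv (A →ₗ[ℚ] B) := WithConv.toConv π.toLinearMap
  let z : WithConv (A →ₗ[ℚ] B) := WithConv.toConv (π.toLinearMap ∘ₗ SA)
  have hxy : x * y = 1 := by
    ext a
    have h1 : TensorProduct.map (SB ∘ₗ π.toLinearMap) π.toLinearMap =
        SB.rTensor B ∘ₗ TensorProduct.map π.toLinearMap π.toLinearMap := by
      ext; rfl
    change LinearMap.mul' ℚ B (TensorProduct.map (SB ∘ₗ π.toLinearMap) π.toLinearMap (ΔA a)) =
      algebraMap ℚ B (εA a)
    rw [h1, LinearMap.comp_apply, ← hΔ, hB.antipode_left, hε]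
  have hyz : y * z = 1 := by
    ext a
    have h1 : LinearMap.mul' ℚ B ∘ₗ TensorProduct.map π.toLinearMap (π.toLinearMap ∘ₗ SA) =
        π.toLinearMap ∘ₗ LinearMap.mul' ℚ A ∘ₗ SA.lTensor A := by
      ext; simp
    have h2 := LinearMap.congr_fun h1 (ΔA a)
    refine h2.trans ?_
    change π (LinearMap.mul' ℚ A (SA.lTensor A (ΔA a))) = algebraMap ℚ B (εA a)
    rw [hA.antipode_right, AlgHom.commutes]
  exact congrArg (fun g : WithConv (A →ₗ[ℚ] B) => g a) (left_inv_eq_right_inv hxy hyz)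

/-- If a pairing turns products into coproducts and vice versa, then the antipodes are adjoint. -/
theorem IsSuperHopf.antipode_adjoint {B : Type} [Ring B] [Algebra ℚ B]
    {PA : A →ₗ[ℚ] A} {ΔA : A →ₗ[ℚ] A ⊗[ℚ] A} {εA : A →ₗ[ℚ] ℚ} {SA : A →ₗ[ℚ] A}
    {PB : B →ₗ[ℚ] B} {ΔB : B →ₗ[ℚ] B ⊗[ℚ] B} {εB : B →ₗ[ℚ] ℚ} {SB : B →ₗ[ℚ] B}
    (hA : IsSuperHopf PA ΔA εA SA) (hB : IsSuperHopf PB ΔB εB SB)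
    (q : A →ₗ[ℚ] B →ₗ[ℚ] ℚ)
    (hmul : ∀ F G b, q (F * G) b = tensorEval (q F) (q G) (ΔB b))
    (hcomul : ∀ F a b, q F (a * b) =
      TensorProduct.dualDistrib ℚ B B (TensorProduct.map q q (ΔA F)) (a ⊗ₜ b))
    (hone : ∀ b, q 1 b = εB b) (hcounit : ∀ F, q F 1 = εA F) (F : A) (b : B) :
    q (SA F) b = q F (SB b) := by
  let _ := coalgebraOf hA.coassoc hA.counit_left hA.counit_right
  let _ := coalgebraOf hB.coassoc hB.counit_left hB.counit_right
  -- Functionals on `B` form a convolution algebra `D`, and `q` becomes a map `j` from the coalgebra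
  -- `A` to `D`. Composing `q` with `SA` gives a left inverse of `j`, by `hmul`; composing with `SB`
  -- gives a right inverse, by `hcomul`.
  let D := WithConv (B →ₗ[ℚ] ℚ)
  let j : A →ₗ[ℚ] D := (WithConv.linearEquiv ℚ (B →ₗ[ℚ] ℚ)).symm.toLinearMap ∘ₗ q
  let k : A →ₗ[ℚ] D := (WithConv.linearEquiv ℚ (B →ₗ[ℚ] ℚ)).symm.toLinearMap ∘ₗ
    (LinearMap.lcomp ℚ ℚ SB) ∘ₗ q
  let x : WithConv (A →ₗ[ℚ] D) := WithConv.toConv (j ∘ₗ SA)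
  let y : WithConv (A →ₗ[ℚ] D) := WithConv.toConv j
  let z : WithConv (A →ₗ[ℚ] D) := WithConv.toConv k
  have hm : ∀ (φ ψ : B →ₗ[ℚ] ℚ) (t : B ⊗[ℚ] B),
      LinearMap.mul' ℚ ℚ (TensorProduct.map φ ψ t) = tensorEval φ ψ t := fun φ ψ t => by
    induction t with
    | zero => simp
    | add x y hx hy => simp only [map_add, hx, hy]
    | tmul x y => rfl
  have hxy : x * y = 1 := by
    ext F b
    have h1 : LinearMap.mul' ℚ D ∘ₗ TensorProduct.map (j ∘ₗ SA) j =
        j ∘ₗ LinearMap.mul' ℚ A ∘ₗ SA.rTensor A := by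
      ext F G b
      change LinearMap.mul' ℚ ℚ (TensorProduct.map (q (SA F)) (q G) (ΔB b)) = q (SA F * G) b
      rw [hm, hmul]
    have h2 := congrArg (fun g : D => g b) (LinearMap.congr_fun h1 (ΔA F))
    refine h2.trans ?_
    change q (LinearMap.mul' ℚ A (SA.rTensor A (ΔA F))) b = εA F • algebraMap ℚ ℚ (εB b)
    rw [hA.antipode_left, Algebra.algebraMap_eq_smul_one, map_smul, LinearMap.smul_apply, hone]
    rfl
  have hyz : y * z = 1 := by
    ext F b
    have h1 : ∀ (t : A ⊗[ℚ] A) (b : B),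
        (LinearMap.mul' ℚ D (TensorProduct.map j k t) : D) b =
        TensorProduct.dualDistrib ℚ B B (TensorProduct.map q q t) (SB.lTensor B (ΔB b)) := by
      intro t b
      induction t with
      | zero => simp
      | add x y hx hy =>
        simp only [map_add, LinearMap.add_apply, ← hx, ← hy]; rfl
      | tmul F G =>
        change LinearMap.mul' ℚ ℚ (TensorProduct.map (q F) (q G ∘ₗ SB) (ΔB b)) =
          tensorEval (q F) (q G) (SB.lTensor B (ΔB b))
        rw [hm]
        induction ΔB b with
        | zero => simp
        | add x y hx hy => simp only [map_add, hx, hy]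
        | tmul x y => rfl
    have h3 : ∀ u : B ⊗[ℚ] B, TensorProduct.dualDistrib ℚ B B (TensorProduct.map q q (ΔA F)) u =
        q F (LinearMap.mul' ℚ B u) := fun u => by
      induction u with
      | zero => simp
      | add x y hx hy => simp only [map_add, hx, hy]
      | tmul x y => rw [← hcomul]; rfl
    refine (h1 (ΔA F) b).trans ?_
    rw [h3, hB.antipode_right, Algebra.algebraMap_eq_smul_one, map_smul, hcounit]
    change εB b * εA F = εA F * εB b
    exact mul_comm _ _
  have h := congrArg (fun g : WithConv (A →ₗ[ℚ] D) => (g F) b) (left_inv_eq_right_inv hxy hyz)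
  exact h

end Antipode

end SuperSym

namespace SuperSym

open Finset TensorProduct

/-! ### Factorizations of juxtaposed monomials and their signs. -/

namespace SSeries

/-- The ways to write the monomial `u` as a product of two monomials, up to sign: `(B, p)` stands for
the factors `θ_B x^{p_1}` and `θ_{u_1 ∖ B} x^{p_2}`. -/
noncomputable def factorizations (u : Mon) : Finset (Finset ℕ × (ℕ →₀ ℕ) × (ℕ →₀ ℕ)) :=
  u.1.powerset ×ˢ antidiagonal u.2

theorem mem_factorizations {u : Mon} {x : Finset ℕ × (ℕ →₀ ℕ) × (ℕ →₀ ℕ)} :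
    x ∈ factorizations u ↔ x.1 ⊆ u.1 ∧ x.2.1 + x.2.2 = u.2 := by
  rw [factorizations, mem_product, mem_powerset, HasAntidiagonal.mem_antidiagonal]

theorem coeff_mul' (f g : SSeries) (u : Mon) :
    coeff u.1 u.2 (f * g) = ∑ x ∈ factorizations u, crossSign x.1 (u.1 \ x.1) *
      (coeff x.1 x.2.1 f * coeff (u.1 \ x.1) x.2.2 g) := by
  rw [coeff_mul, factorizations, sum_product]

theorem bound_le_iff {u : Mon} {N : ℕ} :
    bound u ≤ N ↔ ∀ n ∈ u.1 ∪ u.2.support, n < N := by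
  simp only [bound, Finset.sup_le_iff, Nat.succ_le_iff]

theorem embDomain_add_apply (N : ℕ) (e : ℕ →₀ ℕ) (n : ℕ) :
    e.embDomain (addRightEmbedding N) n = if N ≤ n then e (n - N) else 0 := by
  split_ifs with h
  · obtain ⟨k, rfl⟩ := Nat.exists_eq_add_of_le' h
    rw [Nat.add_sub_cancel]
    exact Finsupp.embDomain_apply_self (addRightEmbedding N) e k
  · refine Finsupp.embDomain_of_notMem_range _ _ _ ?_
    rintro ⟨k, hk⟩
    simp only [addRightEmbedding_apply] at hk
    omega

theorem mem_map_add {N n : ℕ} {A : Finset ℕ} :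
    n ∈ A.map (addRightEmbedding N) ↔ N ≤ n ∧ n - N ∈ A := by
  simp only [mem_map, addRightEmbedding_apply]
  constructor
  · rintro ⟨k, hk, rfl⟩
    exact ⟨by omega, by simpa using hk⟩
  · rintro ⟨h, hk⟩
    exact ⟨n - N, hk, by omega⟩

theorem eq_zero_of_bound_le {u : Mon} {N n : ℕ} (hu : bound u ≤ N) (hn : N ≤ n) : u.2 n = 0 := by
  by_contra h
  have := bound_le_iff.1 hu n (mem_union_right _ (Finsupp.mem_support_iff.2 h))
  omega

theorem notMem_of_bound_le {u : Mon} {N n : ℕ} (hu : bound u ≤ N) (hn : N ≤ n) : n ∉ u.1 :=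
  fun h => by
    have := bound_le_iff.1 hu n (mem_union_left _ h)
    omega

theorem mem_juxt_fst {u v : Mon} {N n : ℕ} :
    n ∈ (juxt N u v).1 ↔ n ∈ u.1 ∨ (N ≤ n ∧ n - N ∈ v.1) := by
  rw [juxt, mem_union, mem_map_add]

theorem juxt_snd_apply (u v : Mon) (N n : ℕ) :
    (juxt N u v).2 n = u.2 n + if N ≤ n then v.2 (n - N) else 0 := by
  rw [juxt, Finsupp.add_apply, embDomain_add_apply]

theorem bound_juxt_le {u v : Mon} {N M : ℕ} (hu : bound u ≤ N) (hv : bound v ≤ M) :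
    bound (juxt N u v) ≤ N + M := by
  rw [bound_le_iff]
  intro n hn
  by_contra h
  rw [mem_union, mem_juxt_fst, Finsupp.mem_support_iff, juxt_snd_apply, if_pos (by omega),
    eq_zero_of_bound_le hu (by omega), eq_zero_of_bound_le hv (by omega)] at hn
  rcases hn with (h1 | ⟨-, h1⟩) | h1
  · exact notMem_of_bound_le hu (by omega) h1
  · exact notMem_of_bound_le hv (by omega) h1
  · exact h1 rfl

/-- Shifting by `M` and then by `N` is shifting by `N + M`. This is coassociativity at the level of
monomials. -/
theorem juxt_juxt (N M : ℕ) (u v w : Mon) :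
    juxt N u (juxt M v w) = juxt (N + M) (juxt N u v) w := by
  refine Prod.ext ?_ ?_
  · ext n
    simp only [mem_juxt_fst]
    constructor
    · rintro (h | ⟨h1, h2 | ⟨h2, h3⟩⟩)
      · exact Or.inl (Or.inl h)
      · exact Or.inl (Or.inr ⟨h1, h2⟩)
      · exact Or.inr ⟨by omega, by rwa [← Nat.sub_sub]⟩
    · rintro ((h | ⟨h1, h2⟩) | ⟨h1, h2⟩)
      · exact Or.inl h
      · exact Or.inr ⟨h1, Or.inl h2⟩
      · exact Or.inr ⟨by omega, Or.inr ⟨by omega, by rwa [Nat.sub_sub]⟩⟩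
  · ext n
    simp only [juxt_snd_apply]
    by_cases h1 : N ≤ n
    · by_cases h2 : N + M ≤ n
      · rw [if_pos h1, if_pos h1, if_pos h2, if_pos (by omega), Nat.sub_sub, add_assoc]
      · rw [if_pos h1, if_pos h1, if_neg h2, if_neg (by omega), add_assoc]
    · rw [if_neg h1, if_neg h1, if_neg (by omega)]

/-- The part of the exponent vector `e` that belongs to the variables with indices below `N`. -/
noncomputable def lowExp (N : ℕ) (e : ℕ →₀ ℕ) : ℕ →₀ ℕ := e.filter (· < N)

/-- The part of the exponent vector `e` that belongs to the other variables, shifted by `N`. -/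
noncomputable def highExp (N : ℕ) (e : ℕ →₀ ℕ) : ℕ →₀ ℕ :=
  e.comapDomain (addRightEmbedding N) (addRightEmbedding N).injective.injOn

theorem lowExp_apply (N : ℕ) (e : ℕ →₀ ℕ) (n : ℕ) :
    lowExp N e n = if n < N then e n else 0 := Finsupp.filter_apply _ _ _

theorem highExp_apply (N : ℕ) (e : ℕ →₀ ℕ) (n : ℕ) : highExp N e n = e (n + N) := rfl

theorem bound_le_of_mem_factorizations {u : Mon} {N : ℕ} (hu : bound u ≤ N)
    {x : Finset ℕ × (ℕ →₀ ℕ) × (ℕ →₀ ℕ)} (hx : x ∈ factorizations u) :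
    bound (x.1, x.2.1) ≤ N ∧ bound (u.1 \ x.1, x.2.2) ≤ N := by
  rw [mem_factorizations] at hx
  rw [bound_le_iff] at hu
  refine ⟨bound_le_iff.2 fun n hn => hu n ?_, bound_le_iff.2 fun n hn => hu n ?_⟩
  · rw [mem_union, Finsupp.mem_support_iff] at hn ⊢
    rw [← hx.2, Finsupp.add_apply]
    exact hn.imp (fun h => hx.1 h) (fun h => by simp only at h; omega)
  · rw [mem_union, Finsupp.mem_support_iff] at hn ⊢
    rw [← hx.2, Finsupp.add_apply]
    exact hn.imp (fun h => (mem_sdiff.1 h).1) (fun h => by simp only at h; omega)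

/-- The factorizations of a juxtaposition of two monomials. -/
theorem sum_factorizations_juxt {u v : Mon} {N : ℕ} (hu : bound u ≤ N)
    (F : Finset ℕ × (ℕ →₀ ℕ) × (ℕ →₀ ℕ) → ℚ) :
    ∑ z ∈ factorizations (juxt N u v), F z =
      ∑ x ∈ factorizations u, ∑ y ∈ factorizations v,
        F ((juxt N (x.1, x.2.1) (y.1, y.2.1)).1, (juxt N (x.1, x.2.1) (y.1, y.2.1)).2,
          (juxt N (x.1, x.2.2) (y.1, y.2.2)).2) := by
  rw [← sum_product' (factorizations u) (factorizations v) fun x y =>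
    F ((juxt N (x.1, x.2.1) (y.1, y.2.1)).1, (juxt N (x.1, x.2.1) (y.1, y.2.1)).2,
          (juxt N (x.1, x.2.2) (y.1, y.2.2)).2)]
  symm
  refine sum_bij' (fun w _ => ((juxt N (w.1.1, w.1.2.1) (w.2.1, w.2.2.1)).1,
      (juxt N (w.1.1, w.1.2.1) (w.2.1, w.2.2.1)).2,
      (juxt N (w.1.1, w.1.2.2) (w.2.1, w.2.2.2)).2))
    -- The inverse cuts a factorization at `N`: indices below `N` belong to `u`, the others, shifted
    -- back, to `v`.
    (fun z _ => ((z.1.filter (· < N), lowExp N z.2.1, lowExp N z.2.2),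
      (z.1.preimage (addRightEmbedding N) (addRightEmbedding N).injective.injOn,
        highExp N z.2.1, highExp N z.2.2))) ?_ ?_ ?_ ?_ ?_
  · rintro ⟨x, y⟩ h
    rw [mem_product, mem_factorizations, mem_factorizations] at h
    obtain ⟨⟨h1, h2⟩, h3, h4⟩ := h
    rw [mem_factorizations]
    refine ⟨fun n hn => ?_, ?_⟩
    · rw [mem_juxt_fst] at hn ⊢
      exact hn.imp (fun h => h1 h) (fun h => ⟨h.1, h3 h.2⟩)
    · ext n
      rw [Finsupp.add_apply, juxt_snd_apply, juxt_snd_apply, juxt_snd_apply, ← h2, ← h4]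
      simp only [Finsupp.add_apply]
      split_ifs <;> omega
  · rintro z h
    rw [mem_factorizations] at h
    obtain ⟨h1, h2⟩ := h
    have h3 : ∀ n, z.2.1 n + z.2.2 n = (juxt N u v).2 n := fun n => by rw [← h2]; rfl
    rw [mem_product, mem_factorizations, mem_factorizations]
    refine ⟨⟨fun n hn => ?_, ?_⟩, fun n hn => ?_, ?_⟩
    · obtain ⟨hn, hlt⟩ := mem_filter.1 hn
      rcases mem_juxt_fst.1 (h1 hn) with h | ⟨h, -⟩
      · exact h
      · omega
    · ext n
      have := h3 n
      rw [juxt_snd_apply] at this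
      simp only [Finsupp.add_apply, lowExp_apply]
      split_ifs with hn
      · rw [this, if_neg (by omega), add_zero]
      · exact (eq_zero_of_bound_le hu (by omega)).symm
    · have hn' : n + N ∈ z.1 := by simpa only [mem_preimage, addRightEmbedding_apply] using hn
      rcases mem_juxt_fst.1 (h1 hn') with h | ⟨-, h⟩
      · exact absurd h (notMem_of_bound_le hu (by omega))
      · rwa [Nat.add_sub_cancel] at h
    · ext n
      have := h3 (n + N)
      rw [juxt_snd_apply, eq_zero_of_bound_le hu (by omega), if_pos (by omega),
        Nat.add_sub_cancel, zero_add] at this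
      exact this
  · rintro ⟨x, y⟩ h
    rw [mem_product] at h
    have hb := bound_le_of_mem_factorizations hu h.1
    refine Prod.ext (Prod.ext ?_ (Prod.ext ?_ ?_)) (Prod.ext ?_ (Prod.ext ?_ ?_))
    · ext n
      simp only [mem_filter, mem_juxt_fst]
      constructor
      · rintro ⟨h | h, h'⟩
        · exact h
        · omega
      · exact fun h => ⟨Or.inl h, bound_le_iff.1 hb.1 n (mem_union_left _ h)⟩
    · ext n
      simp only [lowExp_apply, juxt_snd_apply]
      split_ifs
      · omega
      · omega
      · exact (eq_zero_of_bound_le hb.1 (by omega)).symm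
    · ext n
      simp only [lowExp_apply, juxt_snd_apply]
      split_ifs
      · omega
      · omega
      · exact (eq_zero_of_bound_le hb.2 (by omega)).symm
    · ext n
      simp only [mem_preimage, addRightEmbedding_apply, mem_juxt_fst, Nat.add_sub_cancel]
      constructor
      · rintro (h | h)
        · exact absurd h (notMem_of_bound_le hb.1 (by omega))
        · exact h.2
      · exact fun h => Or.inr ⟨by omega, h⟩
    · ext n
      have := eq_zero_of_bound_le hb.1 (show N ≤ n + N by omega)
      simp only at this
      simp [highExp_apply, juxt_snd_apply, this]
    · ext n
      have := eq_zero_of_bound_le hb.2 (show N ≤ n + N by omega)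
      simp only at this
      simp [highExp_apply, juxt_snd_apply, this]
  · rintro z h
    refine Prod.ext ?_ (Prod.ext ?_ ?_)
    · ext n
      simp only [mem_juxt_fst, mem_filter, mem_preimage, addRightEmbedding_apply]
      by_cases hn : n < N
      · simp [hn, not_le.2 hn]
      · simp [hn, not_lt.1 hn, Nat.sub_add_cancel (not_lt.1 hn)]
    · ext n
      simp only [juxt_snd_apply, lowExp_apply, highExp_apply]
      by_cases hn : n < N
      · simp [hn, not_le.2 hn]
      · simp [hn, not_lt.1 hn, Nat.sub_add_cancel (not_lt.1 hn)]
    · ext n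
      simp only [juxt_snd_apply, lowExp_apply, highExp_apply]
      by_cases hn : n < N
      · simp [hn, not_le.2 hn]
      · simp [hn, not_lt.1 hn, Nat.sub_add_cancel (not_lt.1 hn)]
  · rintro w h
    rfl

/-- Every shifted index of `Y` exceeds every index of `Z`, so all these pairs are inversions, while
`X` and the shifted `W` have none. The extra power of `-1` is the sign in the product on `V ⊗ V`. -/
theorem crossSign_juxt {X Y Z W : Finset ℕ} {N : ℕ} (hX : ∀ n ∈ X, n < N) (hZ : ∀ n ∈ Z, n < N) :
    crossSign (X ∪ Y.map (addRightEmbedding N)) (Z ∪ W.map (addRightEmbedding N)) =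
      (-1) ^ (Y.card * Z.card) * (crossSign X Z * crossSign Y W) := by
  have hd : ∀ {X Y : Finset ℕ}, (∀ n ∈ X, n < N) → Disjoint X (Y.map (addRightEmbedding N)) := by
    intro X Y hX
    rw [disjoint_left]
    intro n hn hn'
    have := hX n hn
    have := (mem_map_add.1 hn').1
    omega
  rw [crossSign_union_left (hd hX), crossSign_union_right (hd hZ), crossSign_union_right (hd hZ)]
  have h1 : crossSign X (W.map (addRightEmbedding N)) = 1 :=
    prod_eq_one fun b hb => prod_eq_one fun c hc => if_neg (by
      have := hX b hb
      have := (mem_map_add.1 hc).1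
      omega)
  have h2 : crossSign (Y.map (addRightEmbedding N)) Z = (-1) ^ (Y.card * Z.card) := by
    rw [crossSign, prod_congr rfl fun b hb => prod_congr rfl fun c hc => if_pos (by
      have := hZ c hc
      have := (mem_map_add.1 hb).1
      omega)]
    rw [prod_const, prod_const, card_map, ← pow_mul, mul_comm]
  have h3 : crossSign (Y.map (addRightEmbedding N)) (W.map (addRightEmbedding N)) =
      crossSign Y W := by
    simp only [crossSign, prod_map, addRightEmbedding_apply, Nat.add_lt_add_iff_right]
  rw [h1, h2, h3]
  ring

/-- The coefficients of `(fg)(x, y; θ, φ)`. -/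
theorem split_mul {f g : SSeries} (hf : IsQuasi f) (hg : IsQuasi g) (u v : Mon) :
    split (f * g) u v = ∑ x ∈ factorizations u, ∑ y ∈ factorizations v,
      (-1) ^ (y.1.card * (u.1 \ x.1).card) *
        (crossSign x.1 (u.1 \ x.1) * crossSign y.1 (v.1 \ y.1)) *
        (split f (x.1, x.2.1) (y.1, y.2.1) *
          split g (u.1 \ x.1, x.2.2) (v.1 \ y.1, y.2.2)) := by
  rw [split_apply, coeff_mul', sum_factorizations_juxt le_rfl]
  refine sum_congr rfl fun x hx => sum_congr rfl fun y hy => ?_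
  have hb := bound_le_of_mem_factorizations le_rfl hx
  have hx1 : ∀ n ∈ x.1, n < bound u := fun n hn =>
    bound_le_iff.1 hb.1 n (mem_union_left _ hn)
  have hx2 : ∀ n ∈ u.1 \ x.1, n < bound u := fun n hn =>
    bound_le_iff.1 hb.2 n (mem_union_left _ hn)
  have h1 : (juxt (bound u) u v).1 \ (juxt (bound u) (x.1, x.2.1) (y.1, y.2.1)).1 =
      (juxt (bound u) (u.1 \ x.1, x.2.2) (v.1 \ y.1, y.2.2)).1 := by
    ext n
    rw [mem_sdiff, mem_juxt_fst, mem_juxt_fst, mem_juxt_fst]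
    simp only [mem_sdiff]
    by_cases hn : bound u ≤ n
    · have h2 : n ∉ u.1 := notMem_of_bound_le le_rfl hn
      have h3 : n ∉ x.1 := notMem_of_bound_le hb.1 hn
      tauto
    · tauto
  have h2 : (juxt (bound u) (x.1, x.2.2) (y.1, y.2.2)).2 =
    (juxt (bound u) (u.1 \ x.1, x.2.2) (v.1 \ y.1, y.2.2)).2 := rfl
  simp only [h1, h2]
  rw [← split_eq_of_le hf hb.1, ← split_eq_of_le hg hb.2]
  congr 1
  exact crossSign_juxt hx1 hx2

/-! ### Coalgebra axioms, uniformly for `sQSym` and `sSym`. -/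

section Subalgebra

variable {V : Subalgebra ℚ SSeries}

/-- The coefficient of the monomial `u`, as a functional on `V`. -/
noncomputable def coeffOn (V : Subalgebra ℚ SSeries) (u : Mon) : V →ₗ[ℚ] ℚ :=
  coeff u.1 u.2 ∘ₗ V.toSubmodule.subtype

theorem coeffOn_apply (u : Mon) (f : V) : coeffOn V u f = coeff u.1 u.2 (f : SSeries) := rfl

theorem eq_zero_of_coeffOn (f : V) (h : ∀ u, coeffOn V u f = 0) : f = 0 :=
  Subtype.ext (ext fun A e => (h (A, e)).trans (map_zero _).symm)

theorem eq_of_coeffOn {f g : V} (h : ∀ u, coeffOn V u f = coeffOn V u g) : f = g :=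
  Subtype.ext (ext fun A e => h (A, e))

theorem tensorEval_coeffOn (t : V ⊗[ℚ] V) (u v : Mon) :
    tensorEval (coeffOn V u) (coeffOn V v) t = twoAlphabet V t u v := by
  induction t with
  | zero => simp
  | add x y hx hy => rw [map_add, map_add, hx, hy]; rfl
  | tmul x y => rfl

theorem coeffOn_lid_rTensor (v : Mon) (t : V ⊗[ℚ] V) :
    coeffOn V v (TensorProduct.lid ℚ V ((counit V).rTensor V t)) =
      twoAlphabet V t (∅, 0) v := by
  induction t with
  | zero => simp
  | add x y hx hy => simp only [map_add, hx, hy]; rfl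
  | tmul x y =>
    rw [LinearMap.rTensor_tmul, TensorProduct.lid_tmul, map_smul, twoAlphabet_tmul]
    rfl

theorem coeffOn_rid_lTensor (u : Mon) (t : V ⊗[ℚ] V) :
    coeffOn V u (TensorProduct.rid ℚ V ((counit V).lTensor V t)) =
      twoAlphabet V t u (∅, 0) := by
  induction t with
  | zero => simp
  | add x y hx hy => simp only [map_add, hx, hy]; rfl
  | tmul x y =>
    rw [LinearMap.lTensor_tmul, TensorProduct.rid_tmul, map_smul, twoAlphabet_tmul, mul_comm]
    rfl

theorem juxt_empty_left (v : Mon) : juxt (bound (∅, 0)) (∅, 0) v = v := by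
  have h : bound (∅, 0) = 0 := by simp [bound]
  rw [h]
  refine Prod.ext ?_ ?_
  · ext n; simp [mem_juxt_fst]
  · ext n; simp [juxt_snd_apply]

theorem juxt_empty_right (N : ℕ) (u : Mon) : juxt N u (∅, 0) = u := by
  refine Prod.ext ?_ ?_
  · ext n; simp [mem_juxt_fst]
  · ext n; simp [juxt_snd_apply]

theorem counit_rTensor_comul (hV : SplitClosed V) (f : V) :
    (counit V).rTensor V (comul hV f) = 1 ⊗ₜ f := by
  refine (TensorProduct.lid ℚ V).injective (eq_of_coeffOn fun v => ?_)
  rw [coeffOn_lid_rTensor, twoAlphabet_comul, split_apply, juxt_empty_left, TensorProduct.lid_tmul,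
    one_smul]
  rfl

theorem counit_lTensor_comul (hV : SplitClosed V) (f : V) :
    (counit V).lTensor V (comul hV f) = f ⊗ₜ 1 := by
  refine (TensorProduct.rid ℚ V).injective (eq_of_coeffOn fun u => ?_)
  rw [coeffOn_rid_lTensor, twoAlphabet_comul, split_apply, juxt_empty_right,
    TensorProduct.rid_tmul, one_smul]
  rfl

theorem comul_one (hV : SplitClosed V) : comul hV 1 = 1 ⊗ₜ 1 := by
  refine twoAlphabet_injective V ?_
  rw [twoAlphabet_comul]
  funext u v
  rw [twoAlphabet_tmul, split_apply, Subalgebra.coe_one, coeff_one, coeff_one, coeff_one]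
  have h1 : (juxt (bound u) u v).1 = ∅ ↔ u.1 = ∅ ∧ v.1 = ∅ := by
    rw [juxt, union_eq_empty, map_eq_empty]
  have h2 : (juxt (bound u) u v).2 = 0 ↔ u.2 = 0 ∧ v.2 = 0 := by
    simp only [juxt]
    rw [add_eq_zero, Finsupp.embDomain_eq_zero]
  simp only [h1, h2]
  rw [ite_zero_mul_ite_zero, mul_one]
  congr 1
  exact propext (by tauto)

/-- Either iterated coproduct reads off the coefficient of `f` at the juxtaposition of three
monomials; this lemma and the next differ only in the bracketing, which `juxt_juxt` reconciles. -/
theorem tensorEval_rTensor_comul (hV : SplitClosed V) (u v w : Mon) (f : V) :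
    tensorEval (coeffOn V u) (tensorEval (coeffOn V v) (coeffOn V w))
      (TensorProduct.assoc ℚ V V V ((comul hV).rTensor V (comul hV f))) =
      coeff (juxt (bound u + bound v) (juxt (bound u) u v) w).1
        (juxt (bound u + bound v) (juxt (bound u) u v) w).2 (f : SSeries) := by
  have h1 : ∀ t : V ⊗[ℚ] V, tensorEval (coeffOn V u) (tensorEval (coeffOn V v) (coeffOn V w))
      (TensorProduct.assoc ℚ V V V ((comul hV).rTensor V t)) =
      twoAlphabet V t (juxt (bound u) u v) w := fun t => by
    induction t with
    | zero => simp only [LinearMap.map_zero, LinearEquiv.map_zero]; rfl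
    | add x y hx hy => simp only [LinearMap.map_add, LinearEquiv.map_add, hx, hy]; rfl
    | tmul x y =>
      have h2 : ∀ s : V ⊗[ℚ] V, tensorEval (coeffOn V u)
          (tensorEval (coeffOn V v) (coeffOn V w)) (TensorProduct.assoc ℚ V V V (s ⊗ₜ y)) =
          twoAlphabet V s u v * coeffOn V w y := fun s => by
        induction s with
        | zero =>
          rw [TensorProduct.zero_tmul]
          simp only [LinearMap.map_zero, LinearEquiv.map_zero, Pi.zero_apply, zero_mul]
        | add x' y' hx hy =>
          rw [TensorProduct.add_tmul]
          simp only [LinearMap.map_add, LinearEquiv.map_add, hx, hy, Pi.add_apply, add_mul]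
        | tmul x' y' => simp [twoAlphabet_tmul, coeffOn_apply, mul_assoc]
      rw [LinearMap.rTensor_tmul, h2, twoAlphabet_comul, split_apply, twoAlphabet_tmul]
      rfl
  -- The coproduct shifts `w` by the bound of the juxtaposition of `u` and `v`. Quasisymmetry
  -- permits the possibly larger shift `bound u + bound v` that matches the other bracketing.
  rw [h1, twoAlphabet_comul, split_eq_of_le (hV.1 f.2).2 (bound_juxt_le le_rfl le_rfl)]

theorem tensorEval_lTensor_comul (hV : SplitClosed V) (u v w : Mon) (f : V) :
    tensorEval (coeffOn V u) (tensorEval (coeffOn V v) (coeffOn V w))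
      ((comul hV).lTensor V (comul hV f)) =
      coeff (juxt (bound u) u (juxt (bound v) v w)).1
        (juxt (bound u) u (juxt (bound v) v w)).2 (f : SSeries) := by
  have h1 : ∀ t : V ⊗[ℚ] V, tensorEval (coeffOn V u) (tensorEval (coeffOn V v) (coeffOn V w))
      ((comul hV).lTensor V t) =
      twoAlphabet V t u (juxt (bound v) v w) := fun t => by
    induction t with
    | zero => simp
    | add x y hx hy => simp only [map_add, hx, hy]; rfl
    | tmul x y =>
      rw [LinearMap.lTensor_tmul, tensorEval_tmul, tensorEval_coeffOn, twoAlphabet_comul,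
        split_apply, twoAlphabet_tmul]
      rfl
  rw [h1, twoAlphabet_comul, split_apply]

theorem comul_coassoc (hV : SplitClosed V) :
    TensorProduct.assoc ℚ V V V ∘ₗ (comul hV).rTensor V ∘ₗ comul hV =
      (comul hV).lTensor V ∘ₗ comul hV := by
  refine LinearMap.ext fun f => tensor_ext (φ := coeffOn V)
    (ψ := fun p : Mon × Mon => tensorEval (coeffOn V p.1) (coeffOn V p.2))
    eq_zero_of_coeffOn ?_ ?_
  · exact fun t ht => tensor_eq_zero eq_zero_of_coeffOn eq_zero_of_coeffOn fun i j => ht (i, j)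
  · rintro u ⟨v, w⟩
    refine (tensorEval_rTensor_comul hV u v w f).trans ?_
    rw [← juxt_juxt]
    exact (tensorEval_lTensor_comul hV u v w f).symm

/-- This is the tensor product algebra without the sign for exchanging the middle factors;
`superMul` is a combination of four such products. -/
theorem twoAlphabet_mul (s t : V ⊗[ℚ] V) (u v : Mon) :
    twoAlphabet V (s * t) u v = ∑ x ∈ factorizations u, ∑ y ∈ factorizations v,
      (crossSign x.1 (u.1 \ x.1) * crossSign y.1 (v.1 \ y.1)) *
        (twoAlphabet V s (x.1, x.2.1) (y.1, y.2.1) *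
          twoAlphabet V t (u.1 \ x.1, x.2.2) (v.1 \ y.1, y.2.2)) := by
  induction s with
  | zero => simp
  | add s s' hs hs' =>
    simp only [add_mul, map_add, Pi.add_apply, hs, hs', mul_add, sum_add_distrib]
  | tmul f g =>
    induction t with
    | zero => simp
    | add t t' ht ht' =>
      simp only [mul_add, map_add, Pi.add_apply, ht, ht', sum_add_distrib]
    | tmul f' g' =>
      rw [Algebra.TensorProduct.tmul_mul_tmul, twoAlphabet_tmul, Subalgebra.coe_mul,
        Subalgebra.coe_mul, coeff_mul', coeff_mul', sum_mul_sum]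
      refine sum_congr rfl fun x _ => sum_congr rfl fun y _ => ?_
      rw [twoAlphabet_tmul, twoAlphabet_tmul]
      ring

theorem twoAlphabet_lTensor {P : V →ₗ[ℚ] V} (hP : ∀ f : V, (P f : SSeries) = parity f)
    (t : V ⊗[ℚ] V) (u v : Mon) :
    twoAlphabet V (P.lTensor V t) u v = (-1) ^ v.1.card * twoAlphabet V t u v := by
  induction t with
  | zero => simp
  | add s s' hs hs' => simp only [map_add, Pi.add_apply, hs, hs', mul_add]
  | tmul f g => rw [LinearMap.lTensor_tmul, twoAlphabet_tmul, twoAlphabet_tmul, hP, coeff_parity]; ring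

theorem twoAlphabet_rTensor {P : V →ₗ[ℚ] V} (hP : ∀ f : V, (P f : SSeries) = parity f)
    (t : V ⊗[ℚ] V) (u v : Mon) :
    twoAlphabet V (P.rTensor V t) u v = (-1) ^ u.1.card * twoAlphabet V t u v := by
  induction t with
  | zero => simp
  | add s s' hs hs' => simp only [map_add, Pi.add_apply, hs, hs', mul_add]
  | tmul f g => rw [LinearMap.rTensor_tmul, twoAlphabet_tmul, twoAlphabet_tmul, hP, coeff_parity]; ring

end Subalgebra

end SSeries

/-- Written this way, the exchange sign depends on the two parities only through linear operations,
so no homogeneous decomposition is needed in `superMul`. -/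
theorem sign_mul_eq (a b : ℕ) :
    (-1 : ℚ) ^ (a * b) = 1 / 2 * (1 + (-1) ^ a + (-1) ^ b - (-1) ^ a * (-1) ^ b) := by
  rcases Nat.even_or_odd a with ha | ha <;> rcases Nat.even_or_odd b with hb | hb
  · rw [(ha.mul_right b).neg_one_pow, ha.neg_one_pow, hb.neg_one_pow]; norm_num
  · rw [(ha.mul_right b).neg_one_pow, ha.neg_one_pow, hb.neg_one_pow]; norm_num
  · rw [(hb.mul_left a).neg_one_pow, ha.neg_one_pow, hb.neg_one_pow]; norm_num
  · rw [(ha.mul hb).neg_one_pow, ha.neg_one_pow, hb.neg_one_pow]; norm_num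

/-! ### The signed product, the grading, and the antipodes of `sQSym` and `sSym`. -/

namespace SSeries

variable {V : Subalgebra ℚ SSeries}

theorem twoAlphabet_superMul {P : V →ₗ[ℚ] V} (hP : ∀ f : V, (P f : SSeries) = parity f)
    (s t : V ⊗[ℚ] V) (u v : Mon) :
    twoAlphabet V (superMul P s t) u v = ∑ x ∈ factorizations u, ∑ y ∈ factorizations v,
      (-1) ^ (y.1.card * (u.1 \ x.1).card) *
        (crossSign x.1 (u.1 \ x.1) * crossSign y.1 (v.1 \ y.1)) *
        (twoAlphabet V s (x.1, x.2.1) (y.1, y.2.1) *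
          twoAlphabet V t (u.1 \ x.1, x.2.2) (v.1 \ y.1, y.2.2)) := by
  rw [superMul]
  simp only [map_smul, map_add, map_sub, Pi.smul_apply, Pi.add_apply, Pi.sub_apply,
    twoAlphabet_mul, twoAlphabet_lTensor hP, twoAlphabet_rTensor hP, ← sum_add_distrib,
    ← sum_sub_distrib, smul_eq_mul, mul_sum]
  refine sum_congr rfl fun x _ => sum_congr rfl fun y _ => ?_
  rw [sign_mul_eq]
  ring

theorem comul_mul (hV : SplitClosed V) {P : V →ₗ[ℚ] V}
    (hP : ∀ f : V, (P f : SSeries) = parity f) (f g : V) :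
    comul hV (f * g) = superMul P (comul hV f) (comul hV g) := by
  refine twoAlphabet_injective V ?_
  funext u v
  rw [twoAlphabet_superMul hP, twoAlphabet_comul, twoAlphabet_comul, twoAlphabet_comul,
    Subalgebra.coe_mul, split_mul (hV.1 f.2).2 (hV.1 g.2).2]

/-- The component of degree `k`, where the `x`'s and the `θ`'s have degree `1`. -/
noncomputable def homog (k : ℕ) : SSeries →ₗ[ℚ] SSeries where
  toFun f := of fun A e => if A.card + e.degree = k then coeff A e f else 0
  map_add' f g := ext fun A e => by
    simp only [coeff_of, map_add]; split_ifs <;> simp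
  map_smul' r f := ext fun A e => by
    simp only [coeff_of, map_smul, RingHom.id_apply]; split_ifs <;> simp

theorem coeff_homog (k : ℕ) (f : SSeries) (A : Finset ℕ) (e : ℕ →₀ ℕ) :
    coeff A e (homog k f) = if A.card + e.degree = k then coeff A e f else 0 := rfl

theorem relabel_homog (φ : ℕ ↪ ℕ) (k : ℕ) (f : SSeries) :
    relabel φ (homog k f) = homog k (relabel φ f) :=
  ext fun A e => by
    simp only [coeff_relabel, coeff_homog, card_map, Finsupp.embDomain_eq_mapDomain,
      Finsupp.degree_mapDomain, mul_ite, mul_zero]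

theorem bounded_homog (k : ℕ) (f : SSeries) : Bounded (homog k f) k := fun A e h => by
  rw [coeff_homog] at h
  split_ifs at h with h'
  · exact h'.le
  · exact absurd rfl h

theorem homog_mem_sQSym (k : ℕ) (f : SSeries) (hf : f ∈ sQSym) : homog k f ∈ sQSym :=
  ⟨⟨k, bounded_homog k f⟩, isQuasi_iff.2 fun φ => by
    rw [relabel_homog, isQuasi_iff.1 hf.2 φ]⟩

theorem homog_mem_sSym (k : ℕ) (f : SSeries) (hf : f ∈ sSym) : homog k f ∈ sSym :=
  ⟨⟨k, bounded_homog k f⟩, fun σ => by rw [relabel_homog, hf.2 σ]⟩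

/-- The component of degree `k` in a subalgebra that is closed under taking components. -/
noncomputable def homogOn (hH : ∀ k, ∀ f ∈ V, homog k f ∈ V) (k : ℕ) : V →ₗ[ℚ] V :=
  (homog k ∘ₗ V.toSubmodule.subtype).codRestrict V.toSubmodule fun f => hH k f f.2

theorem coe_homogOn (hH : ∀ k, ∀ f ∈ V, homog k f ∈ V) (k : ℕ) (f : V) :
    (homogOn hH k f : SSeries) = homog k f := rfl

theorem eq_sum_homogOn (hV : V ≤ sQSym) (hH : ∀ k, ∀ f ∈ V, homog k f ∈ V) (f : V) :
    ∃ N, f = ∑ k ∈ range N, homogOn hH k f := by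
  obtain ⟨⟨d, hd⟩, -⟩ := hV f.2
  refine ⟨d + 1, eq_of_coeffOn fun u => ?_⟩
  simp only [map_sum, coeffOn_apply, coe_homogOn, coeff_homog, sum_ite_eq, mem_range]
  split_ifs with h
  · rfl
  · by_contra hne
    have := hd _ _ hne
    omega

/-- Quasisymmetric and symmetric functions in superspace are Hopf algebras. -/
theorem exists_isSuperHopf (hV : SplitClosed V) (hH : ∀ k, ∀ f ∈ V, homog k f ∈ V)
    {P : V →ₗ[ℚ] V} (hP : ∀ f : V, (P f : SSeries) = parity f) :
    ∃ S, IsSuperHopf P (comul hV) (counit V) S := by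
  obtain ⟨S, h1, h2⟩ := exists_antipode (comul_coassoc hV) (counit_rTensor_comul hV)
    (counit_lTensor_comul hV) (homogOn hH) (fun k f => by
      refine twoAlphabet_injective V ?_
      have h1 : ∀ (i j : ℕ) (t : V ⊗[ℚ] V) (u v : Mon),
          twoAlphabet V (TensorProduct.map (homogOn hH i) (homogOn hH j) t) u v =
          if u.1.card + u.2.degree = i ∧ v.1.card + v.2.degree = j then
            twoAlphabet V t u v else 0 := fun i j t u v => by
        induction t with
        | zero => simp
        | add x y hx hy => simp only [map_add, Pi.add_apply, hx, hy]; split_ifs <;> simp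
        | tmul x y =>
          rw [TensorProduct.map_tmul, twoAlphabet_tmul, twoAlphabet_tmul, coe_homogOn, coe_homogOn,
            coeff_homog, coeff_homog, ite_zero_mul_ite_zero]
      funext u v
      rw [map_sum, Finset.sum_apply, Finset.sum_apply]
      simp only [h1, twoAlphabet_comul]
      -- Degrees add under juxtaposition, so the only pair in the antidiagonal that can contribute
      -- consists of the degrees of `u` and `v`.
      rw [coe_homogOn, split_apply, coeff_homog, juxt_weight, split_apply]
      split_ifs with h
      · rw [sum_eq_single (u.1.card + u.2.degree, v.1.card + v.2.degree)]
        · simp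
        · rintro ⟨i, j⟩ - hne
          refine if_neg ?_
          rintro ⟨rfl, rfl⟩
          exact hne rfl
        · exact fun h' => absurd (HasAntidiagonal.mem_antidiagonal.2 h) h'
      · refine (sum_eq_zero ?_).symm
        rintro ⟨i, j⟩ hij
        rw [HasAntidiagonal.mem_antidiagonal] at hij
        refine if_neg ?_
        rintro ⟨rfl, rfl⟩
        exact h hij)
    (fun f => eq_of_coeffOn fun u => by
      rw [Algebra.algebraMap_eq_smul_one, map_smul, coeffOn_apply, coeffOn_apply, counit,
        LinearMap.comp_apply]
      change _ = coeff ∅ 0 ((homogOn hH 0 f : V) : SSeries) • coeff u.1 u.2 (1 : SSeries)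
      rw [coe_homogOn, coeff_homog, coeff_homog, coeff_one]
      by_cases h : u.1 = ∅ ∧ u.2 = 0
      · simp [h.1, h.2]
      · have : ¬ (u.1.card + u.2.degree = 0) := fun h' => h ⟨card_eq_zero.1 (by omega),
          Finsupp.degree_eq_zero_iff _ |>.1 (by omega)⟩
        rw [if_neg this, if_neg h, smul_zero])
    (eq_sum_homogOn hV.1 hH)
  exact ⟨S, {
    coassoc := comul_coassoc hV
    counit_left := counit_rTensor_comul hV
    counit_right := counit_lTensor_comul hV
    comul_one := comul_one hV
    comul_mul := comul_mul hV hP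
    counit_one := by
      change coeff ∅ 0 (1 : SSeries) = 1
      rw [coeff_one]; simp
    counit_mul := fun a b => by
      change coeff ∅ 0 ((a : SSeries) * (b : SSeries)) = coeff ∅ 0 (a : SSeries) * coeff ∅ 0 (b : SSeries)
      rw [coeff_mul]
      simp [crossSign]
    antipode_left := h1
    antipode_right := h2 }⟩

end SSeries

end SuperSym

namespace SuperSym

open Finset TensorProduct

/-! ### Shapes of monomials and leading monomials. -/

namespace SSeries

/-- The part that the index `n` contributes to the shape of the monomial `u`. -/
def partAt (u : Mon) (n : ℕ) : DPart :=
  if n ∈ u.1 then Sum.inr (u.2 n) else Sum.inl (u.2 n).toPNat'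

/-- The dotted composition `α` such that `u` is a term of `M_α`. -/
def shape (u : Mon) : DComp :=
  FreeMonoid.ofList (((u.1 ∪ u.2.support).sort (· ≤ ·)).map (partAt u))

theorem sort_map_orderEmb {l : ℕ} (i : Fin l ↪o ℕ) :
    (univ.map i.toEmbedding).sort (· ≤ ·) = List.ofFn i := by
  have h1 : univ.map i.toEmbedding = (List.ofFn i).toFinset := by
    ext n; simp [List.mem_ofFn, eq_comm]
  rw [h1]
  refine (List.toFinset_sort _ (List.nodup_ofFn.2 i.injective)).2 ?_
  exact (List.sortedLT_ofFn_iff.2 i.strictMono).sortedLE.pairwise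

theorem union_support_shape {l : ℕ} (a : Fin l → DPart) (i : Fin l ↪o ℕ) :
    thetaSet a i ∪ (expo a i).support = univ.map i.toEmbedding := by
  ext n
  constructor
  · intro h
    by_contra hn
    have hn' : ∀ k, i k ≠ n := fun k hk => hn (mem_map.2 ⟨k, mem_univ _, hk⟩)
    rcases mem_union.1 h with h | h
    · obtain ⟨k, -, hk⟩ := mem_map.1 h
      exact hn' k hk
    · rw [Finsupp.mem_support_iff, expo, Finsupp.finsetSum_apply] at h
      exact h (sum_eq_zero fun k _ => Finsupp.single_eq_of_ne (hn' k).symm)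
  · intro h
    obtain ⟨k, -, rfl⟩ := mem_map.1 h
    exact mem_of_shape a i k

theorem partAt_shape {l : ℕ} (a : Fin l → DPart) (i : Fin l ↪o ℕ) (k : Fin l) :
    partAt (thetaSet a i, expo a i) (i k) = a k := by
  have h1 : i k ∈ thetaSet a i ↔ (a k).isRight := by
    rw [thetaSet, mem_map]
    constructor
    · rintro ⟨k', hk', h⟩
      rw [← i.injective h]
      exact (mem_filter.1 hk').2
    · exact fun h => ⟨k, mem_filter.2 ⟨mem_univ _, h⟩, rfl⟩
  rw [partAt]
  simp only [h1, expo_apply]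
  rcases a k with n | n
  · simp [DPart.val]
  · simp [DPart.val]

theorem shape_eq {l : ℕ} (a : Fin l → DPart) (i : Fin l ↪o ℕ) :
    shape (thetaSet a i, expo a i) = FreeMonoid.ofList (List.ofFn a) := by
  rw [shape, union_support_shape, sort_map_orderEmb, List.map_ofFn]
  congr 2
  funext k
  exact partAt_shape a i k

/-- The leading monomial of `M_α`. -/
noncomputable def leadMon (α : DComp) : Mon :=
  (thetaSet α.toList.get (Fin.valOrderEmb _), expo α.toList.get (Fin.valOrderEmb _))

theorem shape_leadMon (α : DComp) : shape (leadMon α) = α := by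
  rw [leadMon, shape_eq, List.ofFn_get]
  rfl

theorem leadMon_ofFn {l : ℕ} (a : Fin l → DPart) :
    leadMon (FreeMonoid.ofList (List.ofFn a)) =
      (thetaSet a (Fin.valOrderEmb _), expo a (Fin.valOrderEmb _)) := by
  -- The length of `List.ofFn a` is `l` only up to a proof, so length and entries are replaced
  -- together, as one element of a sigma type.
  have h : (⟨_, (List.ofFn a).get⟩ : Σ n, Fin n → DPart) = ⟨l, a⟩ :=
    List.ofFn_inj'.1 (List.ofFn_get _)
  exact congrArg (fun s : Σ n, Fin n → DPart =>
    ((thetaSet s.2 (Fin.valOrderEmb _), expo s.2 (Fin.valOrderEmb _)) : Mon)) h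

/-- The coefficients of a quasisymmetric series factor through `shape`; the leading monomial, on the
indices `0, 1, 2, ...`, is the chosen representative of a shape. -/
theorem coeff_eq_leadMon {f : SSeries} (hf : IsQuasi f) (u : Mon) :
    coeff u.1 u.2 f = coeff (leadMon (shape u)).1 (leadMon (shape u)).2 f := by
  obtain ⟨l, a, i, -, h1, h2⟩ := exists_eq_expo u.1 u.2
  have h : u = (thetaSet a i, expo a i) := Prod.ext h1.symm h2.symm
  rw [h, shape_eq, leadMon_ofFn]
  exact hf l a i _

theorem coeff_monoSeries (α : DComp) (u : Mon) :
    coeff u.1 u.2 (monoSeries α.toList.get) = if shape u = α then 1 else 0 := by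
  rw [monoSeries, coeff_of]
  congr 1
  refine propext ⟨?_, fun h => ?_⟩
  · rintro ⟨i, h1, h2⟩
    rw [show u = (thetaSet α.toList.get i, expo α.toList.get i) from Prod.ext h1.symm h2.symm,
      shape_eq, List.ofFn_get]
    rfl
  · obtain ⟨l, a, i, -, h1, h2⟩ := exists_eq_expo u.1 u.2
    have hu : u = (thetaSet a i, expo a i) := Prod.ext h1.symm h2.symm
    rw [hu, shape_eq] at h
    have h' : (⟨_, α.toList.get⟩ : Σ n, Fin n → DPart) = ⟨l, a⟩ := by
      refine List.ofFn_inj'.1 ?_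
      rw [List.ofFn_get, ← h]
      rfl
    have key : ∀ s : Σ n, Fin n → DPart, s = ⟨l, a⟩ →
        ∃ i : Fin s.1 ↪o ℕ, thetaSet s.2 i = u.1 ∧ expo s.2 i = u.2 := by
      rintro s rfl
      exact ⟨i, h1, h2⟩
    exact key _ h'

theorem sort_union_map_add {S T : Finset ℕ} {N : ℕ} (hS : ∀ n ∈ S, n < N) :
    (S ∪ T.map (addRightEmbedding N)).sort (· ≤ ·) =
      S.sort (· ≤ ·) ++ (T.sort (· ≤ ·)).map (· + N) := by
  have h1 : S ∪ T.map (addRightEmbedding N) =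
      (S.sort (· ≤ ·) ++ (T.sort (· ≤ ·)).map (· + N)).toFinset := by
    ext n; simp
  rw [h1]
  refine (List.toFinset_sort _ ?_).2 ?_
  · refine List.Nodup.append (sort_nodup _ _)
      ((sort_nodup _ _).map (add_left_injective N)) fun n hn hn' => ?_
    rw [mem_sort] at hn
    obtain ⟨m, -, rfl⟩ := List.mem_map.1 hn'
    have := hS _ hn
    omega
  · refine List.pairwise_append.2 ⟨pairwise_sort _ _, ?_, fun n hn m hm => ?_⟩
    · rw [List.pairwise_map]
      exact (pairwise_sort T (· ≤ ·)).imp fun h => by omega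
    · rw [mem_sort] at hn
      obtain ⟨k, -, rfl⟩ := List.mem_map.1 hm
      have := hS _ hn
      omega

/-- The shifted indices of `v` come after all those of `u`, so sorting lists the parts of `u` first.
This is why the coproduct of `sQSym` is dual to concatenation. -/
theorem shape_juxt {u v : Mon} {N : ℕ} (hu : bound u ≤ N) :
    shape (juxt N u v) = shape u * shape v := by
  have h1 : (juxt N u v).1 ∪ (juxt N u v).2.support =
      (u.1 ∪ u.2.support) ∪ (v.1 ∪ v.2.support).map (addRightEmbedding N) := by
    ext n
    rw [mem_union, mem_juxt_fst, Finsupp.mem_support_iff, juxt_snd_apply, mem_union, mem_map_add]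
    simp only [mem_union, Finsupp.mem_support_iff]
    by_cases hn : N ≤ n
    · simp only [hn, if_true, eq_zero_of_bound_le hu hn, notMem_of_bound_le hu hn]
      simp
    · simp only [hn, if_false]
      simp
  rw [shape, h1, sort_union_map_add (bound_le_iff.1 hu), List.map_append, List.map_map,
    FreeMonoid.ofList_append]
  refine congrArg₂ (· * ·) ?_ ?_
  · refine congrArg FreeMonoid.ofList (List.map_congr_left fun n hn => ?_)
    have hlt := bound_le_iff.1 hu n ((mem_sort _).1 hn)
    simp only [partAt, mem_juxt_fst, juxt_snd_apply, not_le.2 hlt, if_false, false_and, or_false,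
      add_zero]
  · refine congrArg FreeMonoid.ofList (List.map_congr_left fun n _ => ?_)
    have h2 := eq_zero_of_bound_le hu (show N ≤ n + N by omega)
    have h3 := notMem_of_bound_le hu (show N ≤ n + N by omega)
    simp only [Function.comp_apply, partAt, mem_juxt_fst, juxt_snd_apply, h2, h3, false_or,
      Nat.le_add_left, true_and, Nat.add_sub_cancel, if_true, zero_add]

theorem shape_empty : shape (∅, 0) = 1 := by
  simp [shape]

theorem leadMon_one : leadMon 1 = (∅, 0) := by
  have : leadMon (FreeMonoid.ofList (List.ofFn (Fin.elim0 : Fin 0 → DPart))) = (∅, 0) := by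
    rw [leadMon_ofFn]
    rfl
  simpa using this

/-- Each part contributes a `θ` or a positive exponent, hence at least one to the degree; a bound on
the degree thus bounds the length of `α` and all its parts. -/
theorem leadMon_mem_testSet {α : DComp} {d : ℕ}
    (h : (leadMon α).1.card + (leadMon α).2.degree ≤ d) : leadMon α ∈ testSet d := by
  have hl : α.toList.length ≤ d := by
    have h1 := congrArg Finset.card
      (union_support_shape α.toList.get (Fin.valOrderEmb α.toList.length))
    rw [card_map, card_univ, Fintype.card_fin] at h1
    have h2 := card_union_le (leadMon α).1 (leadMon α).2.support
    have h3 := card_support_le (leadMon α).2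
    change ((leadMon α).1 ∪ (leadMon α).2.support).card = _ at h1
    omega
  have hlt : ∀ n ∈ (leadMon α).1 ∪ (leadMon α).2.support, n < d := by
    intro n hn
    change n ∈ thetaSet _ _ ∪ (expo _ _).support at hn
    rw [union_support_shape] at hn
    obtain ⟨k, -, rfl⟩ := mem_map.1 hn
    exact lt_of_lt_of_le k.2 hl
  rw [testSet, mem_product, mem_powerset, Finset.mem_finsupp_iff]
  refine ⟨fun n hn => mem_range.2 (hlt n (mem_union_left _ hn)),
    fun n hn => mem_range.2 (hlt n (mem_union_right _ hn)), fun n _ => mem_range.2 ?_⟩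
  have := Finsupp.le_degree n (leadMon α).2
  omega

end SSeries

open SSeries

/-! ### Expansion of quasisymmetric functions in the `M α`. -/

namespace sQSym

theorem lead_eq (α : DComp) : lead α = coeffOn sQSym (leadMon α) := rfl

theorem coeffOn_eq_lead (u : Mon) : coeffOn sQSym u = lead (shape u) :=
  LinearMap.ext fun f => coeff_eq_leadMon f.2.2 u

theorem coeffOn_M (u : Mon) (α : DComp) :
    coeffOn sQSym u (M α) = if shape u = α then 1 else 0 := coeff_monoSeries α u

theorem lead_M (α β : DComp) : lead α (M β) = if α = β then 1 else 0 := by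
  rw [lead_eq, coeffOn_M, shape_leadMon]

/-- Quasisymmetric functions are determined by their expansion in the `M_α`. -/
theorem eq_zero_of_lead (f : sQSym) (h : ∀ α, lead α f = 0) : f = 0 :=
  eq_zero_of_coeffOn f fun u => by rw [coeffOn_eq_lead, h]

/-- Bounded degree confines the relevant leading monomials to a finite set, and `α` is recovered
from its leading monomial. -/
theorem finite_lead_ne_zero (f : sQSym) : {α | lead α f ≠ 0}.Finite := by
  obtain ⟨⟨d, hd⟩, -⟩ := f.2
  refine Set.Finite.of_finite_image (f := leadMon)
    ((testSet d).finite_toSet.subset ?_) fun α _ β _ h => ?_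
  · rintro _ ⟨α, hα, rfl⟩
    exact leadMon_mem_testSet (hd _ _ hα)
  · rw [← shape_leadMon α, h, shape_leadMon]

theorem eq_sum_M (f : sQSym) :
    f = ∑ α ∈ (finite_lead_ne_zero f).toFinset, lead α f • M α := by
  refine eq_of_coeffOn fun u => ?_
  simp only [map_sum, map_smul, coeffOn_M, smul_eq_mul, mul_ite, mul_one, mul_zero, sum_ite_eq,
    Set.Finite.mem_toFinset, Set.mem_ofPred_eq]
  rw [coeffOn_eq_lead]
  split_ifs with h
  · rfl
  · exact not_not.1 h

theorem hom_ext {W : Type} [AddCommGroup W] [Module ℚ W] {f g : sQSym →ₗ[ℚ] W}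
    (h : ∀ α, f (M α) = g (M α)) : f = g := LinearMap.ext fun a => by
  rw [eq_sum_M a, map_sum, map_sum]
  exact sum_congr rfl fun α _ => by rw [map_smul, map_smul, h]

theorem lead_mul (α β : DComp) (f : sQSym) :
    lead (α * β) f = tensorEval (lead α) (lead β) (comul f) := by
  rw [lead_eq α, lead_eq β, lead_eq, tensorEval_coeffOn, comul, twoAlphabet_comul, split_apply]
  have h1 : shape (juxt (bound (leadMon α)) (leadMon α) (leadMon β)) = α * β := by
    rw [shape_juxt le_rfl, shape_leadMon, shape_leadMon]
  rw [coeff_eq_leadMon f.2.2, h1]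
  rfl

theorem lead_one (f : sQSym) : lead 1 f = counit f := by
  rw [lead_eq, leadMon_one]
  rfl

theorem lead_parity (α : DComp) (f : sQSym) :
    lead α (parity f) = (-1) ^ (α.toList.countP Sum.isRight) * lead α f := by
  have h1 : (leadMon α).1.card = α.toList.countP Sum.isRight := by
    rw [leadMon, thetaSet, card_map]
    conv_rhs => rw [← List.ofFn_get α.toList]
    rw [List.countP_eq_length_filter, List.ofFn_eq_map, List.filter_map, List.length_map]
    rw [← List.toFinset_card_of_nodup ((List.nodup_finRange _).filter _)]
    congr 1
    ext k
    simp
  rw [← h1]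
  rfl

end sQSym

/-- Needed for its dual: the coproduct of `sNSym` respects the grading. -/
theorem homogOn_mul {V : Subalgebra ℚ SSeries} (hH : ∀ k, ∀ f ∈ V, homog k f ∈ V) (k : ℕ)
    (f g : V) : homogOn hH k (f * g) =
      ∑ p ∈ antidiagonal k, homogOn hH p.1 f * homogOn hH p.2 g := by
  refine eq_of_coeffOn fun u => ?_
  rw [map_sum]
  simp only [coeffOn_apply, coe_homogOn, Subalgebra.coe_mul, coeff_homog, coeff_mul']
  rw [sum_comm]
  have key : ∀ x ∈ factorizations u, x.1.card + x.2.1.degree +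
      ((u.1 \ x.1).card + x.2.2.degree) = u.1.card + u.2.degree := fun x hx => by
    rw [mem_factorizations] at hx
    rw [← hx.2, map_add]
    have := card_sdiff_add_card_eq_card hx.1
    omega
  split_ifs with h
  · refine sum_congr rfl fun x hx => ?_
    rw [sum_eq_single (x.1.card + x.2.1.degree, (u.1 \ x.1).card + x.2.2.degree)]
    · simp
    · rintro ⟨i, j⟩ - hne
      by_cases h1 : x.1.card + x.2.1.degree = i
      · by_cases h2 : (u.1 \ x.1).card + x.2.2.degree = j
        · exact absurd (by rw [h1, h2]) hne
        · simp [h2]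
      · simp [h1]
    · intro h'
      exact absurd (HasAntidiagonal.mem_antidiagonal.2 ((key x hx).trans h)) h'
  · refine (sum_eq_zero fun x hx => sum_eq_zero ?_).symm
    rintro ⟨i, j⟩ hij
    rw [HasAntidiagonal.mem_antidiagonal] at hij
    by_cases h1 : x.1.card + x.2.1.degree = i
    · by_cases h2 : (u.1 \ x.1).card + x.2.2.degree = j
      · exact absurd ((key x hx).symm.trans (by rw [h1, h2]; exact hij)) h
      · simp [h2]
    · simp [h1]

/-! ### The pairing and the coalgebra structure of `sNSym`. -/

namespace sNSym

theorem hom_ext {W : Type} [AddCommGroup W] [Module ℚ W] {f g : sNSym →ₗ[ℚ] W}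
    (h : ∀ α, f (H α) = g (H α)) : f = g := by
  refine MonoidAlgebra.lhom_ext' fun α => LinearMap.ext_ring ?_
  exact h α

theorem pairing_H (α : DComp) (f : sQSym) : pairing (H α) f = sQSym.lead α f := by
  rw [pairing, lin_H]

theorem pairing_H_M (α β : DComp) : pairing (H α) (sQSym.M β) = if α = β then 1 else 0 := by
  rw [pairing_H, sQSym.lead_M]

theorem one_eq_H : (1 : sNSym) = H 1 := rfl

/-- The functional on `sNSym` given by pairing with `a`. -/
noncomputable abbrev pairWith (a : sQSym) : sNSym →ₗ[ℚ] ℚ := pairing.flip a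

theorem pairWith_M (α : DComp) : pairWith (sQSym.M α) = lin fun β => if β = α then 1 else 0 :=
  hom_ext fun β => by rw [lin_H]; exact pairing_H_M β α

theorem lin_self : (lin H : sNSym →ₗ[ℚ] sNSym) = LinearMap.id :=
  hom_ext fun α => by rw [lin_H]; rfl

theorem eq_sum_H (F : sNSym) : ∃ s : Finset DComp, ∃ c : DComp → ℚ, F = ∑ α ∈ s, c α • H α := by
  have h := LinearMap.congr_fun lin_self F
  exact ⟨_, _, h.symm⟩

theorem eq_zero_of_pairing (F : sNSym) (h : ∀ a, pairWith a F = 0) : F = 0 := by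
  obtain ⟨s, c, rfl⟩ := eq_sum_H F
  refine sum_eq_zero fun α hα => ?_
  have := h (sQSym.M α)
  rw [map_sum] at this
  simp only [map_smul, LinearMap.flip_apply, pairing_H_M, smul_eq_mul, mul_ite, mul_one,
    mul_zero, sum_ite_eq', hα, if_true] at this
  rw [this, zero_smul]

theorem pairing_nondegenerate : pairing.Nondegenerate :=
  ⟨eq_zero_of_pairing, fun a h => sQSym.eq_zero_of_lead a fun α => by rw [← pairing_H]; exact h _⟩

theorem tensorPairing_tmul_left (F G : sNSym) (t : sQSym ⊗[ℚ] sQSym) :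
    tensorPairing (F ⊗ₜ G) t = tensorEval (pairing F) (pairing G) t := rfl

theorem tensorPairing_tmul_right (S : sNSym ⊗[ℚ] sNSym) (a b : sQSym) :
    tensorPairing S (a ⊗ₜ b) = tensorEval (pairWith a) (pairWith b) S := by
  induction S with
  | zero => simp
  | add x y hx hy => simp only [map_add, LinearMap.add_apply, hx, hy]
  | tmul x y => rfl

theorem tensor_ext_of_pairing {S T : sNSym ⊗[ℚ] sNSym}
    (h : ∀ a b, tensorEval (pairWith a) (pairWith b) S = tensorEval (pairWith a) (pairWith b) T) :
    S = T :=
  tensor_ext eq_zero_of_pairing eq_zero_of_pairing h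

theorem pairing_mul (F G : sNSym) (a : sQSym) :
    pairing (F * G) a = tensorPairing (F ⊗ₜ G) (sQSym.comul a) := by
  have h : pairing ∘ₗ LinearMap.mul' ℚ sNSym = (LinearMap.lcomp ℚ ℚ sQSym.comul) ∘ₗ tensorPairing := by
    refine TensorProduct.ext (hom_ext fun α => hom_ext fun β => LinearMap.ext fun a => ?_)
    change pairing (H α * H β) a = tensorEval (pairing (H α)) (pairing (H β)) (sQSym.comul a)
    rw [H_mul_H, pairing_H, sQSym.lead_mul]
    congr 2 <;> exact LinearMap.ext fun f => (pairing_H _ f).symm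
  exact LinearMap.congr_fun (LinearMap.congr_fun h (F ⊗ₜ G)) a

/-- Without this the `finsum` in `comul` would take its default value zero. A nonzero coefficient
forces the two compositions to be the shapes of complementary factors of the leading monomial of
`γ`, which has finitely many factorizations. -/
theorem finite_support_comul (γ : DComp) : (Function.support fun q : DComp × DComp =>
    pairing (H γ) (sQSym.M q.1 * sQSym.M q.2) • (H q.1 ⊗ₜ[ℚ] H q.2)).Finite := by
  refine ((factorizations (leadMon γ)).image fun x =>
    (shape (x.1, x.2.1), shape ((leadMon γ).1 \ x.1, x.2.2))).finite_toSet.subset ?_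
  rintro ⟨α, β⟩ h
  rw [Function.mem_support] at h
  have h1 : sQSym.lead γ (sQSym.M α * sQSym.M β) ≠ 0 := by
    intro h'
    apply h
    rw [pairing_H, h', zero_smul]
  rw [sQSym.lead_eq, coeffOn_apply, Subalgebra.coe_mul, coeff_mul'] at h1
  obtain ⟨x, hx, h2⟩ := exists_ne_zero_of_sum_ne_zero h1
  rw [mem_coe, mem_image]
  refine ⟨x, hx, ?_⟩
  have h3 := left_ne_zero_of_mul (right_ne_zero_of_mul h2)
  have h4 := right_ne_zero_of_mul (right_ne_zero_of_mul h2)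
  have h5 := sQSym.coeffOn_M (x.1, x.2.1) α
  have h6 := sQSym.coeffOn_M ((leadMon γ).1 \ x.1, x.2.2) β
  rw [coeffOn_apply] at h5 h6
  refine Prod.ext ?_ ?_
  · by_contra h'
    rw [if_neg h'] at h5
    exact h3 h5
  · by_contra h'
    rw [if_neg h'] at h6
    exact h4 h6

/-- Against `M α` and `M β` the defining sum reduces to one term; the general case is bilinear,
because the `M α` span. The coalgebra axioms of `sNSym` are obtained by testing with this formula.
-/
theorem tensorEval_comul (F : sNSym) (a b : sQSym) :
    tensorEval (pairWith a) (pairWith b) (comul F) = pairing F (a * b) := by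
  have h1 : ∀ α β : DComp, tensorEval (pairWith (sQSym.M α)) (pairWith (sQSym.M β)) ∘ₗ comul =
      pairWith (sQSym.M α * sQSym.M β) := fun α β => hom_ext fun γ => by
    rw [LinearMap.comp_apply, comul, lin_H,
      finsum_eq_sum_of_support_subset _ (Set.Finite.coe_toFinset (finite_support_comul γ)).superset,
      map_sum]
    simp only [map_smul, tensorEval_tmul, LinearMap.flip_apply, pairing_H_M, ite_zero_mul_ite_zero,
      mul_one, smul_eq_mul]
    rw [sum_eq_single (α, β)]
    · simp
    · rintro ⟨α', β'⟩ - hne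
      rw [if_neg, mul_zero]
      rintro ⟨rfl, rfl⟩
      exact hne rfl
    -- Outside the support the whole term vanishes; pairing it with `M α ⊗ M β` shows that its
    -- scalar coefficient is zero as well.
    · intro h
      rw [Set.Finite.mem_toFinset, Function.mem_support, not_not] at h
      have h2 := congrArg (tensorEval (pairWith (sQSym.M α)) (pairWith (sQSym.M β))) h
      simpa [pairing_H_M] using h2
  have h2 : tensorPairing (comul F) = pairing F ∘ₗ LinearMap.mul' ℚ sQSym :=
    TensorProduct.ext (sQSym.hom_ext fun α => sQSym.hom_ext fun β =>
      (tensorPairing_tmul_right _ _ _).trans (LinearMap.congr_fun (h1 α β) F))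
  rw [← tensorPairing_tmul_right, h2]
  rfl

theorem pairing_comul (F : sNSym) (a b : sQSym) :
    pairing F (a * b) = tensorPairing (comul F) (a ⊗ₜ b) := by
  rw [tensorPairing_tmul_right, tensorEval_comul]

theorem pairing_one_left (a : sQSym) : pairing 1 a = sQSym.counit a := by
  rw [one_eq_H, pairing_H, sQSym.lead_one]

theorem M_one : sQSym.M 1 = 1 := by
  refine eq_of_coeffOn fun u => ?_
  rw [sQSym.coeffOn_M, coeffOn_apply, Subalgebra.coe_one, coeff_one]
  congr 1
  refine propext ⟨fun h => ?_, fun h => ?_⟩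
  · have h1 : ((u.1 ∪ u.2.support).sort (· ≤ ·)).map (partAt u) = [] := h
    rw [List.map_eq_nil_iff] at h1
    have h2 : u.1 ∪ u.2.support = ∅ := by
      rw [← sort_toFinset (u.1 ∪ u.2.support) (· ≤ ·), h1, List.toFinset_nil]
    rw [union_eq_empty, Finsupp.support_eq_empty] at h2
    exact h2
  · rw [show u = (∅, 0) from Prod.ext h.1 h.2, shape_empty]

theorem pairing_one_right (F : sNSym) : pairing F 1 = counit F := by
  rw [← M_one]
  exact LinearMap.congr_fun (pairWith_M 1) F

theorem pairing_parity (F : sNSym) (a : sQSym) :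
    pairing (parity F) a = pairing F (sQSym.parity a) := by
  have : pairWith a ∘ₗ parity = pairWith (sQSym.parity a) := hom_ext fun α => by
    rw [LinearMap.comp_apply, parity, lin_H, map_smul, LinearMap.flip_apply, LinearMap.flip_apply,
      pairing_H, pairing_H, sQSym.lead_parity, smul_eq_mul]
  exact LinearMap.congr_fun this F

theorem tensorEval_rTensor_comul (t : sNSym ⊗[ℚ] sNSym) (a b c : sQSym) :
    tensorEval (pairWith a) (tensorEval (pairWith b) (pairWith c))
      (TensorProduct.assoc ℚ _ _ _ (comul.rTensor sNSym t)) =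
      tensorEval (pairWith (a * b)) (pairWith c) t := by
  induction t with
  | zero => simp only [LinearMap.map_zero, LinearEquiv.map_zero]
  | add x y hx hy => simp only [LinearMap.map_add, LinearEquiv.map_add, hx, hy]
  | tmul F G =>
    have h2 : ∀ s : sNSym ⊗[ℚ] sNSym, tensorEval (pairWith a) (tensorEval (pairWith b) (pairWith c))
        (TensorProduct.assoc ℚ _ _ _ (s ⊗ₜ G)) =
        tensorEval (pairWith a) (pairWith b) s * pairWith c G := fun s => by
      induction s with
      | zero =>
        rw [TensorProduct.zero_tmul]
        simp only [LinearMap.map_zero, LinearEquiv.map_zero, zero_mul]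
      | add x y hx hy =>
        rw [TensorProduct.add_tmul]
        simp only [LinearMap.map_add, LinearEquiv.map_add, hx, hy, add_mul]
      | tmul x y =>
        rw [TensorProduct.assoc_tmul, tensorEval_tmul, tensorEval_tmul, tensorEval_tmul, mul_assoc]
    rw [LinearMap.rTensor_tmul, h2, tensorEval_comul, tensorEval_tmul]
    rfl

theorem tensorEval_lTensor_comul (t : sNSym ⊗[ℚ] sNSym) (a b c : sQSym) :
    tensorEval (pairWith a) (tensorEval (pairWith b) (pairWith c)) (comul.lTensor sNSym t) =
      tensorEval (pairWith a) (pairWith (b * c)) t := by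
  induction t with
  | zero => simp only [LinearMap.map_zero]
  | add x y hx hy => simp only [LinearMap.map_add, hx, hy]
  | tmul F G =>
    rw [LinearMap.lTensor_tmul, tensorEval_tmul, tensorEval_comul, tensorEval_tmul]
    rfl

/-- Dual to associativity in `sQSym`: tested against `a ⊗ b ⊗ c`, the two sides pair `F` with `(a *
b) * c` and `a * (b * c)`. -/
theorem comul_coassoc : TensorProduct.assoc ℚ sNSym sNSym sNSym ∘ₗ comul.rTensor sNSym ∘ₗ comul =
    comul.lTensor sNSym ∘ₗ comul := by
  refine LinearMap.ext fun F => tensor_ext (φ := pairWith)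
    (ψ := fun p : sQSym × sQSym => tensorEval (pairWith p.1) (pairWith p.2))
    eq_zero_of_pairing ?_ ?_
  · exact fun t ht => tensor_eq_zero eq_zero_of_pairing eq_zero_of_pairing fun i j => ht (i, j)
  · rintro a ⟨b, c⟩
    refine (tensorEval_rTensor_comul (comul F) a b c).trans ?_
    refine Eq.trans ?_ (tensorEval_lTensor_comul (comul F) a b c).symm
    rw [tensorEval_comul, tensorEval_comul, mul_assoc]

theorem counit_eq_pairWith : counit = pairWith 1 :=
  LinearMap.ext fun F => (pairing_one_right F).symm

theorem counit_rTensor_comul (F : sNSym) : counit.rTensor sNSym (comul F) = 1 ⊗ₜ F := by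
  have h : ∀ (t : sNSym ⊗[ℚ] sNSym) (a : sQSym),
      pairWith a (TensorProduct.lid ℚ sNSym (counit.rTensor sNSym t)) =
      tensorEval (pairWith 1) (pairWith a) t := fun t a => by
    induction t with
    | zero => simp only [map_zero]
    | add x y hx hy => simp only [map_add, hx, hy]
    | tmul x y =>
      rw [LinearMap.rTensor_tmul, TensorProduct.lid_tmul, map_smul, counit_eq_pairWith]
      rfl
  refine (TensorProduct.lid ℚ sNSym).injective (sub_eq_zero.1 (eq_zero_of_pairing _ fun a => ?_))
  rw [map_sub, h, tensorEval_comul, one_mul, TensorProduct.lid_tmul, one_smul]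
  exact sub_self _

theorem counit_lTensor_comul (F : sNSym) : counit.lTensor sNSym (comul F) = F ⊗ₜ 1 := by
  have h : ∀ (t : sNSym ⊗[ℚ] sNSym) (a : sQSym),
      pairWith a (TensorProduct.rid ℚ sNSym (counit.lTensor sNSym t)) =
      tensorEval (pairWith a) (pairWith 1) t := fun t a => by
    induction t with
    | zero => simp only [map_zero]
    | add x y hx hy => simp only [map_add, hx, hy]
    | tmul x y =>
      rw [LinearMap.lTensor_tmul, TensorProduct.rid_tmul, map_smul, counit_eq_pairWith,
        tensorEval_tmul, mul_comm]
      rfl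
  refine (TensorProduct.rid ℚ sNSym).injective (sub_eq_zero.1 (eq_zero_of_pairing _ fun a => ?_))
  rw [map_sub, h, tensorEval_comul, mul_one, TensorProduct.rid_tmul, one_smul]
  exact sub_self _

end sNSym
end SuperSym

namespace SuperSym

open Finset TensorProduct SSeries

/-! ### Compatibility of product and coproduct on `sNSym`, by duality, and its antipode. -/

namespace sNSym

/-- The pairing `⟨F₁, a₁⟩ ⟨F₂, b₁⟩ ⟨G₁, a₂⟩ ⟨G₂, b₂⟩` of `(F₁ ⊗ F₂) ⊗ (G₁ ⊗ G₂)` with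
`(a₁ ⊗ a₂) ⊗ (b₁ ⊗ b₂)`. -/
noncomputable def crossPairing (S T : sNSym ⊗[ℚ] sNSym) (s t : sQSym ⊗[ℚ] sQSym) : ℚ :=
  tensorEval (tensorPairing.flip s) (tensorPairing.flip t)
    (TensorProduct.tensorTensorTensorComm ℚ sNSym sNSym sNSym sNSym (S ⊗ₜ T))

theorem crossPairing_tmul (F₁ F₂ G₁ G₂ : sNSym) (s t : sQSym ⊗[ℚ] sQSym) :
    crossPairing (F₁ ⊗ₜ F₂) (G₁ ⊗ₜ G₂) s t =
      tensorPairing (F₁ ⊗ₜ G₁) s * tensorPairing (F₂ ⊗ₜ G₂) t := rfl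

theorem crossPairing_add_left (S S' T : sNSym ⊗[ℚ] sNSym) (s t : sQSym ⊗[ℚ] sQSym) :
    crossPairing (S + S') T s t = crossPairing S T s t + crossPairing S' T s t := by
  rw [crossPairing, TensorProduct.add_tmul, LinearEquiv.map_add, LinearMap.map_add]
  rfl

theorem crossPairing_add_right (S T T' : sNSym ⊗[ℚ] sNSym) (s t : sQSym ⊗[ℚ] sQSym) :
    crossPairing S (T + T') s t = crossPairing S T s t + crossPairing S T' s t := by
  rw [crossPairing, TensorProduct.tmul_add, LinearEquiv.map_add, LinearMap.map_add]
  rfl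

theorem crossPairing_zero_left (T : sNSym ⊗[ℚ] sNSym) (s t : sQSym ⊗[ℚ] sQSym) :
    crossPairing 0 T s t = 0 := by
  rw [crossPairing, TensorProduct.zero_tmul, LinearEquiv.map_zero, LinearMap.map_zero]

theorem crossPairing_zero_right (S : sNSym ⊗[ℚ] sNSym) (s t : sQSym ⊗[ℚ] sQSym) :
    crossPairing S 0 s t = 0 := by
  rw [crossPairing, TensorProduct.tmul_zero, LinearEquiv.map_zero, LinearMap.map_zero]

/-- Two functions on pairs of tensors agree if they are biadditive and agree on pure tensors. -/
theorem tensor_induction₂ {A B : Type} [AddCommGroup A] [Module ℚ A] [AddCommGroup B] [Module ℚ B]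
    {f g : A ⊗[ℚ] A → B ⊗[ℚ] B → ℚ}
    (f0 : ∀ t, f 0 t = 0) (g0 : ∀ t, g 0 t = 0) (f0' : ∀ s, f s 0 = 0) (g0' : ∀ s, g s 0 = 0)
    (fadd : ∀ s s' t, f (s + s') t = f s t + f s' t)
    (gadd : ∀ s s' t, g (s + s') t = g s t + g s' t)
    (fadd' : ∀ s t t', f s (t + t') = f s t + f s t')
    (gadd' : ∀ s t t', g s (t + t') = g s t + g s t')
    (h : ∀ a a' b b', f (a ⊗ₜ a') (b ⊗ₜ b') = g (a ⊗ₜ a') (b ⊗ₜ b')) (s : A ⊗[ℚ] A)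
    (t : B ⊗[ℚ] B) : f s t = g s t := by
  induction s with
  | zero => rw [f0, g0]
  | add s s' hs hs' => rw [fadd, gadd, hs, hs']
  | tmul a a' =>
    induction t with
    | zero => rw [f0', g0']
    | add t t' ht ht' => rw [fadd', gadd', ht, ht']
    | tmul b b' => exact h a a' b b'

/-- Duality in each slot turns the unsigned product of `S` and `T` into the coproducts of `a` and
`b`; `crossPairing` hides the exchange of the middle factors. `tensorPairing_mul` is the mirror
image, so both sides of the compatibility axiom become values of `crossPairing`. -/
theorem tensorEval_mul (S T : sNSym ⊗[ℚ] sNSym) (a b : sQSym) :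
    tensorEval (pairWith a) (pairWith b) (S * T) =
      crossPairing S T (sQSym.comul a) (sQSym.comul b) := by
  refine tensor_induction₂ (f := fun S T => tensorEval (pairWith a) (pairWith b) (S * T))
    (g := fun S T => crossPairing S T (sQSym.comul a) (sQSym.comul b))
    (fun t => by simp only [zero_mul, map_zero]) (fun t => crossPairing_zero_left _ _ _)
    (fun s => by simp only [mul_zero, map_zero]) (fun s => crossPairing_zero_right _ _ _)
    (fun s s' t => by simp only [add_mul, map_add]) (fun s s' t => crossPairing_add_left _ _ _ _ _)
    (fun s t t' => by simp only [mul_add, map_add]) (fun s t t' => crossPairing_add_right _ _ _ _ _)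
    (fun F₁ F₂ G₁ G₂ => ?_) S T
  rw [Algebra.TensorProduct.tmul_mul_tmul, crossPairing_tmul, tensorEval_tmul, ← pairing_mul,
    ← pairing_mul]
  rfl

theorem crossPairing_tmul_tmul (S T : sNSym ⊗[ℚ] sNSym) (a₁ a₂ b₁ b₂ : sQSym) :
    crossPairing S T (a₁ ⊗ₜ a₂) (b₁ ⊗ₜ b₂) =
      tensorPairing S (a₁ ⊗ₜ b₁) * tensorPairing T (a₂ ⊗ₜ b₂) := by
  refine tensor_induction₂ (f := fun S T => crossPairing S T (a₁ ⊗ₜ a₂) (b₁ ⊗ₜ b₂))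
    (g := fun S T => tensorPairing S (a₁ ⊗ₜ b₁) * tensorPairing T (a₂ ⊗ₜ b₂))
    (fun t => crossPairing_zero_left _ _ _)
    (fun t => by simp only [map_zero, LinearMap.zero_apply, zero_mul])
    (fun s => crossPairing_zero_right _ _ _)
    (fun s => by simp only [map_zero, LinearMap.zero_apply, mul_zero])
    (fun s s' t => crossPairing_add_left _ _ _ _ _)
    (fun s s' t => by simp only [map_add, LinearMap.add_apply, add_mul])
    (fun s t t' => crossPairing_add_right _ _ _ _ _)
    (fun s t t' => by simp only [map_add, LinearMap.add_apply, mul_add])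
    (fun F₁ F₂ G₁ G₂ => ?_) S T
  rw [crossPairing_tmul]
  simp only [tensorPairing_tmul]
  ring

theorem crossPairing_add_third (S T : sNSym ⊗[ℚ] sNSym) (s s' t : sQSym ⊗[ℚ] sQSym) :
    crossPairing S T (s + s') t = crossPairing S T s t + crossPairing S T s' t := by
  simp only [crossPairing, tensorEval, map_add, TensorProduct.add_tmul, LinearMap.add_apply]

theorem crossPairing_add_fourth (S T : sNSym ⊗[ℚ] sNSym) (s t t' : sQSym ⊗[ℚ] sQSym) :
    crossPairing S T s (t + t') = crossPairing S T s t + crossPairing S T s t' := by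
  simp only [crossPairing, tensorEval, map_add, TensorProduct.tmul_add, LinearMap.add_apply]

theorem crossPairing_zero_third (S T : sNSym ⊗[ℚ] sNSym) (t : sQSym ⊗[ℚ] sQSym) :
    crossPairing S T 0 t = 0 := by
  simp only [crossPairing, tensorEval, map_zero, TensorProduct.zero_tmul, LinearMap.zero_apply]

theorem crossPairing_zero_fourth (S T : sNSym ⊗[ℚ] sNSym) (s : sQSym ⊗[ℚ] sQSym) :
    crossPairing S T s 0 = 0 := by
  simp only [crossPairing, tensorEval, map_zero, TensorProduct.tmul_zero, LinearMap.zero_apply]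

theorem tensorPairing_mul (F G : sNSym) (s t : sQSym ⊗[ℚ] sQSym) :
    tensorPairing (F ⊗ₜ G) (s * t) = crossPairing (comul F) (comul G) s t := by
  refine tensor_induction₂ (f := fun s t => tensorPairing (F ⊗ₜ G) (s * t))
    (g := fun s t => crossPairing (comul F) (comul G) s t)
    (fun t => by simp only [zero_mul, map_zero])
    (fun t => crossPairing_zero_third _ _ _)
    (fun s => by simp only [mul_zero, map_zero])
    (fun s => crossPairing_zero_fourth _ _ _)
    (fun s s' t => by simp only [add_mul, map_add])
    (fun s s' t => crossPairing_add_third _ _ _ _ _)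
    (fun s t t' => by simp only [mul_add, map_add])
    (fun s t t' => crossPairing_add_fourth _ _ _ _ _)
    (fun a₁ a₂ b₁ b₂ => ?_) s t
  rw [Algebra.TensorProduct.tmul_mul_tmul, crossPairing_tmul_tmul, tensorPairing_tmul,
    pairing_comul, pairing_comul]

theorem tensorPairing_lTensor_parity (F G : sNSym) (s : sQSym ⊗[ℚ] sQSym) :
    tensorPairing (F ⊗ₜ G) (sQSym.parity.lTensor sQSym s) =
      tensorPairing (F ⊗ₜ parity G) s := by
  induction s with
  | zero => simp only [map_zero]
  | add x y hx hy => simp only [map_add, hx, hy]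
  | tmul a b =>
    rw [LinearMap.lTensor_tmul, tensorPairing_tmul, tensorPairing_tmul, pairing_parity]

theorem tensorPairing_rTensor_parity (F G : sNSym) (s : sQSym ⊗[ℚ] sQSym) :
    tensorPairing (F ⊗ₜ G) (sQSym.parity.rTensor sQSym s) =
      tensorPairing (parity F ⊗ₜ G) s := by
  induction s with
  | zero => simp only [map_zero]
  | add x y hx hy => simp only [map_add, hx, hy]
  | tmul a b =>
    rw [LinearMap.rTensor_tmul, tensorPairing_tmul, tensorPairing_tmul, pairing_parity]

/-- The second factor of `S` is paired with the first factor of `t`, so the parity map may be moved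
from one to the other. -/
theorem crossPairing_parity_left (S T : sNSym ⊗[ℚ] sNSym) (s t : sQSym ⊗[ℚ] sQSym) :
    crossPairing (parity.lTensor sNSym S) T s t =
      crossPairing S T s (sQSym.parity.rTensor sQSym t) := by
  refine tensor_induction₂ (f := fun S T => crossPairing (parity.lTensor sNSym S) T s t)
    (g := fun S T => crossPairing S T s (sQSym.parity.rTensor sQSym t))
    (fun t => by simp only [map_zero, crossPairing_zero_left])
    (fun t => crossPairing_zero_left _ _ _)
    (fun s => crossPairing_zero_right _ _ _)
    (fun s => crossPairing_zero_right _ _ _)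
    (fun s s' t => by simp only [map_add, crossPairing_add_left])
    (fun s s' t => crossPairing_add_left _ _ _ _ _)
    (fun s t t' => crossPairing_add_right _ _ _ _ _)
    (fun s t t' => crossPairing_add_right _ _ _ _ _)
    (fun F₁ F₂ G₁ G₂ => ?_) S T
  rw [LinearMap.lTensor_tmul, crossPairing_tmul, crossPairing_tmul, tensorPairing_rTensor_parity]

theorem crossPairing_parity_right (S T : sNSym ⊗[ℚ] sNSym) (s t : sQSym ⊗[ℚ] sQSym) :
    crossPairing S (parity.rTensor sNSym T) s t =
      crossPairing S T (sQSym.parity.lTensor sQSym s) t := by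
  refine tensor_induction₂ (f := fun S T => crossPairing S (parity.rTensor sNSym T) s t)
    (g := fun S T => crossPairing S T (sQSym.parity.lTensor sQSym s) t)
    (fun t => crossPairing_zero_left _ _ _)
    (fun t => crossPairing_zero_left _ _ _)
    (fun s => by simp only [map_zero, crossPairing_zero_right])
    (fun s => crossPairing_zero_right _ _ _)
    (fun s s' t => crossPairing_add_left _ _ _ _ _)
    (fun s s' t => crossPairing_add_left _ _ _ _ _)
    (fun s t t' => by simp only [map_add, crossPairing_add_right])
    (fun s t t' => crossPairing_add_right _ _ _ _ _)
    (fun F₁ F₂ G₁ G₂ => ?_) S T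
  rw [LinearMap.rTensor_tmul, crossPairing_tmul, crossPairing_tmul, tensorPairing_lTensor_parity]

/-- Pairing with `a ⊗ b` reduces this to the same axiom for `sQSym`. Of the four terms of
`superMul`, the two with a single parity map trade places, and the other two correspond to
themselves. -/
theorem comul_mul (F G : sNSym) : comul (F * G) = superMul parity (comul F) (comul G) := by
  refine tensor_ext_of_pairing fun a b => ?_
  rw [tensorEval_comul, pairing_mul]
  rw [show sQSym.comul (a * b) = superMul sQSym.parity (sQSym.comul a) (sQSym.comul b) from
    SSeries.comul_mul splitClosed_sQSym (fun _ => rfl) a b]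
  rw [superMul, superMul]
  simp only [map_smul, map_add, map_sub, tensorPairing_mul, tensorEval_mul,
    crossPairing_parity_left, crossPairing_parity_right]
  ring

/-- The component of degree `k`. -/
noncomputable def homogPart (k : ℕ) : sNSym →ₗ[ℚ] sNSym :=
  lin fun α => if (leadMon α).1.card + (leadMon α).2.degree = k then H α else 0

/-- The degree projections are adjoint, so the grading needed for the antipode of `sNSym` is
inherited from `sQSym`. -/
theorem pairing_homogPart (k : ℕ) (F : sNSym) (a : sQSym) :
    pairing (homogPart k F) a = pairing F (homogOn homog_mem_sQSym k a) := by
  have : pairWith a ∘ₗ homogPart k = pairWith (homogOn homog_mem_sQSym k a) := hom_ext fun α => by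
    rw [LinearMap.comp_apply, homogPart, lin_H, LinearMap.flip_apply, LinearMap.flip_apply,
      pairing_H, sQSym.lead_eq, coeffOn_apply, coe_homogOn, coeff_homog]
    split_ifs
    · rw [pairing_H]; rfl
    · rw [map_zero]; rfl
  exact LinearMap.congr_fun this F

theorem tensorEval_map_homogPart (i j : ℕ) (t : sNSym ⊗[ℚ] sNSym) (a b : sQSym) :
    tensorEval (pairWith a) (pairWith b) (TensorProduct.map (homogPart i) (homogPart j) t) =
      tensorEval (pairWith (homogOn homog_mem_sQSym i a)) (pairWith (homogOn homog_mem_sQSym j b))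
        t := by
  induction t with
  | zero => simp only [map_zero]
  | add x y hx hy => simp only [map_add, hx, hy]
  | tmul F G =>
    rw [TensorProduct.map_tmul, tensorEval_tmul, tensorEval_tmul]
    simp only [LinearMap.flip_apply, pairing_homogPart]

theorem eq_sum_homogPart (F : sNSym) : ∃ N, F = ∑ k ∈ range N, homogPart k F := by
  obtain ⟨s, c, rfl⟩ := eq_sum_H F
  refine ⟨s.sup (fun α => (leadMon α).1.card + (leadMon α).2.degree) + 1, ?_⟩
  simp only [map_sum, map_smul, homogPart, lin_H]
  rw [sum_comm]
  refine sum_congr rfl fun α hα => ?_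
  rw [← smul_sum, sum_ite_eq, if_pos]
  exact mem_range.2 (Nat.lt_succ_of_le
    (le_sup (f := fun α => (leadMon α).1.card + (leadMon α).2.degree) hα))

/-- Noncommutative symmetric functions in superspace are a Hopf algebra. -/
theorem exists_isSuperHopf : ∃ S, IsSuperHopf parity comul counit S := by
  have h0 : ∀ F, homogPart 0 F = algebraMap ℚ sNSym (counit (homogPart 0 F)) := by
    have : homogPart 0 = Algebra.linearMap ℚ sNSym ∘ₗ counit ∘ₗ homogPart 0 := hom_ext fun α => by
      rw [LinearMap.comp_apply, LinearMap.comp_apply, homogPart, lin_H]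
      split_ifs with h
      · have h1 : α = 1 := by
          rw [← shape_leadMon α, show leadMon α = (∅, 0) from
            Prod.ext (card_eq_zero.1 (by omega)) ((Finsupp.degree_eq_zero_iff _).1 (by omega)),
            shape_empty]
        rw [h1, counit, lin_H, if_pos rfl, Algebra.linearMap_apply, map_one, one_eq_H]
      · rw [map_zero, map_zero]
    exact LinearMap.congr_fun this
  obtain ⟨S, h1, h2⟩ := exists_antipode comul_coassoc counit_rTensor_comul counit_lTensor_comul
    homogPart (fun k F => tensor_ext_of_pairing fun a b => by
      simp only [map_sum, tensorEval_map_homogPart, tensorEval_comul]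
      rw [pairing_homogPart, homogOn_mul, map_sum]) h0 eq_sum_homogPart
  refine ⟨S, {
    coassoc := comul_coassoc
    counit_left := counit_rTensor_comul
    counit_right := counit_lTensor_comul
    comul_one := tensor_ext_of_pairing fun a b => ?_
    comul_mul := comul_mul
    counit_one := by rw [one_eq_H, counit, lin_H, if_pos rfl]
    counit_mul := fun F G => ?_
    antipode_left := h1
    antipode_right := h2 }⟩
  -- `Δ 1 = 1 ⊗ 1` is dual to the multiplicativity of the counit of `sQSym`; the next axiom is dual
  -- to `Δ 1 = 1 ⊗ 1` there.
  · rw [tensorEval_comul, pairing_one_left, tensorEval_tmul]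
    simp only [LinearMap.flip_apply, pairing_one_left]
    obtain ⟨S, hS⟩ := SSeries.exists_isSuperHopf (P := sQSym.parity) splitClosed_sQSym homog_mem_sQSym
      fun _ => rfl
    exact hS.counit_mul a b
  · rw [← pairing_one_right, pairing_mul, ← pairing_one_right, ← pairing_one_right]
    rw [show sQSym.comul 1 = 1 ⊗ₜ 1 from SSeries.comul_one splitClosed_sQSym, tensorPairing_tmul]

theorem isHopfDual {SN : sNSym →ₗ[ℚ] sNSym} {SQ : sQSym →ₗ[ℚ] sQSym}
    (hN : IsSuperHopf parity comul counit SN)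
    (hQ : IsSuperHopf sQSym.parity sQSym.comul sQSym.counit SQ) : IsHopfDual SN SQ where
  mul := pairing_mul
  comul := pairing_comul
  one := pairing_one_left
  counit := pairing_one_right
  antipode := hN.antipode_adjoint hQ pairing pairing_mul pairing_comul pairing_one_left
    pairing_one_right
  nondegenerate := pairing_nondegenerate

end sNSym

/-! ### Leading terms of products of power sums. -/

namespace SSeries

/-- The exponents of the `x_n` with `θ_n` in the monomial `u`. -/
def antiType (u : Mon) : Multiset ℕ := u.1.val.map u.2

/-- The nonzero exponents of the `x_n` without `θ_n` in the monomial `u`. -/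
def symType (u : Mon) : Multiset ℕ := (u.2.support \ u.1).val.map u.2

/-- The number of indices that occur in the monomial `u`. -/
def numVars (u : Mon) : ℕ := Multiset.card (antiType u) + Multiset.card (symType u)

theorem map_val_congr {S : Finset ℕ} {e e' : ℕ → ℕ} (h : ∀ n ∈ S, e n = e' n) :
    S.val.map e = S.val.map e' := Multiset.map_congr rfl h

theorem map_val_erase {S : Finset ℕ} {i : ℕ} (hi : i ∈ S) (e : ℕ → ℕ) :
    S.val.map e = e i ::ₘ (S.erase i).val.map e := by
  rw [← Multiset.map_cons e i, erase_val, Multiset.cons_erase hi]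

variable {A : Finset ℕ} {e e' : ℕ →₀ ℕ} {i : ℕ}

/-- This and the following lemmas track the two multisets of exponents when one index is altered, as
happens when a term of a power sum is divided off. -/
theorem antiType_of_mem (hi : i ∈ A) (h : ∀ n ≠ i, e' n = e n) :
    antiType (A, e) = e i ::ₘ antiType (A.erase i, e') := by
  rw [antiType, map_val_erase hi]
  exact congrArg _ (map_val_congr fun n hn => (h n (ne_of_mem_erase hn)).symm)

theorem antiType_of_notMem (hi : i ∉ A) (h : ∀ n ≠ i, e' n = e n) :
    antiType (A, e') = antiType (A, e) :=
  map_val_congr fun n hn => h n fun h => hi (h ▸ hn)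

theorem symType_erase_of_eq_zero (hi : i ∈ A) (h : ∀ n ≠ i, e' n = e n) (h0 : e' i = 0) :
    symType (A.erase i, e') = symType (A, e) := by
  have h1 : e'.support \ A.erase i = e.support \ A := by
    ext n
    simp only [mem_sdiff, Finsupp.mem_support_iff, mem_erase]
    by_cases hn : n = i
    · subst hn; simp [h0, hi]
    · simp [h n hn, hn]
  rw [symType, symType, h1]
  refine map_val_congr fun n hn => h n ?_
  rintro rfl
  exact (mem_sdiff.1 hn).2 hi

theorem symType_erase_of_ne_zero (hi : i ∈ A) (h : ∀ n ≠ i, e' n = e n) (h0 : e' i ≠ 0) :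
    symType (A.erase i, e') = e' i ::ₘ symType (A, e) := by
  have h1 : i ∈ e'.support \ A.erase i := by simp [h0]
  have h2 : (e'.support \ A.erase i).erase i = e.support \ A := by
    ext n
    simp only [mem_sdiff, Finsupp.mem_support_iff, mem_erase]
    by_cases hn : n = i
    · subst hn; simp [hi]
    · simp [h n hn, hn]
  rw [symType, map_val_erase h1, h2]
  refine congrArg _ (map_val_congr fun n hn => h n ?_)
  rintro rfl
  exact (mem_sdiff.1 hn).2 hi

theorem symType_of_eq_zero (hi : i ∉ A) (h : ∀ n ≠ i, e' n = e n) (h0 : e i ≠ 0) (h0' : e' i = 0) :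
    symType (A, e) = e i ::ₘ symType (A, e') := by
  have h1 : i ∈ e.support \ A := by simp [h0, hi]
  have h2 : (e.support \ A).erase i = e'.support \ A := by
    ext n
    simp only [mem_sdiff, Finsupp.mem_support_iff, mem_erase]
    by_cases hn : n = i
    · subst hn; simp [h0']
    · simp [h n hn, hn]
  rw [symType, map_val_erase h1, h2]
  refine congrArg _ (map_val_congr fun n hn => (h n ?_).symm)
  rintro rfl
  exact Finsupp.mem_support_iff.1 (mem_sdiff.1 hn).1 h0'

theorem card_symType_of_ne_zero (h : ∀ n ≠ i, e' n = e n) (h0 : e i ≠ 0) (h0' : e' i ≠ 0) :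
    Multiset.card (symType (A, e')) = Multiset.card (symType (A, e)) := by
  have h1 : e.support = e'.support := by
    ext n
    simp only [Finsupp.mem_support_iff]
    by_cases hn : n = i
    · subst hn; simp [h0, h0']
    · simp [h n hn]
  simp only [symType, Multiset.card_map, h1]

theorem sub_single_of_ne {e : ℕ →₀ ℕ} {i r n : ℕ} (h : n ≠ i) :
    (e - Finsupp.single i r) n = e n := by
  rw [Finsupp.tsub_apply, Finsupp.single_eq_of_ne h, Nat.sub_zero]

theorem sub_single_self {e : ℕ →₀ ℕ} {i r : ℕ} : (e - Finsupp.single i r) i = e i - r := by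
  rw [Finsupp.tsub_apply, Finsupp.single_eq_same]

/-- The coefficients of `p_r f`. -/
theorem coeff_psumSeries_mul {r : ℕ} (hr : 0 < r) (f : SSeries) (u : Mon) :
    coeff u.1 u.2 (psumSeries r * f) = ∑ i ∈ u.2.support.filter fun i => r ≤ u.2 i,
      coeff u.1 (u.2 - Finsupp.single i r) f := by
  rw [coeff_mul']
  symm
  refine sum_of_injOn (fun i => (∅, Finsupp.single i r, u.2 - Finsupp.single i r)) ?_ ?_ ?_ ?_
  · intro i _ j _ h
    have h1 := congrArg (fun x : Finset ℕ × (ℕ →₀ ℕ) × (ℕ →₀ ℕ) => x.2.1) h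
    exact Finsupp.single_left_injective hr.ne' h1
  · intro i hi
    rw [mem_coe, mem_factorizations]
    exact ⟨empty_subset _, add_tsub_cancel_of_le
      (Finsupp.single_le_iff.2 (mem_filter.1 hi).2)⟩
  · rintro ⟨B, p, q⟩ hx hni
    rw [mem_factorizations] at hx
    simp only at hx ⊢
    rw [psumSeries, coeff_of, if_neg, zero_mul, mul_zero]
    rintro ⟨rfl, i, rfl⟩
    have hi : r ≤ u.2 i := by rw [← hx.2]; simp
    refine hni ⟨i, ?_, ?_⟩
    · rw [mem_coe, mem_filter, Finsupp.mem_support_iff]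
      exact ⟨by omega, hi⟩
    · simp only [← hx.2, add_tsub_cancel_left]
  · intro i _
    rw [psumSeries, coeff_of, if_pos ⟨rfl, i, rfl⟩]
    simp [crossSign]

/-- The coefficients of `p̃_k f`. -/
theorem coeff_psumTildeSeries_mul (k : ℕ) (f : SSeries) (u : Mon) :
    coeff u.1 u.2 (psumTildeSeries k * f) = ∑ i ∈ u.1.filter fun i => k ≤ u.2 i,
      crossSign {i} (u.1.erase i) * coeff (u.1.erase i) (u.2 - Finsupp.single i k) f := by
  rw [coeff_mul']
  symm
  refine sum_of_injOn (fun i => ({i}, Finsupp.single i k, u.2 - Finsupp.single i k)) ?_ ?_ ?_ ?_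
  · intro i _ j _ h
    exact singleton_injective (congrArg Prod.fst h)
  · intro i hi
    rw [mem_coe, mem_factorizations]
    exact ⟨singleton_subset_iff.2 (mem_filter.1 hi).1, add_tsub_cancel_of_le
      (Finsupp.single_le_iff.2 (mem_filter.1 hi).2)⟩
  · rintro ⟨B, p, q⟩ hx hni
    rw [mem_factorizations] at hx
    simp only at hx ⊢
    rw [psumTildeSeries, coeff_of, if_neg, zero_mul, mul_zero]
    rintro ⟨i, rfl, rfl⟩
    have hi : k ≤ u.2 i := by rw [← hx.2]; simp
    refine hni ⟨i, ?_, ?_⟩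
    · rw [mem_coe, mem_filter]
      exact ⟨singleton_subset_iff.1 hx.1, hi⟩
    · simp only [← hx.2, add_tsub_cancel_left]
  · intro i _
    rw [psumTildeSeries, coeff_of, if_pos ⟨i, rfl, rfl⟩, sdiff_singleton_eq_erase, one_mul]

theorem crossSign_ne_zero (B C : Finset ℕ) : crossSign B C ≠ 0 :=
  prod_ne_zero_iff.2 fun _ _ => prod_ne_zero_iff.2 fun _ _ => by split_ifs <;> norm_num

/-- The coefficients in `p_λ` of the monomials with at least `ℓ(λ)` variables. -/
theorem coeff_prod_psumSeries (ss : List ℕ) (hpos : ∀ r ∈ ss, 0 < r) :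
    ∃ c : ℚ, 0 < c ∧ ∀ u : Mon, ss.length ≤ numVars u →
      coeff u.1 u.2 (ss.map psumSeries).prod =
        if antiType u = 0 ∧ symType u = ss then c else 0 := by
  induction ss with
  | nil =>
    refine ⟨1, one_pos, fun u _ => ?_⟩
    rw [List.map_nil, List.prod_nil, coeff_one]
    congr 1
    refine propext ⟨fun h => ?_, fun h => ?_⟩
    · rw [show u = (∅, 0) from Prod.ext h.1 h.2]
      simp [antiType, symType]
    · have h1 : u.1 = ∅ := by simpa [antiType] using h.1
      have h2 := h.2
      rw [Multiset.coe_nil, symType, h1, sdiff_empty, Multiset.map_eq_zero, val_eq_zero,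
        Finsupp.support_eq_empty] at h2
      exact ⟨h1, h2⟩
  | cons r ss ih =>
    obtain ⟨c, hc, h⟩ := ih fun s hs => hpos s (List.mem_cons_of_mem _ hs)
    have hr : 0 < r := hpos r List.mem_cons_self
    -- A monomial with exponents `r :: ss` contains a term of `p_r` once for each variable of
    -- exponent exactly `r`.
    refine ⟨(r :: ss).count r * c, mul_pos (Nat.cast_pos.2 (List.count_pos_iff.2 List.mem_cons_self)) hc, ?_⟩
    rintro ⟨A, e⟩ hu
    rw [List.map_cons, List.prod_cons, coeff_psumSeries_mul hr]
    simp only [List.length_cons, numVars] at hu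
    simp only at hu ⊢
    by_cases hA : A = ∅
    · subst hA
      have hanti : ∀ e : ℕ →₀ ℕ, antiType (∅, e) = 0 := fun _ => rfl
      have hterm : ∀ i ∈ e.support.filter fun i => r ≤ e i,
          coeff ∅ (e - Finsupp.single i r) (ss.map psumSeries).prod =
          if e i = r ∧ symType (∅, e) = ((r :: ss : List ℕ) : Multiset ℕ) then c else 0 := by
        intro i hi
        rw [mem_filter, Finsupp.mem_support_iff] at hi
        -- If `r < e i`, the variable survives the division, and the quotient has too many variables
        -- to occur with the type `ss`. Only `r = e i`, where the variable disappears, can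
        -- contribute.
        rcases hi.2.lt_or_eq with hlt | heq
        · have h1 := card_symType_of_ne_zero (A := ∅) (e := e) (e' := e - Finsupp.single i r) (i := i)
            (fun n hn => sub_single_of_ne hn) hi.1 (by rw [sub_single_self]; omega)
          have h2 := h (∅, e - Finsupp.single i r) (by
            rw [numVars, h1]; rw [hanti] at hu ⊢; omega)
          simp only at h2
          rw [h2, if_neg, if_neg]
          · rintro ⟨h3, -⟩; omega
          · rintro ⟨-, h3⟩
            rw [h3] at h1
            rw [hanti, Multiset.card_zero, ← h1, Multiset.coe_card] at hu
            omega
        · have h1 := symType_of_eq_zero (A := ∅) (e := e) (e' := e - Finsupp.single i r) (i := i)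
            (notMem_empty i) (fun n hn => sub_single_of_ne hn) hi.1
            (by rw [sub_single_self]; omega)
          have h2 := h (∅, e - Finsupp.single i r) (by
            rw [h1, Multiset.card_cons] at hu
            rw [numVars]; rw [hanti] at hu ⊢; omega)
          simp only at h2
          rw [h2]
          congr 1
          rw [h1, ← heq, ← Multiset.cons_coe r ss, Multiset.cons_inj_right]
          simp [hanti]
      rw [sum_congr rfl hterm]
      simp only [hanti, true_and]
      by_cases hs : symType (∅, e) = ((r :: ss : List ℕ) : Multiset ℕ)
      · simp only [hs, and_true, if_true]
        rw [← sum_filter, sum_const, nsmul_eq_mul]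
        congr 2
        rw [← Multiset.coe_count, ← hs, symType, sdiff_empty, Multiset.count_map, filter_filter,
          card_def, filter_val]
        congr 1
        refine Multiset.filter_congr fun n _ => ?_
        constructor
        · rintro ⟨-, h⟩; exact h.symm
        · rintro rfl; exact ⟨le_rfl, rfl⟩
      · simp only [hs, and_false, if_false, sum_const_zero]
    · have hanti : ∀ e : ℕ →₀ ℕ, antiType (A, e) ≠ 0 := fun e h0 => by
        rw [antiType, Multiset.map_eq_zero, val_eq_zero] at h0
        exact hA h0
      rw [if_neg fun h => hanti _ h.1]
      refine sum_eq_zero fun i hi => ?_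
      rw [mem_filter, Finsupp.mem_support_iff] at hi
      -- Division by `x_i^r` loses at most one variable, so the induction hypothesis applies; it
      -- gives zero because the `θ`'s remain.
      have hn : ss.length ≤ numVars (A, e - Finsupp.single i r) := by
        rw [numVars]
        have h1 : Multiset.card (antiType (A, e - Finsupp.single i r)) =
          Multiset.card (antiType (A, e)) := by simp [antiType]
        rw [h1]
        by_cases hiA : i ∈ A
        · have : e.support \ A ⊆ (e - Finsupp.single i r).support \ A := by
            intro n hn
            rw [mem_sdiff, Finsupp.mem_support_iff] at hn ⊢
            rw [sub_single_of_ne fun h => hn.2 (by rwa [h])]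
            exact hn
          have := card_le_card this
          simp only [symType, Multiset.card_map] at hu ⊢
          simp only [card_def] at this
          omega
        · by_cases h0 : e i - r = 0
          · rw [symType_of_eq_zero hiA (fun n hn => sub_single_of_ne hn) hi.1
              (by rw [sub_single_self]; exact h0), Multiset.card_cons] at hu
            omega
          · rw [card_symType_of_ne_zero (fun n hn => sub_single_of_ne hn) hi.1
              (by rw [sub_single_self]; exact h0)]
            omega
      have h2 := h _ hn
      simp only at h2
      rw [h2, if_neg fun h => hanti _ h.1]

/-- The coefficients in `p_Λ` of the monomials with at least `ℓ(Λ)` variables. -/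
theorem coeff_prod_psumTildeSeries_ne_zero (ss : List ℕ) (hpos : ∀ r ∈ ss, 0 < r) (as : List ℕ)
    (hnd : as.Nodup) (u : Mon) (hu : as.length + ss.length ≤ numVars u) :
      coeff u.1 u.2 ((as.map psumTildeSeries).prod * (ss.map psumSeries).prod) ≠ 0 ↔
        antiType u = as ∧ symType u = ss := by
  induction as generalizing u with
  | nil =>
    obtain ⟨c, hc, h⟩ := coeff_prod_psumSeries ss hpos
    rw [List.length_nil, zero_add] at hu
    rw [List.map_nil, List.prod_nil, one_mul, h u hu, Multiset.coe_nil]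
    simp [hc.ne']
  | cons k as ih =>
    rw [List.nodup_cons] at hnd
    obtain ⟨A, e⟩ := u
    rw [List.map_cons, List.prod_cons, mul_assoc, coeff_psumTildeSeries_mul]
    simp only [List.length_cons] at hu ⊢
    have hterm : ∀ i ∈ A.filter fun i => k ≤ e i,
        coeff (A.erase i) (e - Finsupp.single i k)
          ((as.map psumTildeSeries).prod * (ss.map psumSeries).prod) ≠ 0 ↔
        e i = k ∧ antiType (A, e) = ((k :: as : List ℕ) : Multiset ℕ) ∧ symType (A, e) = ss := by
      intro i hi
      rw [mem_filter] at hi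
      have ha := antiType_of_mem (e := e) (e' := e - Finsupp.single i k) hi.1
        fun n hn => sub_single_of_ne hn
      -- If `k < e i`, the index `i` merely loses its `θ`. The number of variables is unchanged and
      -- exceeds what the induction hypothesis allows for a nonzero coefficient.
      rcases hi.2.lt_or_eq with hlt | heq
      · have hs := symType_erase_of_ne_zero (e := e) (e' := e - Finsupp.single i k) hi.1
          (fun n hn => sub_single_of_ne hn) (by rw [sub_single_self]; omega)
        have h1 : as.length + 1 + ss.length ≤ numVars (A.erase i, e - Finsupp.single i k) := by
          simp only [numVars, ha, hs, Multiset.card_cons] at hu ⊢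
          omega
        refine iff_of_false (fun h2 => ?_) fun h2 => by omega
        have h3 := (ih hnd.2 (A.erase i, e - Finsupp.single i k) (by omega)).1 h2
        rw [numVars, h3.1, h3.2, Multiset.coe_card, Multiset.coe_card] at h1
        omega
      · have hs := symType_erase_of_eq_zero (e := e) (e' := e - Finsupp.single i k) hi.1
          (fun n hn => sub_single_of_ne hn) (by rw [sub_single_self]; omega)
        have h1 : as.length + ss.length ≤ numVars (A.erase i, e - Finsupp.single i k) := by
          simp only [numVars, ha, hs, Multiset.card_cons] at hu ⊢
          omega
        rw [ih hnd.2 (A.erase i, e - Finsupp.single i k) h1, hs, ha, ← heq, ← Multiset.cons_coe,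
          Multiset.cons_inj_right]
        simp
    constructor
    · intro h
      obtain ⟨i, hi, h⟩ := exists_ne_zero_of_sum_ne_zero h
      exact ((hterm i hi).1 (right_ne_zero_of_mul h)).2
    · rintro ⟨h1, h2⟩
      have hk : k ∈ antiType (A, e) := by rw [h1]; exact List.mem_cons_self
      obtain ⟨i, hi, hik⟩ := Multiset.mem_map.1 hk
      have hnd' : (A.val.map e).Nodup := by
        change (antiType (A, e)).Nodup
        rw [h1, Multiset.coe_nodup, List.nodup_cons]
        exact hnd
      simp only at hi hik
      have hi' : i ∈ A.filter fun i => k ≤ e i := mem_filter.2 ⟨hi, hik.ge⟩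
      -- The exponents on `A` are distinct, so only one index has exponent `k`: a single term
      -- survives and no signs can cancel.
      rw [sum_eq_single i]
      · exact mul_ne_zero (crossSign_ne_zero _ _) ((hterm i hi').2 ⟨hik, h1, h2⟩)
      · intro j hj hne
        by_contra h
        have := ((hterm j hj).1 (right_ne_zero_of_mul h)).1
        exact hne (Multiset.inj_on_of_nodup_map hnd' j (mem_filter.1 hj).1 i hi
          (this.trans hik.symm))
      · exact fun h => absurd hi' h

end SSeries

/-! ### Types of monomials and permutations of the variables. -/

namespace SSeries

theorem antiType_mapMon (φ : ℕ ↪ ℕ) (u : Mon) : antiType (mapMon φ u) = antiType u := by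
  rw [antiType, mapMon, map_val, Multiset.map_map]
  exact Multiset.map_congr rfl fun n _ => Finsupp.embDomain_apply_self φ u.2 n

theorem symType_mapMon (φ : ℕ ↪ ℕ) (u : Mon) : symType (mapMon φ u) = symType u := by
  have h : (u.2.embDomain φ).support \ u.1.map φ = (u.2.support \ u.1).map φ := by
    rw [Finsupp.support_embDomain]
    simp only [map_eq_image, image_sdiff _ _ φ.injective]
  rw [symType, mapMon, h, map_val, Multiset.map_map]
  exact Multiset.map_congr rfl fun n _ => Finsupp.embDomain_apply_self φ u.2 n

theorem exists_mapMon_leadMon (u : Mon) : ∃ φ : ℕ ↪ ℕ, mapMon φ (leadMon (shape u)) = u := by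
  obtain ⟨l, a, i, -, h1, h2⟩ := exists_eq_expo u.1 u.2
  have h : u = (thetaSet a i, expo a i) := Prod.ext h1.symm h2.symm
  obtain ⟨φ, hφ⟩ := exists_extend i
  refine ⟨φ.toEmbedding, ?_⟩
  rw [h, shape_eq, leadMon_ofFn, mapMon, thetaSet_map, expo_map, hφ]

theorem pos_of_mem_symType {u : Mon} {n : ℕ} (h : n ∈ symType u) : 0 < n := by
  obtain ⟨i, hi, rfl⟩ := Multiset.mem_map.1 h
  exact Nat.pos_of_ne_zero (Finsupp.mem_support_iff.1 (mem_sdiff.1 (Finset.mem_def.2 hi)).1)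

/-- Equal multisets of values come from a bijection between the index sets. -/
theorem exists_bijOn_of_map_eq (S T : Finset ℕ) (e e' : ℕ → ℕ)
    (h : S.val.map e = T.val.map e') :
    ∃ φ : ℕ → ℕ, Set.BijOn φ S T ∧ ∀ n ∈ S, e' (φ n) = e n := by
  induction S using Finset.induction_on generalizing T with
  | empty =>
    have : T = ∅ := by
      rw [empty_val, Multiset.map_zero, eq_comm, Multiset.map_eq_zero, val_eq_zero] at h
      exact h
    subst this
    exact ⟨id, by simp, by simp⟩
  | insert a S ha ih =>
    rw [insert_val_of_notMem ha, Multiset.map_cons, eq_comm, ← Multiset.map_eq_cons] at h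
    obtain ⟨b, hb, hba, h⟩ := h
    rw [← erase_val, eq_comm] at h
    obtain ⟨φ, hφ, hφe⟩ := ih (T.erase b) h
    have hne : ∀ n ∈ S, n ≠ a := fun n hn h => ha (h ▸ hn)
    refine ⟨Function.update φ a b, ⟨fun n hn => ?_, fun m hm n hn hmn => ?_, fun n hn => ?_⟩,
      fun n hn => ?_⟩
    · rcases mem_insert.1 (mem_coe.1 hn) with rfl | hn
      · rw [Function.update_self]; exact hb
      · rw [Function.update_of_ne (hne n hn)]
        exact mem_of_mem_erase (mem_coe.1 (hφ.mapsTo hn))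
    · have key : ∀ n ∈ S, φ n ≠ b := fun n hn => ne_of_mem_erase (mem_coe.1 (hφ.mapsTo hn))
      rcases mem_insert.1 (mem_coe.1 hm) with hma | hm <;>
        rcases mem_insert.1 (mem_coe.1 hn) with hna | hn
      · rw [hma, hna]
      · rw [hma, Function.update_self, Function.update_of_ne (hne n hn)] at hmn
        exact absurd hmn.symm (key n hn)
      · rw [hna, Function.update_self, Function.update_of_ne (hne m hm)] at hmn
        exact absurd hmn (key m hm)
      · rw [Function.update_of_ne (hne n hn), Function.update_of_ne (hne m hm)] at hmn
        exact hφ.injOn hm hn hmn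
    · by_cases hnb : n = b
      · exact ⟨a, by simp, by rw [Function.update_self, hnb]⟩
      · obtain ⟨m, hm, rfl⟩ := hφ.surjOn (mem_coe.2 (mem_erase.2 ⟨hnb, hn⟩))
        exact ⟨m, mem_coe.2 (mem_insert_of_mem hm), Function.update_of_ne (hne m hm) _ _⟩
    · rcases mem_insert.1 hn with rfl | hn
      · rw [Function.update_self, hba]
      · rw [Function.update_of_ne (hne n hn), hφe n hn]

/-- Monomials with the same types differ by a permutation of the variables. -/
theorem exists_perm_mapMon {u v : Mon} (ha : antiType u = antiType v)
    (hs : symType u = symType v) : ∃ σ : Equiv.Perm ℕ, mapMon σ.toEmbedding u = v := by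
  obtain ⟨φ, hφ, hφe⟩ := exists_bijOn_of_map_eq _ _ _ _ ha
  obtain ⟨χ, hχ, hχe⟩ := exists_bijOn_of_map_eq _ _ _ _ hs
  let ψ : (u.1 ∪ u.2.support : Finset ℕ) → ℕ := fun n => if (n : ℕ) ∈ u.1 then φ n else χ n
  have hS : ∀ n : (u.1 ∪ u.2.support : Finset ℕ), (n : ℕ) ∉ u.1 → (n : ℕ) ∈ u.2.support \ u.1 :=
    fun n hn => mem_sdiff.2 ⟨(mem_union.1 n.2).resolve_left hn, hn⟩
  have hψ : Function.Injective ψ := by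
    intro m n hmn
    simp only [ψ] at hmn
    refine Subtype.ext ?_
    split_ifs at hmn with h1 h2 h2
    · exact hφ.injOn h1 h2 hmn
    · exact absurd (hmn ▸ hφ.mapsTo h1) (mem_sdiff.1 (mem_coe.1 (hχ.mapsTo (hS n h2)))).2
    · exact absurd (hmn ▸ hφ.mapsTo h2) (mem_sdiff.1 (mem_coe.1 (hχ.mapsTo (hS m h1)))).2
    · exact hχ.injOn (hS m h1) (hS n h2) hmn
  obtain ⟨σ, hσ⟩ := Equiv.Perm.exists_extending_pair
    (fun n : (u.1 ∪ u.2.support : Finset ℕ) => (n : ℕ)) ψ Subtype.val_injective hψ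
  have h1 : ∀ n ∈ u.1, σ n = φ n := fun n hn =>
    (hσ ⟨n, mem_union_left _ hn⟩).trans (if_pos hn)
  have h2 : ∀ n ∈ u.2.support \ u.1, σ n = χ n := fun n hn =>
    (hσ ⟨n, mem_union_right _ (mem_sdiff.1 hn).1⟩).trans (if_neg (mem_sdiff.1 hn).2)
  have hA : u.1.map σ.toEmbedding = v.1 := by
    ext n
    rw [mem_map]
    constructor
    · rintro ⟨m, hm, rfl⟩
      rw [Equiv.coe_toEmbedding, h1 m hm]
      exact hφ.mapsTo hm
    · intro hn
      obtain ⟨m, hm, rfl⟩ := hφ.surjOn hn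
      exact ⟨m, hm, h1 m hm⟩
  refine ⟨σ, Prod.ext hA ?_⟩
  have he : ∀ m, (u.2.embDomain σ.toEmbedding) (σ m) = u.2 m := fun m =>
    Finsupp.embDomain_apply_self σ.toEmbedding u.2 m
  ext n
  obtain ⟨m, rfl⟩ := σ.surjective n
  change (u.2.embDomain σ.toEmbedding) (σ m) = _
  rw [he]
  by_cases hm : m ∈ u.1
  · rw [h1 m hm, hφe m hm]
  · by_cases hm' : m ∈ u.2.support
    · have := mem_sdiff.2 ⟨hm', hm⟩
      rw [h2 m this, hχe m this]
    · rw [Finsupp.notMem_support_iff.1 hm', eq_comm]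
      by_contra h
      have hv : σ m ∈ v.2.support \ v.1 := by
        refine mem_sdiff.2 ⟨Finsupp.mem_support_iff.2 h, ?_⟩
        rw [← hA, mem_map]
        rintro ⟨m', h3, h4⟩
        exact hm (σ.injective h4 ▸ h3)
      obtain ⟨m', h3, h4⟩ := hχ.surjOn hv
      rw [← h2 m' h3] at h4
      exact hm' (σ.injective h4 ▸ (mem_sdiff.1 (mem_coe.1 h3)).1)

/-- A permutation carries `u` to `v`, and invariance under it equates the coefficients up to sign.
-/
theorem coeff_ne_zero_iff {f : SSeries} (hf : IsSymm f) {u v : Mon} (ha : antiType u = antiType v)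
    (hs : symType u = symType v) : coeff u.1 u.2 f ≠ 0 ↔ coeff v.1 v.2 f ≠ 0 := by
  obtain ⟨σ, rfl⟩ := exists_perm_mapMon ha hs
  have h := congrArg (coeff u.1 u.2) (hf σ)
  rw [coeff_relabel'] at h
  rw [← h]
  have h0 : relabelSign σ.toEmbedding u.1 ≠ 0 :=
    left_ne_zero_of_mul (relabelSign_sq σ.toEmbedding u.1 ▸ one_ne_zero)
  simp [h0]

/-- Interchanging two variables with equal exponents changes the sign of a monomial that contains both
`θ`'s. -/
theorem nodup_antiType {f : SSeries} (hf : IsSymm f) {u : Mon} (hu : coeff u.1 u.2 f ≠ 0) :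
    (antiType u).Nodup := by
  refine Multiset.Nodup.map_on (fun i hi j hj hij => ?_) u.1.nodup
  rw [mem_val] at hi hj
  by_contra hne
  -- With `i` and `j` sent to `0` and `1` and all other indices behind them, a preceding exchange of
  -- `i` and `j` reverses the order of that one pair and of no other.
  let φ : ℕ ↪ ℕ := ⟨fun n => if n = i then 0 else if n = j then 1 else n + 2, fun m n h => by
    simp only at h
    split_ifs at h <;> omega⟩
  have hφi : φ i = 0 := if_pos rfl
  have hφj : φ j = 1 := (if_neg (Ne.symm hne)).trans (if_pos rfl)
  have hφ : ∀ n, n ≠ i → n ≠ j → φ n = n + 2 := fun n h1 h2 => (if_neg h1).trans (if_neg h2)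
  let τ : Equiv.Perm ℕ := Equiv.swap i j
  have hτu : mapMon τ.toEmbedding u = u := by
    refine Prod.ext ?_ ?_
    · refine eq_of_subset_of_card_le (fun n hn => ?_) (card_map _).ge
      obtain ⟨m, hm, rfl⟩ := mem_map.1 hn
      change Equiv.swap i j m ∈ u.1
      rw [Equiv.swap_apply_def]
      split_ifs <;> assumption
    · ext n
      obtain ⟨m, rfl⟩ := τ.surjective n
      refine (Finsupp.embDomain_apply_self τ.toEmbedding u.2 m).trans ?_
      change u.2 m = u.2 (Equiv.swap i j m)
      rw [Equiv.swap_apply_def]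
      split_ifs with h1 h2
      · rw [h1, hij]
      · rw [h2, hij]
      · rfl
  have hmap : mapMon (τ.toEmbedding.trans φ) u = mapMon φ u := by
    conv_rhs => rw [← hτu]
    rw [mapMon, mapMon, mapMon, Finset.map_map, Finsupp.embDomain_trans_apply]
  have h1 := congrArg (coeff u.1 u.2) (hf.relabel_eq φ)
  have h2 := congrArg (coeff u.1 u.2) (hf.relabel_eq (τ.toEmbedding.trans φ))
  rw [coeff_relabel'] at h1 h2
  rw [hmap] at h2
  have h3 : relabelSign (τ.toEmbedding.trans φ) u.1 * relabelSign φ u.1 = -1 := by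
    have hpair : (min i j, max i j) ∈ pairs u.1 := by
      rw [mem_pairs]
      rcases lt_or_gt_of_ne hne with h | h
      · rw [min_eq_left h.le, max_eq_right h.le]; exact ⟨hi, hj, h⟩
      · rw [min_eq_right h.le, max_eq_left h.le]; exact ⟨hj, hi, h⟩
    rw [relabelSign, relabelSign, ← prod_mul_distrib, prod_eq_single (min i j, max i j)]
    · rcases lt_or_gt_of_ne hne with h | h
      · simp [min_eq_left h.le, max_eq_right h.le, τ, hφi, hφj]
      · simp [min_eq_right h.le, max_eq_left h.le, τ, hφi, hφj]
    · rintro ⟨m, n⟩ hmn hne'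
      rw [mem_pairs] at hmn
      have hcase : ((τ.toEmbedding.trans φ) m < (τ.toEmbedding.trans φ) n ↔ φ m < φ n) := by
        change φ (Equiv.swap i j m) < φ (Equiv.swap i j n) ↔ φ m < φ n
        by_cases hmi : m = i <;> by_cases hmj : m = j <;> by_cases hni : n = i <;>
          by_cases hnj : n = j
        all_goals first
          | omega
          | skip
        · exfalso; apply hne'; subst hmi; subst hnj
          rw [min_eq_left hmn.2.2.le, max_eq_right hmn.2.2.le]
        · subst hmi
          rw [Equiv.swap_apply_left, Equiv.swap_apply_of_ne_of_ne hni hnj, hφi, hφj, hφ n hni hnj]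
          omega
        · exfalso; apply hne'; subst hmj; subst hni
          rw [min_eq_right hmn.2.2.le, max_eq_left hmn.2.2.le]
        · subst hmj
          rw [Equiv.swap_apply_right, Equiv.swap_apply_of_ne_of_ne hni hnj, hφi, hφj, hφ n hni hnj]
          omega
        · subst hni
          rw [Equiv.swap_apply_left, Equiv.swap_apply_of_ne_of_ne hmi hmj, hφi, hφj, hφ m hmi hmj]
          omega
        · subst hnj
          rw [Equiv.swap_apply_right, Equiv.swap_apply_of_ne_of_ne hmi hmj, hφi, hφj, hφ m hmi hmj]
          omega
        · rw [Equiv.swap_apply_of_ne_of_ne hmi hmj, Equiv.swap_apply_of_ne_of_ne hni hnj]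
      simp only [hcase]
      split_ifs <;> norm_num
    · exact fun h => absurd hpair h
  apply hu
  have h4 := relabelSign_sq φ u.1
  -- The two relabelings express the coefficient at `u` as the same number with opposite signs.
  linear_combination (-1 / 2 : ℚ) * h1 + (-1 / 2 : ℚ) * h2 +
    1 / 2 * coeff (mapMon φ u).1 (mapMon φ u).2 f *
      (relabelSign φ u.1 * h3 - relabelSign (τ.toEmbedding.trans φ) u.1 * h4)

theorem exists_symType_eq (ss : Multiset ℕ) (hpos : ∀ n ∈ ss, 0 < n) :
    ∃ u : Mon, antiType u = 0 ∧ symType u = ss := by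
  induction ss using Multiset.induction_on with
  | empty => exact ⟨(∅, 0), rfl, by simp [symType]⟩
  | cons r ss ih =>
    obtain ⟨⟨A, e⟩, h1, h2⟩ := ih fun n hn => hpos n (Multiset.mem_cons_of_mem hn)
    have hr := hpos r (Multiset.mem_cons_self r ss)
    have hi : bound (A, e) ∉ A := notMem_of_bound_le le_rfl le_rfl
    have h0 : e (bound (A, e)) = 0 := eq_zero_of_bound_le (u := (A, e)) le_rfl le_rfl
    have hv : (e + Finsupp.single (bound (A, e)) r) (bound (A, e)) = r := by simp [h0]
    have hne : ∀ n ≠ bound (A, e), e n = (e + Finsupp.single (bound (A, e)) r) n := fun n hn => by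
      simp [hn]
    refine ⟨(A, e + Finsupp.single (bound (A, e)) r), ?_, ?_⟩
    · rw [← h1]
      exact antiType_of_notMem hi fun n hn => (hne n hn).symm
    · rw [symType_of_eq_zero hi hne (by rw [hv]; exact hr.ne') h0, hv, h2]

theorem exists_antiType_eq (as ss : Multiset ℕ) (hpos : ∀ n ∈ ss, 0 < n) :
    ∃ u : Mon, antiType u = as ∧ symType u = ss := by
  induction as using Multiset.induction_on with
  | empty => exact exists_symType_eq ss hpos
  | cons k as ih =>
    obtain ⟨⟨A, e⟩, h1, h2⟩ := ih
    have hi : bound (A, e) ∉ A := notMem_of_bound_le le_rfl le_rfl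
    have h0 : e (bound (A, e)) = 0 := eq_zero_of_bound_le (u := (A, e)) le_rfl le_rfl
    have hv : (e + Finsupp.single (bound (A, e)) k) (bound (A, e)) = k := by simp [h0]
    have hne : ∀ n ≠ bound (A, e), e n = (e + Finsupp.single (bound (A, e)) k) n := fun n hn => by
      simp [hn]
    refine ⟨(insert (bound (A, e)) A, e + Finsupp.single (bound (A, e)) k), ?_, ?_⟩
    · rw [antiType_of_mem (mem_insert_self _ _) hne, erase_insert hi, hv, h1]
    · rw [← h2]
      conv_rhs => rw [← erase_insert hi]
      exact (symType_erase_of_eq_zero (mem_insert_self _ _) hne h0).symm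

end SSeries

theorem SPar.ext' {Λ Ω : SPar} (h1 : Λ.anti.val = Ω.anti.val) (h2 : Λ.sym = Ω.sym) : Λ = Ω := by
  obtain ⟨a, s, h⟩ := Λ
  obtain ⟨a', s', h'⟩ := Ω
  obtain rfl : a = a' := Finset.val_injective h1
  obtain rfl : s = s' := h2
  rfl

/-! ### The products `p Λ` form a basis. -/

namespace sSym

/-- The number of parts of a superpartition. -/
def numParts (Λ : SPar) : ℕ := Λ.anti.card + Multiset.card Λ.sym

/-- A monomial with the exponents prescribed by a superpartition. -/
theorem exists_mon (Λ : SPar) : ∃ u : Mon, antiType u = Λ.anti.val ∧ symType u = Λ.sym :=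
  exists_antiType_eq _ _ Λ.pos

theorem coe_p (Λ : SPar) : (p Λ : SSeries) =
    ((Λ.anti.sort (· ≥ ·)).map psumTildeSeries).prod *
      ((Λ.sym.sort (· ≥ ·)).map psumSeries).prod := by
  have h (l : List sSym) : (l.prod : SSeries) = (l.map fun f : sSym => (f : SSeries)).prod :=
    map_list_prod sSym.val l
  rw [p, Subalgebra.coe_mul, h, h, List.map_map, List.map_map]
  rfl

/-- The leading terms of `p_Λ` are the monomials with exponents `Λ`. -/
theorem coeffOn_p_ne_zero (Λ : SPar) {u : Mon} (hu : numParts Λ ≤ numVars u) :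
    coeffOn sSym u (p Λ) ≠ 0 ↔ antiType u = Λ.anti.val ∧ symType u = Λ.sym := by
  rw [coeffOn_apply, coe_p]
  have h := coeff_prod_psumTildeSeries_ne_zero (Λ.sym.sort (· ≥ ·))
    (fun r hr => Λ.pos r ((Multiset.mem_sort _).1 hr)) (Λ.anti.sort (· ≥ ·))
    (Finset.sort_nodup _ _) u (by rwa [Finset.length_sort, Multiset.length_sort])
  rwa [Finset.sort_eq, Multiset.sort_eq] at h

theorem numVars_eq {Λ : SPar} {u : Mon} (h : antiType u = Λ.anti.val ∧ symType u = Λ.sym) :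
    numVars u = numParts Λ := by
  rw [numVars, h.1, h.2]
  rfl

/-- In a linear relation, choose `Λ` with the most parts among those with nonzero coefficient. A
monomial with exponents `Λ` occurs in `p Λ`, but in no other `p Ω` of the relation, as these have at
most as many parts. -/
theorem linearIndependent_p : LinearIndependent ℚ p := by
  rw [linearIndependent_iff']
  intro s c hc
  by_contra! hne
  obtain ⟨Λ, hΛ, hmax⟩ := exists_max_image (s.filter fun Λ => c Λ ≠ 0) numParts (by
    obtain ⟨Λ, h1, h2⟩ := hne
    exact ⟨Λ, mem_filter.2 ⟨h1, h2⟩⟩)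
  rw [mem_filter] at hΛ
  obtain ⟨u, hu⟩ := exists_mon Λ
  have h := congrArg (coeffOn sSym u) hc
  rw [map_sum, map_zero, sum_eq_single Λ, map_smul, smul_eq_mul] at h
  · exact mul_ne_zero hΛ.2 ((coeffOn_p_ne_zero Λ (numVars_eq hu).ge).2 hu) h
  · intro Ω hΩ hne
    rw [map_smul]
    by_cases h0 : c Ω = 0
    · rw [h0, zero_smul]
    · have h1 := hmax Ω (mem_filter.2 ⟨hΩ, h0⟩)
      have h2 : coeffOn sSym u (p Ω) = 0 := by
        by_contra h3
        have h4 := (coeffOn_p_ne_zero Ω (h1.trans (numVars_eq hu).ge)).1 h3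
        exact hne (SPar.ext' (h4.1.symm.trans hu.1) (h4.2.symm.trans hu.2))
      rw [h2, smul_zero]
  · exact fun h' => absurd hΛ.1 h'

/-- The superpartition of exponents of a monomial. -/
def typeOf (u : Mon) : SPar := ⟨(antiType u).toFinset, symType u, fun _ h => pos_of_mem_symType h⟩

/-- Elimination from the top: subtracting suitable multiples of the `p Λ` with the maximal number of
parts removes all monomials with the maximal number of variables. -/
theorem mem_span_p (n : ℕ) (f : sSym) (hf : ∀ u, coeffOn sSym u f ≠ 0 → numVars u < n) :
    f ∈ Submodule.span ℚ (Set.range p) := by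
  induction n generalizing f with
  | zero =>
    have : f = 0 := eq_zero_of_coeffOn f fun u => by
      by_contra h
      exact absurd (hf u h) (Nat.not_lt_zero _)
    rw [this]
    exact Submodule.zero_mem _
  | succ n ih =>
    choose w hw using exists_mon
    classical
    -- Finiteness comes from the expansion of `f` in the `M α`. The scalar `c Λ` below is chosen to
    -- cancel the coefficient at one representative monomial `w Λ`.
    let T : Finset SPar := ((sQSym.finite_lead_ne_zero (incl f)).toFinset.image
      fun α => typeOf (leadMon α)).filter fun Λ => numParts Λ = n
    let c : SPar → ℚ := fun Λ => coeffOn sSym (w Λ) f / coeffOn sSym (w Λ) (p Λ)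
    have hp0 : ∀ Λ, coeffOn sSym (w Λ) (p Λ) ≠ 0 := fun Λ =>
      (coeffOn_p_ne_zero Λ (numVars_eq (hw Λ)).ge).2 (hw Λ)
    have hmem : ∀ u : Mon, numVars u = n → (antiType u).Nodup → coeffOn sSym u f ≠ 0 →
        typeOf u ∈ T := by
      intro u hn hnd hu
      obtain ⟨φ, hφ⟩ := exists_mapMon_leadMon u
      have h1 : antiType (leadMon (shape u)) = antiType u := by
        rw [← antiType_mapMon φ, hφ]
      have h2 : symType (leadMon (shape u)) = symType u := by
        rw [← symType_mapMon φ, hφ]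
      have h3 : typeOf (leadMon (shape u)) = typeOf u :=
        SPar.ext' (congrArg (fun s : Multiset ℕ => s.toFinset.val) h1) h2
      rw [mem_filter, mem_image]
      refine ⟨⟨shape u, ?_, h3⟩, ?_⟩
      · rw [Set.Finite.mem_toFinset, Set.mem_ofPred_eq, ← sQSym.coeffOn_eq_lead]
        exact hu
      · rw [← hn]
        refine (numVars_eq (u := u) ⟨?_, rfl⟩).symm
        exact (Multiset.toFinset_val _).trans hnd.dedup |>.symm
    let g : sSym := f - ∑ Λ ∈ T, c Λ • p Λ
    have hg : ∀ u, coeffOn sSym u g = coeffOn sSym u f - ∑ Λ ∈ T, c Λ * coeffOn sSym u (p Λ) :=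
      fun u => by simp only [g, map_sub, map_sum, map_smul, smul_eq_mul]
    have hg' : ∀ u, coeffOn sSym u g ≠ 0 → numVars u < n := by
      intro u hu
      by_contra hlt
      rw [not_lt] at hlt
      rcases hlt.lt_or_eq with hlt | heq
      · apply hu
        have h1 : coeffOn sSym u f = 0 := by
          by_contra h
          have := hf u h
          omega
        rw [hg, h1, sum_eq_zero, sub_zero]
        intro Λ hΛ
        have hn := (mem_filter.1 hΛ).2
        have h2 : coeffOn sSym u (p Λ) = 0 := by
          by_contra h
          have h3 := (coeffOn_p_ne_zero Λ (by omega)).1 h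
          rw [← numVars_eq h3] at hn
          omega
        rw [h2, mul_zero]
      -- Antisymmetry makes the exponents at `θ`'s distinct, so the type of `u` is a genuine
      -- superpartition, and symmetry moves the question from `u` to the representative of that
      -- type.
      · have hnd := nodup_antiType g.2.2 hu
        have hty : antiType u = (typeOf u).anti.val :=
          ((Multiset.toFinset_val _).trans hnd.dedup).symm
        have hwu := hw (typeOf u)
        have h1 : coeffOn sSym (w (typeOf u)) g ≠ 0 :=
          (coeff_ne_zero_iff g.2.2 (hty.trans hwu.1.symm) hwu.2.symm).1 hu
        have hnw : numVars (w (typeOf u)) = n := by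
          rw [numVars, hwu.1, hwu.2, ← hty]
          exact heq.symm
        rw [hg, sum_eq_single (typeOf u)] at h1
        · exact h1 (by rw [div_mul_cancel₀ _ (hp0 _), sub_self])
        · intro Λ hΛ hne
          have h2 : coeffOn sSym (w (typeOf u)) (p Λ) = 0 := by
            by_contra h
            have h3 := (coeffOn_p_ne_zero Λ (by rw [(mem_filter.1 hΛ).2, hnw])).1 h
            exact hne (SPar.ext' (h3.1.symm.trans hwu.1) (h3.2.symm.trans hwu.2))
          rw [h2, mul_zero]
        · intro hT
          have h2 : coeffOn sSym (w (typeOf u)) f = 0 := by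
            by_contra h
            apply hT
            have h3 : typeOf (w (typeOf u)) = typeOf u := SPar.ext' (by
              change (antiType (w (typeOf u))).toFinset.val = _
              rw [hwu.1, Multiset.toFinset_val, (typeOf u).anti.nodup.dedup]) hwu.2
            rw [← h3]
            exact hmem _ hnw (by rw [hwu.1]; exact (typeOf u).anti.nodup) h
          simp only [c, h2, zero_div, zero_mul]
    have := Submodule.add_mem _ (ih g hg') (Submodule.sum_mem _ fun Λ (_ : Λ ∈ T) =>
      Submodule.smul_mem _ (c Λ) (Submodule.subset_span (Set.mem_range_self Λ)))
    rwa [sub_add_cancel] at this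

theorem span_p : Submodule.span ℚ (Set.range p) = ⊤ := by
  refine eq_top_iff.2 fun f _ => ?_
  obtain ⟨⟨d, hd⟩, -⟩ := f.2
  refine mem_span_p (d + 1) f fun u hu => ?_
  have h1 := hd _ _ hu
  have h2 := card_le_card (sdiff_subset (s := u.2.support) (t := u.1))
  have h3 := card_support_le u.2
  simp only [numVars, antiType, symType, Multiset.card_map, ← card_def]
  omega

/-- The basis `p_Λ`. -/
noncomputable def pBasis : Module.Basis SPar ℚ sSym :=
  Module.Basis.mk linearIndependent_p span_p.ge

theorem pBasis_apply (Λ : SPar) : pBasis Λ = p Λ := Module.Basis.mk_apply _ _ Λ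

end sSym

/-! ### Supercommutativity and multiplication in the basis `p Λ`. -/

namespace SSeries

theorem crossSign_comm {B C : Finset ℕ} (h : Disjoint B C) :
    crossSign B C = (-1) ^ (B.card * C.card) * crossSign C B := by
  have h1 : crossSign C B = ∏ b ∈ B, ∏ c ∈ C, if b < c then (-1 : ℚ) else 1 := prod_comm
  have h2 : (-1 : ℚ) ^ (B.card * C.card) = ∏ _b ∈ B, ∏ _c ∈ C, (-1 : ℚ) := by
    rw [prod_const, prod_const, ← pow_mul, mul_comm]
  rw [h1, h2, ← prod_mul_distrib, crossSign]
  refine prod_congr rfl fun b hb => ?_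
  rw [← prod_mul_distrib]
  refine prod_congr rfl fun c hc => ?_
  have hne : b ≠ c := fun h' => disjoint_left.1 h hb (h' ▸ hc)
  rcases lt_or_gt_of_ne hne with h3 | h3 <;> simp [h3, h3.not_gt]

/-- Supercommutativity. -/
theorem mul_eq_smul_mul {f g : SSeries} {n : ℕ}
    (h : ∀ A e B e', coeff A e f ≠ 0 → coeff B e' g ≠ 0 → A.card * B.card = n) :
    f * g = (-1 : ℚ) ^ n • (g * f) := by
  refine ext fun A e => ?_
  rw [map_smul, coeff_mul' f g (A, e), coeff_mul' g f (A, e), smul_eq_mul, mul_sum]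
  refine sum_nbij' (fun x => (A \ x.1, x.2.2, x.2.1)) (fun x => (A \ x.1, x.2.2, x.2.1))
    ?_ ?_ ?_ ?_ ?_
  · intro x hx
    rw [mem_factorizations] at hx ⊢
    exact ⟨sdiff_subset, by rw [← hx.2]; exact add_comm _ _⟩
  · intro x hx
    rw [mem_factorizations] at hx ⊢
    exact ⟨sdiff_subset, by rw [← hx.2]; exact add_comm _ _⟩
  · rintro ⟨B, p, q⟩ hx
    rw [mem_factorizations] at hx
    simp only [Finset.sdiff_sdiff_eq_self hx.1]
  · rintro ⟨B, p, q⟩ hx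
    rw [mem_factorizations] at hx
    simp only [Finset.sdiff_sdiff_eq_self hx.1]
  · rintro ⟨B, p, q⟩ hx
    rw [mem_factorizations] at hx
    simp only at hx
    simp only [Finset.sdiff_sdiff_eq_self hx.1]
    by_cases h1 : coeff B p f = 0
    · rw [h1]; ring
    · by_cases h2 : coeff (A \ B) q g = 0
      · rw [h2]; ring
      · rw [crossSign_comm disjoint_sdiff, h B p (A \ B) q h1 h2]
        ring

theorem card_eq_zero_of_psumSeries {r : ℕ} {A : Finset ℕ} {e : ℕ →₀ ℕ}
    (h : coeff A e (psumSeries r) ≠ 0) : A.card = 0 := by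
  rw [psumSeries, coeff_of] at h
  split_ifs at h with h'
  · rw [h'.1, card_empty]
  · exact absurd rfl h

theorem card_eq_one_of_psumTildeSeries {k : ℕ} {A : Finset ℕ} {e : ℕ →₀ ℕ}
    (h : coeff A e (psumTildeSeries k) ≠ 0) : A.card = 1 := by
  rw [psumTildeSeries, coeff_of] at h
  split_ifs at h with h'
  · obtain ⟨i, rfl, -⟩ := h'
    exact card_singleton i
  · exact absurd rfl h

theorem parity_mul (f g : SSeries) : parity (f * g) = parity f * parity g := by
  refine ext fun A e => ?_
  rw [coeff_parity, coeff_mul' f g (A, e), coeff_mul' _ _ (A, e), mul_sum]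
  refine sum_congr rfl fun x hx => ?_
  rw [mem_factorizations] at hx
  rw [coeff_parity, coeff_parity, ← card_sdiff_add_card_eq_card hx.1, pow_add]
  ring

end SSeries

namespace SPar

/-- The superpartition with an additional part in `Λ^s`. -/
def consSym (Λ : SPar) (r : ℕ) (hr : 0 < r) : SPar :=
  ⟨Λ.anti, r ::ₘ Λ.sym, fun n hn => (Multiset.mem_cons.1 hn).elim (fun h => h ▸ hr) (Λ.pos n)⟩

/-- The superpartition with an additional part in `Λ^a`. -/
def insertAnti (Λ : SPar) (k : ℕ) : SPar := ⟨insert k Λ.anti, Λ.sym, Λ.pos⟩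

/-- The superpartition with a part of `Λ^s` removed. -/
def eraseSym (Λ : SPar) (r : ℕ) : SPar :=
  ⟨Λ.anti, Λ.sym.erase r, fun n hn => Λ.pos n (Multiset.mem_of_mem_erase hn)⟩

/-- The superpartition with a part of `Λ^a` removed. -/
def eraseAnti (Λ : SPar) (k : ℕ) : SPar := ⟨Λ.anti.erase k, Λ.sym, Λ.pos⟩

/-- The empty superpartition. -/
def empty : SPar := ⟨∅, 0, fun n hn => absurd hn (Multiset.notMem_zero n)⟩

/-- The parts of `Λ^a` are inserted in increasing order, so each `p̃_k` is multiplied from the left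
to a product of `p̃_j` with `j < k` and no sign appears. -/
theorem induction {C : SPar → Prop} (h0 : C empty)
    (hs : ∀ Λ r hr, C Λ → C (consSym Λ r hr))
    (ha : ∀ Λ k, (∀ j ∈ Λ.anti, j < k) → C Λ → C (insertAnti Λ k)) (Λ : SPar) : C Λ := by
  obtain ⟨A, s, hpos⟩ := Λ
  induction A using Finset.induction_on_max with
  | empty =>
    induction s using Multiset.induction_on with
    | empty => exact h0
    | cons r s ih =>
      exact hs ⟨∅, s, fun n hn => hpos n (Multiset.mem_cons_of_mem hn)⟩ r
        (hpos r (Multiset.mem_cons_self r s)) (ih _)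
  | insert k A hk ih => exact ha ⟨A, s, hpos⟩ k hk ih

end SPar

namespace sSym

theorem psum_mul_comm (r : ℕ) (f : sSym) : psum r * f = f * psum r :=
  Subtype.ext <| by
    have := mul_eq_smul_mul (f := psumSeries r) (g := f) (n := 0) fun A e B e' h _ => by
      rw [card_eq_zero_of_psumSeries h, zero_mul]
    rw [pow_zero, one_smul] at this
    exact this

theorem psumTilde_mul_comm (j k : ℕ) : psumTilde j * psumTilde k = -(psumTilde k * psumTilde j) :=
  Subtype.ext <| by
    have := mul_eq_smul_mul (f := psumTildeSeries j) (g := psumTildeSeries k) (n := 1)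
      fun A e B e' h h' => by
        rw [card_eq_one_of_psumTildeSeries h, card_eq_one_of_psumTildeSeries h']
    rw [pow_one, neg_one_smul] at this
    exact this

theorem psumTilde_mul_self (k : ℕ) : psumTilde k * psumTilde k = 0 := by
  have h := psumTilde_mul_comm k k
  rw [eq_neg_iff_add_eq_zero, ← two_smul ℚ, smul_eq_zero] at h
  exact h.resolve_left two_ne_zero

/-- `p_λ` for a multiset `λ`. -/
noncomputable def psumProd (s : Multiset ℕ) : sSym := ((s.sort (· ≥ ·)).map psum).prod

/-- `p̃_{k_1} p̃_{k_2} ⋯` for the elements `k_1 > k_2 > ...` of a finite set. -/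
noncomputable def psumTildeProd (s : Finset ℕ) : sSym := ((s.sort (· ≥ ·)).map psumTilde).prod

theorem p_eq (Λ : SPar) : p Λ = psumTildeProd Λ.anti * psumProd Λ.sym := rfl

theorem psumProd_cons (r : ℕ) (s : Multiset ℕ) : psumProd (r ::ₘ s) = psum r * psumProd s := by
  rw [psumProd, psumProd, ← List.prod_cons, ← List.map_cons]
  refine List.Perm.prod_eq' (List.Perm.map _ ?_) ?_
  · rw [← Multiset.coe_eq_coe, Multiset.sort_eq, ← Multiset.cons_coe, Multiset.sort_eq]
  · rw [List.pairwise_map]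
    exact List.pairwise_iff_forall_sublist.2 fun _ => psum_mul_comm _ _

theorem psumTildeProd_insert {k : ℕ} {s : Finset ℕ} (h : ∀ j ∈ s, j < k) :
    psumTildeProd (insert k s) = psumTilde k * psumTildeProd s := by
  rw [psumTildeProd, sort_insert _ (fun j hj => (h j hj).le) fun hk => lt_irrefl k (h k hk),
    List.map_cons, List.prod_cons]
  rfl

/-- The factor `p̃_k` has to pass exactly the `p̃_j` with `j > k`, each passage costing a sign, and
its square is zero. -/
theorem psumTilde_mul_psumTildeProd (k : ℕ) (s : Finset ℕ) :
    psumTilde k * psumTildeProd s = if k ∈ s then 0 else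
      (-1 : ℚ) ^ (s.filter (k < ·)).card • psumTildeProd (insert k s) := by
  induction s using Finset.induction_on_max with
  | empty =>
    rw [if_neg (notMem_empty k), filter_empty, card_empty, pow_zero, one_smul,
      psumTildeProd_insert (by simp)]
  | insert a s ha ih =>
    have has : a ∉ s := fun h => lt_irrefl a (ha a h)
    rw [psumTildeProd_insert ha]
    rcases lt_trichotomy k a with hk | rfl | hk
    · rw [← mul_assoc, psumTilde_mul_comm, neg_mul, mul_assoc, ih]
      by_cases hks : k ∈ s
      · rw [if_pos hks, if_pos (mem_insert_of_mem hks), mul_zero, neg_zero]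
      · have h1 : k ∉ insert a s := by simp [hks, hk.ne]
        rw [if_neg hks, if_neg h1, filter_insert, if_pos hk, card_insert_of_notMem (by simp [has]),
          pow_succ, Finset.insert_comm, mul_smul_comm, ← psumTildeProd_insert]
        · rw [mul_neg_one, neg_smul]
        · intro j hj
          rcases mem_insert.1 hj with rfl | hj
          · exact hk
          · exact ha j hj
    · rw [if_pos (mem_insert_self _ _), ← mul_assoc, psumTilde_mul_self, zero_mul]
    · have hlt : ∀ j ∈ insert a s, j < k := fun j hj => by
        rcases mem_insert.1 hj with rfl | hj
        · exact hk
        · exact (ha j hj).trans hk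
      have h1 : k ∉ insert a s := fun h => lt_irrefl k (hlt k h)
      have h2 : (insert a s).filter (k < ·) = ∅ :=
        filter_eq_empty_iff.2 fun j hj => (hlt j hj).not_gt
      rw [if_neg h1, h2, card_empty, pow_zero, one_smul, psumTildeProd_insert hlt,
        psumTildeProd_insert ha]

theorem psum_mul_p {r : ℕ} (hr : 0 < r) (Λ : SPar) : psum r * p Λ = p (Λ.consSym r hr) := by
  rw [p_eq, p_eq, SPar.consSym, psumProd_cons, ← mul_assoc, psum_mul_comm, mul_assoc]

theorem psumTilde_mul_p (k : ℕ) (Λ : SPar) : psumTilde k * p Λ = if k ∈ Λ.anti then 0 else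
    (-1 : ℚ) ^ (Λ.anti.filter (k < ·)).card • p (Λ.insertAnti k) := by
  rw [p_eq, p_eq, SPar.insertAnti, ← mul_assoc, psumTilde_mul_psumTildeProd, ite_mul, zero_mul,
    smul_mul_assoc]

theorem psumTilde_mul_p_of_lt {k : ℕ} {Λ : SPar} (h : ∀ j ∈ Λ.anti, j < k) :
    psumTilde k * p Λ = p (Λ.insertAnti k) := by
  rw [p_eq, p_eq, SPar.insertAnti, ← mul_assoc, psumTildeProd_insert h]

theorem p_empty : p SPar.empty = 1 := by
  simp [p_eq, psumTildeProd, psumProd, SPar.empty]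

theorem psum_eq_p {r : ℕ} (hr : 0 < r) : psum r = p (SPar.empty.consSym r hr) := by
  rw [← psum_mul_p hr, p_empty, mul_one]

theorem psumTilde_eq_p (k : ℕ) : psumTilde k = p (SPar.empty.insertAnti k) := by
  rw [← psumTilde_mul_p_of_lt (by simp [SPar.empty]), p_empty, mul_one]

theorem hom_ext {W : Type} [AddCommGroup W] [Module ℚ W] {f g : sSym →ₗ[ℚ] W}
    (h : ∀ Λ, f (p Λ) = g (p Λ)) : f = g :=
  pBasis.ext fun Λ => by rw [pBasis_apply]; exact h Λ

theorem parity_mul (f g : sSym) : parity (f * g) = parity f * parity g :=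
  Subtype.ext (SSeries.parity_mul f g)

theorem parity_psum (r : ℕ) : parity (psum r) = psum r :=
  Subtype.ext <| ext fun A e => by
    change (-1) ^ A.card * coeff A e (psumSeries r) = coeff A e (psumSeries r)
    by_cases h : coeff A e (psumSeries r) = 0
    · rw [h, mul_zero]
    · rw [card_eq_zero_of_psumSeries h, pow_zero, one_mul]

theorem parity_psumTilde (k : ℕ) : parity (psumTilde k) = -psumTilde k :=
  Subtype.ext <| ext fun A e => by
    change (-1) ^ A.card * coeff A e (psumTildeSeries k) = coeff A e (-psumTildeSeries k)
    rw [map_neg]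
    by_cases h : coeff A e (psumTildeSeries k) = 0
    · rw [h, mul_zero, neg_zero]
    · rw [card_eq_one_of_psumTildeSeries h, pow_one, neg_one_mul]

theorem parity_one : parity 1 = 1 :=
  Subtype.ext <| ext fun A e => by
    change (-1) ^ A.card * coeff A e (1 : SSeries) = coeff A e (1 : SSeries)
    rw [coeff_one]
    split_ifs with h
    · rw [h.1, card_empty, pow_zero, one_mul]
    · rw [mul_zero]

theorem parity_p (Λ : SPar) : parity (p Λ) = (-1 : ℚ) ^ Λ.anti.card • p Λ := by
  induction Λ using SPar.induction with
  | h0 => rw [p_empty, parity_one]; simp [SPar.empty]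
  | hs Λ r hr ih => rw [← psum_mul_p hr, parity_mul, parity_psum, ih, mul_smul_comm]; rfl
  | ha Λ k hk ih =>
    rw [← psumTilde_mul_p_of_lt hk, parity_mul, parity_psumTilde, ih, SPar.insertAnti,
      card_insert_of_notMem fun h => lt_irrefl k (hk k h), pow_succ, mul_smul_comm, neg_mul,
      mul_neg_one, neg_smul, smul_neg]

theorem exists_isSuperHopf : ∃ S, IsSuperHopf parity comul counit S :=
  SSeries.exists_isSuperHopf splitClosed_sSym homog_mem_sSym fun _ => rfl

theorem counit_mul (f g : sSym) : counit (f * g) = counit f * counit g :=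
  exists_isSuperHopf.choose_spec.counit_mul f g

theorem counit_psum {r : ℕ} (hr : 0 < r) : counit (psum r) = 0 := by
  change coeff ∅ 0 (psumSeries r) = 0
  rw [psumSeries, coeff_of, if_neg]
  rintro ⟨-, i, hi⟩
  have := DFunLike.congr_fun hi i
  simp at this
  omega

theorem counit_psumTilde (k : ℕ) : counit (psumTilde k) = 0 := by
  change coeff ∅ 0 (psumTildeSeries k) = 0
  rw [psumTildeSeries, coeff_of, if_neg]
  rintro ⟨i, hi, -⟩
  exact (singleton_ne_empty i) hi.symm

/-! ### The scalar product, and contraction of coproducts against functionals. -/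

/-- The scalar product. -/
noncomputable def form : sSym →ₗ[ℚ] sSym →ₗ[ℚ] ℚ := by
  classical
  exact pBasis.constr ℚ fun Λ => pBasis.constr ℚ fun Ω => if Λ = Ω then (z Λ.sym : ℚ) else 0

open Classical in
theorem form_p (Λ Ω : SPar) : form (p Λ) (p Ω) = if Λ = Ω then (z Λ.sym : ℚ) else 0 := by
  rw [form, ← pBasis_apply, ← pBasis_apply, Module.Basis.constr_basis, Module.Basis.constr_basis]

theorem eq_form {B : sSym →ₗ[ℚ] sSym →ₗ[ℚ] ℚ} (hB : IsHallForm B) : B = form :=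
  hom_ext fun Λ => hom_ext fun Ω => by rw [hB, form_p]

theorem form_symm (f g : sSym) : form f g = form g f := by
  have : form = form.flip := hom_ext fun Λ => hom_ext fun Ω => by
    classical
    rw [LinearMap.flip_apply, form_p, form_p]
    by_cases h : Λ = Ω
    · rw [if_pos h, if_pos h.symm, h]
    · rw [if_neg h, if_neg (Ne.symm h)]
  exact LinearMap.congr_fun (LinearMap.congr_fun this f) g

theorem z_ne_zero (Λ : SPar) : (z Λ.sym : ℚ) ≠ 0 := by
  rw [z, Nat.cast_ne_zero, prod_ne_zero_iff]
  intro i hi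
  have := Λ.pos i (Multiset.mem_toFinset.1 hi)
  positivity

theorem z_eq_prod {s : Multiset ℕ} {S : Finset ℕ} (h : s.toFinset ⊆ S) :
    z s = ∏ i ∈ S, i ^ s.count i * (s.count i).factorial := by
  refine prod_subset h fun i _ hi => ?_
  rw [Multiset.count_eq_zero_of_notMem fun h' => hi (Multiset.mem_toFinset.2 h')]
  simp

/-- The quotient is the factor that `r ∂/∂p_r` produces, which makes this operator adjoint to
multiplication by `p_r`. -/
theorem z_cons (r : ℕ) (s : Multiset ℕ) : z (r ::ₘ s) = r * (s.count r + 1) * z s := by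
  have h1 : (r ::ₘ s).toFinset ⊆ insert r s.toFinset := by
    rw [Multiset.toFinset_cons]
  rw [z_eq_prod h1, z_eq_prod (subset_insert r s.toFinset),
    ← mul_prod_erase _ _ (mem_insert_self r s.toFinset),
    ← mul_prod_erase (insert r s.toFinset) _ (mem_insert_self r s.toFinset),
    Multiset.count_cons_self, Nat.factorial_succ]
  rw [prod_congr rfl fun i hi => by rw [Multiset.count_cons_of_ne (ne_of_mem_erase hi)]]
  ring

theorem eq_zero_of_form (f : sSym) (h : ∀ g, form f g = 0) : f = 0 := by
  classical
  refine pBasis.repr.injective (Finsupp.ext fun Ω => ?_)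
  have h1 : form.flip (p Ω) = (z Ω.sym : ℚ) • pBasis.coord Ω := hom_ext fun Λ => by
    rw [LinearMap.flip_apply, form_p, LinearMap.smul_apply, ← pBasis_apply Λ,
      Module.Basis.coord_apply, Module.Basis.repr_self, Finsupp.single_apply]
    by_cases h : Λ = Ω
    · rw [if_pos h, if_pos h, h, smul_eq_mul, mul_one]
    · rw [if_neg h, if_neg h, smul_zero]
  have h2 := LinearMap.congr_fun h1 f
  rw [LinearMap.flip_apply, h, LinearMap.smul_apply, smul_eq_mul] at h2
  rw [map_zero]
  exact (mul_eq_zero.1 h2.symm).resolve_left (z_ne_zero Ω)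

/-- `a ⊗ b ↦ φ(a) b` -/
noncomputable def contract (φ : sSym →ₗ[ℚ] ℚ) : sSym ⊗[ℚ] sSym →ₗ[ℚ] sSym :=
  (TensorProduct.lid ℚ sSym).toLinearMap ∘ₗ φ.rTensor sSym

theorem contract_tmul (φ : sSym →ₗ[ℚ] ℚ) (a b : sSym) : contract φ (a ⊗ₜ b) = φ a • b := by
  simp [contract]

theorem contract_tmul_one_mul (φ : sSym →ₗ[ℚ] ℚ) (a : sSym) (t : sSym ⊗[ℚ] sSym) :
    contract φ ((a ⊗ₜ 1) * t) = contract (φ ∘ₗ LinearMap.mulLeft ℚ a) t := by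
  induction t with
  | zero => simp only [mul_zero, map_zero]
  | add x y hx hy => simp only [mul_add, map_add, hx, hy]
  | tmul x y =>
    rw [Algebra.TensorProduct.tmul_mul_tmul, contract_tmul, contract_tmul, one_mul]
    rfl

theorem contract_one_tmul_mul (φ : sSym →ₗ[ℚ] ℚ) (a : sSym) (t : sSym ⊗[ℚ] sSym) :
    contract φ ((1 ⊗ₜ a) * t) = a * contract φ t := by
  induction t with
  | zero => simp only [mul_zero, map_zero]
  | add x y hx hy => simp only [mul_add, map_add, hx, hy]
  | tmul x y =>
    rw [Algebra.TensorProduct.tmul_mul_tmul, contract_tmul, contract_tmul, one_mul, mul_smul_comm]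

theorem contract_rTensor (φ : sSym →ₗ[ℚ] ℚ) (P : sSym →ₗ[ℚ] sSym) (t : sSym ⊗[ℚ] sSym) :
    contract φ (P.rTensor sSym t) = contract (φ ∘ₗ P) t := by
  induction t with
  | zero => simp only [map_zero]
  | add x y hx hy => simp only [map_add, hx, hy]
  | tmul x y => rw [LinearMap.rTensor_tmul, contract_tmul, contract_tmul]; rfl

theorem contract_smul (c : ℚ) (φ : sSym →ₗ[ℚ] ℚ) (t : sSym ⊗[ℚ] sSym) :
    contract (c • φ) t = c • contract φ t := by
  rw [contract, contract, LinearMap.rTensor_smul]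
  simp

theorem contract_counit (f : sSym) : contract counit (comul f) = f := by
  have h := SSeries.counit_rTensor_comul splitClosed_sSym f
  change TensorProduct.lid ℚ sSym ((SSeries.counit sSym).rTensor sSym
    (SSeries.comul splitClosed_sSym f)) = f
  rw [h, TensorProduct.lid_tmul, one_smul]

/-- The adjoint of the multiplication by an element that represents `φ`. -/
noncomputable def skew (φ : sSym →ₗ[ℚ] ℚ) : sSym →ₗ[ℚ] sSym := contract φ ∘ₗ comul

theorem comul_contract (φ : sSym →ₗ[ℚ] ℚ) (t : sSym ⊗[ℚ] sSym) :
    comul (contract φ t) =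
      (TensorProduct.lid ℚ (sSym ⊗[ℚ] sSym)) (φ.rTensor (sSym ⊗[ℚ] sSym) (comul.lTensor sSym t)) := by
  induction t with
  | zero => simp only [LinearMap.map_zero, LinearEquiv.map_zero]
  | add x y hx hy => simp only [LinearMap.map_add, LinearEquiv.map_add, hx, hy]
  | tmul x y =>
    rw [contract_tmul, map_smul, LinearMap.lTensor_tmul, LinearMap.rTensor_tmul,
      TensorProduct.lid_tmul]

theorem contract_rTensor_comul (φ : sSym →ₗ[ℚ] ℚ) (t : sSym ⊗[ℚ] sSym) :
    (TensorProduct.lid ℚ (sSym ⊗[ℚ] sSym)) (φ.rTensor (sSym ⊗[ℚ] sSym)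
      (TensorProduct.assoc ℚ sSym sSym sSym (comul.rTensor sSym t))) =
      (skew φ).rTensor sSym t := by
  induction t with
  | zero => simp only [LinearMap.map_zero, LinearEquiv.map_zero]
  | add x y hx hy => simp only [LinearMap.map_add, LinearEquiv.map_add, hx, hy]
  | tmul x y =>
    rw [LinearMap.rTensor_tmul, LinearMap.rTensor_tmul, skew, LinearMap.comp_apply]
    induction comul x with
    | zero =>
      rw [TensorProduct.zero_tmul]
      simp only [LinearMap.map_zero, LinearEquiv.map_zero, TensorProduct.zero_tmul]
    | add x' y' hx hy =>
      rw [TensorProduct.add_tmul]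
      simp only [LinearMap.map_add, LinearEquiv.map_add, hx, hy, TensorProduct.add_tmul]
    | tmul x' y' =>
      rw [TensorProduct.assoc_tmul, LinearMap.rTensor_tmul, TensorProduct.lid_tmul, contract_tmul,
        TensorProduct.smul_tmul']

/-- Both sides apply `φ` to the first of three factors of the iterated coproduct, with the two
bracketings; coassociativity identifies them. -/
theorem comul_skew (φ : sSym →ₗ[ℚ] ℚ) (f : sSym) :
    comul (skew φ f) = (skew φ).rTensor sSym (comul f) := by
  rw [← contract_rTensor_comul]
  rw [show TensorProduct.assoc ℚ sSym sSym sSym (comul.rTensor sSym (comul f)) =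
    comul.lTensor sSym (comul f) from
      LinearMap.congr_fun (SSeries.comul_coassoc splitClosed_sSym) f]
  exact comul_contract φ _

end sSym

theorem superMul_add_left {A : Type} [Ring A] [Algebra ℚ A] (P : A →ₗ[ℚ] A) (s s' t : A ⊗[ℚ] A) :
    superMul P (s + s') t = superMul P s t + superMul P s' t := by
  simp only [superMul, map_add, add_mul]
  module

/-- If the second factors of `s` are even, no sign arises and the four terms collapse. In the odd
case that follows, the sign is the parity of the first factors of `t`. -/
theorem superMul_of_even {A : Type} [Ring A] [Algebra ℚ A] {P : A →ₗ[ℚ] A} {s : A ⊗[ℚ] A}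
    (h : P.lTensor A s = s) (t : A ⊗[ℚ] A) : superMul P s t = s * t := by
  rw [superMul, h]
  module

theorem superMul_of_odd {A : Type} [Ring A] [Algebra ℚ A] {P : A →ₗ[ℚ] A} {s : A ⊗[ℚ] A}
    (h : P.lTensor A s = -s) (t : A ⊗[ℚ] A) : superMul P s t = s * P.rTensor A t := by
  rw [superMul, h, neg_mul, neg_mul]
  module

/-! ### Power sums are primitive. -/

namespace SSeries

theorem coeff_one_eq (u : Mon) : coeff u.1 u.2 (1 : SSeries) = if shape u = 1 then 1 else 0 := by
  rw [← sQSym.coeffOn_M u 1, sNSym.M_one]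
  rfl

theorem thetaSet_fin_one (a : Fin 1 → DPart) (i : Fin 1 ↪o ℕ) :
    thetaSet a i = if (a 0).isRight then {i 0} else ∅ := by
  rw [thetaSet, univ_unique, Fin.default_eq_zero, filter_singleton]
  split_ifs <;> rfl

theorem expo_fin_one (a : Fin 1 → DPart) (i : Fin 1 ↪o ℕ) :
    expo a i = Finsupp.single (i 0) (DPart.val (a 0)) := Fin.sum_univ_one _

theorem shape_eq_of_iff (a : DPart) (u : Mon) : shape u = FreeMonoid.of a ↔
    ∃ i, u = (if a.isRight then {i} else ∅, Finsupp.single i (DPart.val a)) := by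
  have h (i : Fin 1 ↪o ℕ) : shape (if a.isRight then {i 0} else ∅, Finsupp.single (i 0) (DPart.val a)) =
      FreeMonoid.of a := by
    have := shape_eq (fun _ : Fin 1 => a) i
    rwa [thetaSet_fin_one, expo_fin_one] at this
  constructor
  · intro hu
    have h1 := coeff_monoSeries (FreeMonoid.of a) u
    rw [if_pos hu, monoSeries, coeff_of] at h1
    obtain ⟨i, h2, h3⟩ := of_not_not fun hc => zero_ne_one ((if_neg hc).symm.trans h1)
    exact ⟨_, Prod.ext (h2.symm.trans (thetaSet_fin_one _ i)) (h3.symm.trans (expo_fin_one _ i))⟩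
  · rintro ⟨i, rfl⟩
    exact h (OrderEmbedding.ofStrictMono (fun _ => i) (Subsingleton.strictMono _))

theorem coeff_psumSeries {r : ℕ} (hr : 0 < r) (u : Mon) : coeff u.1 u.2 (psumSeries r) =
    if shape u = FreeMonoid.of (Sum.inl ⟨r, hr⟩) then 1 else 0 := by
  rw [psumSeries, coeff_of]
  congr 1
  refine propext (Iff.trans ?_ (shape_eq_of_iff _ u).symm)
  exact ⟨fun ⟨h, i, h'⟩ => ⟨i, Prod.ext h h'⟩,
    fun ⟨i, h⟩ => ⟨congrArg Prod.fst h, i, congrArg Prod.snd h⟩⟩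

theorem coeff_psumTildeSeries (k : ℕ) (u : Mon) : coeff u.1 u.2 (psumTildeSeries k) =
    if shape u = FreeMonoid.of (Sum.inr k) then 1 else 0 := by
  rw [psumTildeSeries, coeff_of]
  congr 1
  refine propext (Iff.trans ?_ (shape_eq_of_iff _ u).symm)
  exact ⟨fun ⟨i, h, h'⟩ => ⟨i, Prod.ext h h'⟩,
    fun ⟨i, h⟩ => ⟨i, congrArg Prod.fst h, congrArg Prod.snd h⟩⟩

end SSeries

namespace sSym

/-- A composition with one part is a concatenation of two compositions only if one of these is
empty. -/
theorem comul_of_coeff {f : sSym} {a : DPart} (h : ∀ u : Mon, coeff u.1 u.2 (f : SSeries) =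
    if shape u = FreeMonoid.of a then 1 else 0) : comul f = f ⊗ₜ 1 + 1 ⊗ₜ f := by
  refine twoAlphabet_injective sSym ?_
  refine (twoAlphabet_comul splitClosed_sSym f).trans ?_
  funext u v
  rw [split_apply, h, shape_juxt le_rfl, map_add, Pi.add_apply, Pi.add_apply, twoAlphabet_tmul,
    twoAlphabet_tmul, h, h, Subalgebra.coe_one, coeff_one_eq, coeff_one_eq]
  have h1 : shape u * shape v = FreeMonoid.of a ↔
      (shape u = 1 ∧ shape v = FreeMonoid.of a) ∨ (shape u = FreeMonoid.of a ∧ shape v = 1) :=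
    List.append_eq_singleton_iff
  have h2 : (1 : DComp) ≠ FreeMonoid.of a := fun h => by cases h
  by_cases hu : shape u = 1
  · have hu' : shape u ≠ FreeMonoid.of a := hu ▸ h2
    simp [hu, h2]
  · by_cases hv : shape v = 1 <;> simp [h1, hu, hv]

theorem comul_psum {r : ℕ} (hr : 0 < r) : comul (psum r) = psum r ⊗ₜ 1 + 1 ⊗ₜ psum r :=
  comul_of_coeff (coeff_psumSeries hr)

theorem comul_psumTilde (k : ℕ) : comul (psumTilde k) = psumTilde k ⊗ₜ 1 + 1 ⊗ₜ psumTilde k :=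
  comul_of_coeff (coeff_psumTildeSeries k)

theorem comul_mul (f g : sSym) : comul (f * g) = superMul parity (comul f) (comul g) :=
  exists_isSuperHopf.choose_spec.comul_mul f g

theorem comul_one : comul 1 = 1 ⊗ₜ 1 := exists_isSuperHopf.choose_spec.comul_one

theorem comul_psum_mul {r : ℕ} (hr : 0 < r) (f : sSym) :
    comul (psum r * f) = (psum r ⊗ₜ 1) * comul f + (1 ⊗ₜ psum r) * comul f := by
  rw [comul_mul, comul_psum hr, superMul_add_left,
    superMul_of_even (by rw [LinearMap.lTensor_tmul, parity_one]),
    superMul_of_even (by rw [LinearMap.lTensor_tmul, parity_psum])]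

theorem comul_psumTilde_mul (k : ℕ) (f : sSym) : comul (psumTilde k * f) =
    (psumTilde k ⊗ₜ 1) * comul f + (1 ⊗ₜ psumTilde k) * parity.rTensor sSym (comul f) := by
  rw [comul_mul, comul_psumTilde, superMul_add_left,
    superMul_of_even (by rw [LinearMap.lTensor_tmul, parity_one]),
    superMul_of_odd (by rw [LinearMap.lTensor_tmul, parity_psumTilde, TensorProduct.tmul_neg])]

/-! ### Contraction with power sums: derivations adjoint to multiplication. -/

theorem skew_one (φ : sSym →ₗ[ℚ] ℚ) : skew φ 1 = φ 1 • 1 := by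
  rw [skew, LinearMap.comp_apply, comul_one, contract_tmul]

/-- A Leibniz rule: the two terms of the primitive coproduct of `p_r` give its derivative `c` and
the undifferentiated factor. For `p̃_k`, in the next lemma, `d` is the parity of `φ`, the sign for
moving the operator past an odd factor. -/
theorem skew_psum_mul {r : ℕ} (hr : 0 < r) {φ : sSym →ₗ[ℚ] ℚ} {c : ℚ}
    (h : φ ∘ₗ LinearMap.mulLeft ℚ (psum r) = c • counit) (f : sSym) :
    skew φ (psum r * f) = c • f + psum r * skew φ f := by
  rw [skew, LinearMap.comp_apply, comul_psum_mul hr, map_add, contract_tmul_one_mul,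
    contract_one_tmul_mul, h, contract_smul, contract_counit]
  rfl

theorem skew_psumTilde_mul (k : ℕ) {φ : sSym →ₗ[ℚ] ℚ} {c d : ℚ}
    (h : φ ∘ₗ LinearMap.mulLeft ℚ (psumTilde k) = c • counit) (hd : φ ∘ₗ parity = d • φ) (f : sSym) :
    skew φ (psumTilde k * f) = c • f + d • (psumTilde k * skew φ f) := by
  rw [skew, LinearMap.comp_apply, comul_psumTilde_mul, map_add, contract_tmul_one_mul,
    contract_one_tmul_mul, h, contract_rTensor, hd, contract_smul, contract_smul, contract_counit,
    mul_smul_comm]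
  rfl

theorem consSym_ne_empty (Λ : SPar) (r : ℕ) (hr : 0 < r) : Λ.consSym r hr ≠ SPar.empty := fun h =>
  Multiset.cons_ne_zero (congrArg SPar.sym h)

theorem insertAnti_ne_empty (Λ : SPar) (k : ℕ) : Λ.insertAnti k ≠ SPar.empty := fun h =>
  insert_ne_empty k Λ.anti (congrArg SPar.anti h)

open Classical in
theorem counit_p (Λ : SPar) : counit (p Λ) = if Λ = SPar.empty then 1 else 0 := by
  induction Λ using SPar.induction with
  | h0 => rw [p_empty, if_pos rfl]; exact exists_isSuperHopf.choose_spec.counit_one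
  | hs Λ r hr _ =>
    rw [← psum_mul_p hr, counit_mul, counit_psum hr, zero_mul, if_neg (consSym_ne_empty _ _ _)]
  | ha Λ k hk _ =>
    rw [← psumTilde_mul_p_of_lt hk, counit_mul, counit_psumTilde, zero_mul,
      if_neg (insertAnti_ne_empty _ _)]

theorem form_one : form 1 = counit := hom_ext fun Λ => by
  classical
  rw [← p_empty, form_p, counit_p]
  by_cases h : Λ = SPar.empty
  · rw [if_pos h, if_pos h.symm]; simp [SPar.empty, z]
  · rw [if_neg h, if_neg (Ne.symm h)]

theorem form_psum_one {r : ℕ} (hr : 0 < r) : form (psum r) 1 = 0 := by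
  rw [form_symm, form_one, counit_psum hr]

theorem form_psumTilde_one (k : ℕ) : form (psumTilde k) 1 = 0 := by
  rw [form_symm, form_one, counit_psumTilde]

/-- Orthogonality of the basis: a product `p_s p_Λ` pairs with the single power sum `p_r` only if
`Λ` is empty. This and its variants supply the hypotheses of the Leibniz rules. -/
theorem form_psum_comp_psum {r s : ℕ} (hr : 0 < r) (hs : 0 < s) :
    form (psum r) ∘ₗ LinearMap.mulLeft ℚ (psum s) = (if s = r then (r : ℚ) else 0) • counit :=
  hom_ext fun Λ => by
    classical
    rw [LinearMap.comp_apply, LinearMap.mulLeft_apply, psum_mul_p hs, psum_eq_p hr, form_p,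
      LinearMap.smul_apply, counit_p, smul_eq_mul]
    by_cases h : SPar.empty.consSym r hr = Λ.consSym s hs
    · have h1 : r ::ₘ (0 : Multiset ℕ) = s ::ₘ Λ.sym := congrArg SPar.sym h
      have h2 : ∅ = Λ.anti := congrArg SPar.anti h
      have h3 := congrArg Multiset.card h1
      rw [Multiset.card_cons, Multiset.card_cons, Multiset.card_zero, Nat.add_right_cancel_iff,
        eq_comm, Multiset.card_eq_zero] at h3
      rw [h3, Multiset.cons_inj_left] at h1
      rw [if_pos h, if_pos h1.symm, if_pos (SPar.ext' (congrArg Finset.val h2.symm) h3)]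
      simp [SPar.consSym, SPar.empty, z]
    · rw [if_neg h, eq_comm, mul_eq_zero]
      by_cases h1 : s = r
      · subst h1
        exact Or.inr (if_neg fun h2 => h (by rw [h2]))
      · exact Or.inl (if_neg h1)

theorem form_psum_comp_psumTilde {r : ℕ} (hr : 0 < r) (k : ℕ) :
    form (psum r) ∘ₗ LinearMap.mulLeft ℚ (psumTilde k) = (0 : ℚ) • counit :=
  hom_ext fun Λ => by
    rw [LinearMap.comp_apply, LinearMap.mulLeft_apply, psumTilde_mul_p, zero_smul,
      LinearMap.zero_apply]
    split_ifs
    · exact map_zero _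
    · rw [map_smul, psum_eq_p hr, form_p, if_neg, smul_zero]
      exact fun h => insert_ne_empty k Λ.anti (congrArg SPar.anti h).symm

theorem form_psumTilde_comp_psum (k : ℕ) {r : ℕ} (hr : 0 < r) :
    form (psumTilde k) ∘ₗ LinearMap.mulLeft ℚ (psum r) = (0 : ℚ) • counit :=
  hom_ext fun Λ => by
    rw [LinearMap.comp_apply, LinearMap.mulLeft_apply, psum_mul_p hr, psumTilde_eq_p, form_p,
      zero_smul, LinearMap.zero_apply, if_neg]
    exact fun h => Multiset.cons_ne_zero (congrArg SPar.sym h).symm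

theorem form_psumTilde_comp_psumTilde (j k : ℕ) :
    form (psumTilde k) ∘ₗ LinearMap.mulLeft ℚ (psumTilde j) = (if j = k then 1 else 0 : ℚ) • counit :=
  hom_ext fun Λ => by
    classical
    rw [LinearMap.comp_apply, LinearMap.mulLeft_apply, psumTilde_mul_p, psumTilde_eq_p k,
      LinearMap.smul_apply, counit_p, smul_eq_mul]
    by_cases hj : j ∈ Λ.anti
    · rw [if_pos hj, map_zero, if_neg (c := Λ = _), mul_zero]
      rintro rfl
      exact notMem_empty j hj
    · rw [if_neg hj, map_smul, form_p, smul_eq_mul]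
      by_cases h : SPar.empty.insertAnti k = Λ.insertAnti j
      · have h1 : insert k ∅ = insert j Λ.anti := congrArg SPar.anti h
        have h2 : 0 = Λ.sym := congrArg SPar.sym h
        have h3 := congrArg card h1
        rw [card_insert_of_notMem (notMem_empty k), card_insert_of_notMem hj, card_empty,
          Nat.add_right_cancel_iff, eq_comm, card_eq_zero] at h3
        have h4 : k = j := by
          rw [h3] at h1
          exact singleton_injective h1
        rw [if_pos h, if_pos h4.symm, if_pos (SPar.ext' (congrArg Finset.val h3) h2.symm), h3]
        simp [SPar.insertAnti, SPar.empty, z]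
      · rw [if_neg h, mul_zero, eq_comm, mul_eq_zero]
        by_cases h1 : j = k
        · subst h1
          exact Or.inr (if_neg fun h2 => h (by rw [h2]))
        · exact Or.inl (if_neg h1)

theorem form_parity (f g : sSym) : form (parity f) (parity g) = form f g := by
  have : (form ∘ₗ parity).compl₂ parity = form := hom_ext fun Λ => hom_ext fun Ω => by
    classical
    rw [LinearMap.compl₂_apply, LinearMap.comp_apply, parity_p, parity_p, map_smul, map_smul,
      LinearMap.smul_apply, form_p, smul_eq_mul, smul_eq_mul]
    split_ifs with h
    · rw [h, ← mul_assoc, ← pow_add, Even.neg_one_pow ⟨_, rfl⟩, one_mul]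
    · rw [mul_zero, mul_zero]
  exact LinearMap.congr_fun (LinearMap.congr_fun this f) g

theorem form_psum_comp_parity (r : ℕ) : form (psum r) ∘ₗ parity = (1 : ℚ) • form (psum r) := by
  refine LinearMap.ext fun f => ?_
  rw [LinearMap.comp_apply, one_smul, ← form_parity _ f, parity_psum]

theorem form_psumTilde_comp_parity (k : ℕ) :
    form (psumTilde k) ∘ₗ parity = (-1 : ℚ) • form (psumTilde k) := by
  refine LinearMap.ext fun f => ?_
  rw [LinearMap.comp_apply, LinearMap.smul_apply, ← form_parity _ f, parity_psumTilde, map_neg,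
    LinearMap.neg_apply, neg_one_smul, neg_neg]

/-- Contraction with `p_r` is `r ∂/∂p_r`, by the Leibniz rules. If `r` is not a part, the count is
zero and the value of `eraseSym` does not matter. -/
theorem skew_psum_p {r : ℕ} (hr : 0 < r) (Λ : SPar) :
    skew (form (psum r)) (p Λ) = (r * Λ.sym.count r : ℚ) • p (Λ.eraseSym r) := by
  induction Λ using SPar.induction with
  | h0 => rw [p_empty, skew_one, form_psum_one hr]; simp [SPar.empty]
  | hs Λ s hs ih =>
    rw [← psum_mul_p hs, skew_psum_mul hs (form_psum_comp_psum hr hs), ih, mul_smul_comm,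
      psum_mul_p hs]
    by_cases h : s = r
    · subst h
      have h1 : (Λ.consSym s hs).eraseSym s = Λ := SPar.ext' rfl (Multiset.erase_cons_head s Λ.sym)
      have h2 : (Λ.consSym s hs).sym.count s = Λ.sym.count s + 1 := Multiset.count_cons_self s _
      rw [if_pos rfl, h1, h2]
      by_cases hm : s ∈ Λ.sym
      · have h3 : (Λ.eraseSym s).consSym s hs = Λ := SPar.ext' rfl (Multiset.cons_erase hm)
        rw [h3]
        push_cast
        module
      · rw [Multiset.count_eq_zero_of_notMem hm]
        simp
    · have h1 : (Λ.consSym s hs).eraseSym r = (Λ.eraseSym r).consSym s hs :=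
        SPar.ext' rfl (Multiset.erase_cons_tail Λ.sym h)
      have h2 : (Λ.consSym s hs).sym.count r = Λ.sym.count r :=
        Multiset.count_cons_of_ne (Ne.symm h) _
      rw [if_neg h, zero_smul, zero_add, h1, h2]
  | ha Λ k hk ih =>
    have hk' : ∀ j ∈ (Λ.eraseSym r).anti, j < k := hk
    rw [← psumTilde_mul_p_of_lt hk, skew_psumTilde_mul k (form_psum_comp_psumTilde hr k)
      (form_psum_comp_parity r), ih, zero_smul, zero_add, one_smul, mul_smul_comm,
      psumTilde_mul_p_of_lt hk']
    rfl

/-- Contraction with `p̃_k` is the left derivative `∂/∂p̃_k`. The sign counts the larger `p̃_j`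
standing before `p̃_k`, just as in `psumTilde_mul_p`, which makes the two operators adjoint. -/
theorem skew_psumTilde_p (k : ℕ) (Λ : SPar) :
    skew (form (psumTilde k)) (p Λ) = if k ∈ Λ.anti then
      (-1 : ℚ) ^ (Λ.anti.filter (k < ·)).card • p (Λ.eraseAnti k) else 0 := by
  induction Λ using SPar.induction with
  | h0 => rw [p_empty, skew_one, form_psumTilde_one, zero_smul]; exact (if_neg (notMem_empty k)).symm
  | hs Λ s hs ih =>
    rw [← psum_mul_p hs, skew_psum_mul hs (form_psumTilde_comp_psum k hs), ih, zero_smul, zero_add,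
      mul_ite, mul_zero, mul_smul_comm, psum_mul_p hs]
    rfl
  | ha Λ j hj ih =>
    rw [← psumTilde_mul_p_of_lt hj, skew_psumTilde_mul j (form_psumTilde_comp_psumTilde j k)
      (form_psumTilde_comp_parity k), ih]
    by_cases h : j = k
    · subst h
      have h0 : j ∈ (Λ.insertAnti j).anti := mem_insert_self j _
      have hm : j ∉ Λ.anti := fun h => lt_irrefl j (hj j h)
      have h1 : (Λ.insertAnti j).eraseAnti j = Λ :=
        SPar.ext' (congrArg Finset.val (erase_insert hm)) rfl
      have h2 : (Λ.insertAnti j).anti.filter (j < ·) = ∅ := filter_eq_empty_iff.2 fun i hi => by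
        rcases mem_insert.1 hi with rfl | hi
        · exact lt_irrefl i
        · exact (hj i hi).not_gt
      rw [if_neg hm, if_pos rfl, if_pos h0, h1, h2]
      simp
    · by_cases hm : k ∈ Λ.anti
      · have h0 : k ∈ (Λ.insertAnti j).anti := mem_insert_of_mem hm
        have h1 : (Λ.insertAnti j).eraseAnti k = (Λ.eraseAnti k).insertAnti j :=
          SPar.ext' (congrArg Finset.val (erase_insert_of_ne h)) rfl
        have h2 : ((Λ.insertAnti j).anti.filter (k < ·)).card =
            (Λ.anti.filter (k < ·)).card + 1 := by
          rw [SPar.insertAnti, filter_insert, if_pos (hj k hm), card_insert_of_notMem]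
          exact fun h => lt_irrefl j (hj j (mem_filter.1 h).1)
        rw [if_pos hm, if_pos h0, if_neg h, h1, h2, mul_smul_comm,
          psumTilde_mul_p_of_lt fun i hi => hj i (mem_of_mem_erase hi), pow_succ]
        module
      · have h1 : k ∉ (Λ.insertAnti j).anti := fun h' =>
          (mem_insert.1 h').elim (fun h' => h h'.symm) hm
        rw [if_neg hm, if_neg h1, if_neg h]
        simp

theorem form_psum_mul {r : ℕ} (hr : 0 < r) (f g : sSym) :
    form (psum r * f) g = form f (skew (form (psum r)) g) := by
  have : form ∘ₗ LinearMap.mulLeft ℚ (psum r) = form.compl₂ (skew (form (psum r))) :=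
    hom_ext fun Λ => hom_ext fun Ω => by
      classical
      rw [LinearMap.compl₂_apply, LinearMap.comp_apply, LinearMap.mulLeft_apply, psum_mul_p hr,
        skew_psum_p hr, map_smul, form_p, form_p, smul_eq_mul]
      by_cases hm : r ∈ Ω.sym
      · have h1 : (Ω.eraseSym r).consSym r hr = Ω := SPar.ext' rfl (Multiset.cons_erase hm)
        by_cases h : Λ = Ω.eraseSym r
        · subst h
          rw [if_pos h1, if_pos rfl]
          conv_rhs => rw [← Multiset.cons_erase hm]
          rw [Multiset.count_cons_self]
          refine (congrArg Nat.cast (z_cons r (Ω.sym.erase r))).trans ?_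
          push_cast
          rfl
        · rw [if_neg h, if_neg, mul_zero]
          rintro rfl
          exact h (SPar.ext' rfl (Multiset.erase_cons_head r Λ.sym).symm)
      · rw [Multiset.count_eq_zero_of_notMem hm, Nat.cast_zero, mul_zero, zero_mul, if_neg]
        rintro rfl
        exact hm (Multiset.mem_cons_self r Λ.sym)
  exact LinearMap.congr_fun (LinearMap.congr_fun this f) g

theorem form_psumTilde_mul (k : ℕ) (f g : sSym) :
    form (psumTilde k * f) g = form f (skew (form (psumTilde k)) g) := by
  have : form ∘ₗ LinearMap.mulLeft ℚ (psumTilde k) = form.compl₂ (skew (form (psumTilde k))) :=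
    hom_ext fun Λ => hom_ext fun Ω => by
      classical
      rw [LinearMap.compl₂_apply, LinearMap.comp_apply, LinearMap.mulLeft_apply, psumTilde_mul_p,
        skew_psumTilde_p]
      by_cases hΛ : k ∈ Λ.anti
      · rw [if_pos hΛ, map_zero, LinearMap.zero_apply]
        split_ifs
        · rw [map_smul, form_p, if_neg, smul_zero]
          rintro rfl
          exact notMem_erase k _ hΛ
        · rw [map_zero]
      · rw [if_neg hΛ, map_smul, LinearMap.smul_apply, form_p, smul_eq_mul]
        by_cases hΩ : k ∈ Ω.anti
        · rw [if_pos hΩ, map_smul, form_p, smul_eq_mul]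
          by_cases h : Λ = Ω.eraseAnti k
          · subst h
            have h1 : (Ω.eraseAnti k).insertAnti k = Ω :=
              SPar.ext' (congrArg Finset.val (insert_erase hΩ)) rfl
            have h2 : (Ω.eraseAnti k).anti.filter (k < ·) = Ω.anti.filter (k < ·) := by
              rw [SPar.eraseAnti, filter_erase, erase_eq_of_notMem]
              exact fun h => lt_irrefl k (mem_filter.1 h).2
            rw [if_pos h1, if_pos rfl, h2]
            rfl
          · rw [if_neg h, if_neg, mul_zero, mul_zero]
            rintro rfl
            exact h (SPar.ext' (congrArg Finset.val (erase_insert hΛ).symm) rfl)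
        · rw [if_neg hΩ, map_zero, if_neg, mul_zero]
          rintro rfl
          exact hΩ (mem_insert_self k _)
  exact LinearMap.congr_fun (LinearMap.congr_fun this f) g

theorem tensorEval_rTensor (φ ψ : sSym →ₗ[ℚ] ℚ) (D : sSym →ₗ[ℚ] sSym) (t : sSym ⊗[ℚ] sSym) :
    tensorEval φ ψ (D.rTensor sSym t) = tensorEval (φ ∘ₗ D) ψ t := by
  induction t with
  | zero => simp only [map_zero]
  | add x y hx hy => simp only [map_add, hx, hy]
  | tmul x y => rfl

theorem tensorEval_counit (ψ : sSym →ₗ[ℚ] ℚ) (t : sSym ⊗[ℚ] sSym) :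
    tensorEval counit ψ t = ψ (contract counit t) := by
  induction t with
  | zero => simp only [map_zero]
  | add x y hx hy => simp only [map_add, hx, hy]
  | tmul x y => rw [contract_tmul, map_smul, tensorEval_tmul, smul_eq_mul]

/-- The scalar product is a Hopf pairing. -/
theorem form_mul (f g h : sSym) : form (f * g) h = tensorEval (form f) (form g) (comul h) := by
  have key (Λ : SPar) : ∀ g h, form (p Λ * g) h = tensorEval (form (p Λ)) (form g) (comul h) := by
    induction Λ using SPar.induction with
    | h0 =>
      intro g h
      rw [p_empty, one_mul, form_one, tensorEval_counit, contract_counit]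
    | hs Λ r hr ih =>
      intro g h
      -- Adjointness moves `p_r` to a contraction of `h`, which acts on the first factor of the
      -- coproduct; there adjointness is used backwards to restore `p_r`.
      rw [← psum_mul_p hr, mul_assoc, form_psum_mul hr, ih, comul_skew, tensorEval_rTensor]
      congr 2
      exact LinearMap.ext fun x => (form_psum_mul hr _ x).symm
    | ha Λ k hk ih =>
      intro g h
      rw [← psumTilde_mul_p_of_lt hk, mul_assoc, form_psumTilde_mul, ih, comul_skew,
        tensorEval_rTensor]
      congr 2
      exact LinearMap.ext fun x => (form_psumTilde_mul k _ x).symm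
  have : form.flip h ∘ₗ LinearMap.mulRight ℚ g =
      (TensorProduct.dualDistrib ℚ sSym sSym).flip (comul h) ∘ₗ
        (TensorProduct.mk ℚ _ _).flip (form g) ∘ₗ form :=
    hom_ext fun Λ => key Λ g h
  exact LinearMap.congr_fun this f

end sSym

/-! ### Coefficients of `h` and `hTilde` and their relations with power sums. -/

theorem sum_partition_ite {s : Multiset ℕ} (hs : ∀ n ∈ s, 0 < n) (n : ℕ) (c : ℚ) :
    (∑ lam : Nat.Partition n, if s = lam.parts then c else 0) = if s.sum = n then c else 0 := by
  split_ifs with h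
  · rw [sum_eq_single ⟨s, fun hi => hs _ hi, h⟩, if_pos rfl]
    · exact fun lam _ hne => if_neg fun h' => hne (Nat.Partition.ext h'.symm)
    · exact fun h' => absurd (mem_univ _) h'
  · refine sum_eq_zero fun lam _ => if_neg ?_
    rintro rfl
    exact h lam.parts_sum

namespace sSym

theorem coeff_m (A : Finset ℕ) (s : Multiset ℕ) (hs : ∀ n ∈ s, 0 < n) (u : Mon) (hu : u.1.card ≤ 1) :
    coeff u.1 u.2 (m ⟨A, s, hs⟩ : SSeries) =
      if u.1.val.map u.2 = A.val then if (u.2.support \ u.1).val.map u.2 = s then 1 else 0 else 0 := by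
  have hp : pairs u.1 = ∅ := eq_empty_of_forall_notMem fun p hp => by
    rw [mem_pairs] at hp
    exact hp.2.2.ne (card_le_one.1 hu _ hp.1 _ hp.2.1)
  change coeff u.1 u.2 (symMono ⟨A, s, hs⟩) = _
  rw [symMono, coeff_of, hp, prod_empty, ite_and]

theorem coeff_m_eq_zero {Λ : SPar} {u : Mon} (h : u.1.card ≠ Λ.anti.card) :
    coeff u.1 u.2 (m Λ : SSeries) = 0 := by
  change coeff u.1 u.2 (symMono Λ) = _
  rw [symMono, coeff_of, if_neg]
  rintro ⟨h1, -⟩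
  have := congrArg Multiset.card h1
  rw [Multiset.card_map] at this
  exact h this

theorem pos_of_mem_map {u : Mon} : ∀ n ∈ (u.2.support \ u.1).val.map u.2, 0 < n := by
  intro n hn
  obtain ⟨i, hi, rfl⟩ := Multiset.mem_map.1 hn
  exact Nat.pos_of_ne_zero (Finsupp.mem_support_iff.1 (mem_sdiff.1 hi).1)

/-- Each monomial without `θ`'s occurs, with coefficient one, in exactly one `m Λ`, so `h r` is the
sum of all those of degree `r`. -/
theorem coeff_h (r : ℕ) (u : Mon) :
    coeff u.1 u.2 (h r : SSeries) = if u.1 = ∅ ∧ u.2.degree = r then 1 else 0 := by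
  rw [h, AddSubmonoidClass.coe_finsetSum, map_sum]
  by_cases hu : u.1 = ∅
  · have h1 : ((u.2.support \ u.1).val.map u.2).sum = u.2.degree := by
      rw [hu, sdiff_empty]; rfl
    simp only [hu, true_and]
    rw [← h1, ← sum_partition_ite pos_of_mem_map]
    refine sum_congr rfl fun lam _ => ?_
    rw [← hu, coeff_m _ _ _ _ (by simp [hu]), if_pos (by simp [hu])]
  · rw [if_neg fun h => hu h.1]
    exact sum_eq_zero fun lam _ => coeff_m_eq_zero fun h => hu (card_eq_zero.1 h)

/-- Under the condition `u.1` is a singleton; summing over it avoids naming its element. -/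
theorem coeff_hTilde (n : ℕ) (u : Mon) : coeff u.1 u.2 (hTilde n : SSeries) =
    if u.1.card = 1 ∧ u.2.degree = n then ∑ i ∈ u.1, ((u.2 i : ℚ) + 1) else 0 := by
  rw [hTilde, AddSubmonoidClass.coe_finsetSum, map_sum]
  by_cases hu : u.1.card = 1
  · obtain ⟨i, hi⟩ := card_eq_one.1 hu
    have h1 : ((u.2.support \ u.1).val.map u.2).sum + u.2 i = u.2.degree := by
      have h2 : ((u.2.support \ u.1).val.map u.2).sum = ∑ j ∈ u.2.support \ u.1, u.2 j := rfl
      rw [h2, hi, Finsupp.degree_apply]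
      by_cases hs : i ∈ u.2.support
      · rw [sdiff_singleton_eq_erase, sum_erase_add _ _ hs]
      · rw [Finsupp.notMem_support_iff.1 hs, sdiff_singleton_eq_erase, erase_eq_of_notMem hs, add_zero]
    have h2 (q : ℕ × ℕ) : coeff u.1 u.2 ((∑ lam : Nat.Partition q.2,
        ((q.1 : ℚ) + 1) • m ⟨{q.1}, lam.parts, fun _ hn => lam.parts_pos hn⟩ : sSym) : SSeries) =
        if u.2 i = q.1 ∧ ((u.2.support \ u.1).val.map u.2).sum = q.2 then (u.2 i : ℚ) + 1 else 0 := by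
      rw [ite_and, ← sum_partition_ite pos_of_mem_map, AddSubmonoidClass.coe_finsetSum, map_sum]
      by_cases hq : u.2 i = q.1
      · rw [if_pos hq]
        refine sum_congr rfl fun lam _ => ?_
        rw [Subalgebra.coe_smul, map_smul, coeff_m _ _ _ _ hu.le, if_pos (by simp [hi, hq]), hq,
          smul_eq_mul, mul_ite, mul_one, mul_zero]
      · rw [if_neg hq]
        refine sum_eq_zero fun lam _ => ?_
        rw [Subalgebra.coe_smul, map_smul, coeff_m _ _ _ _ hu.le, if_neg (by simp [hi, hq]), smul_zero]
    rw [sum_congr rfl fun q _ => h2 q, hi, sum_singleton]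
    by_cases hd : u.2.degree = n
    · rw [if_pos ⟨card_singleton i, hd⟩, sum_eq_single (u.2 i, n - u.2 i)]
      · rw [if_pos ⟨rfl, by rw [← hi]; omega⟩]
      · rintro ⟨a, b⟩ - hne
        refine if_neg ?_
        rintro ⟨rfl, rfl⟩
        exact hne (Prod.ext rfl (by simp only; rw [← hi]; omega))
      · intro hc
        exact absurd (HasAntidiagonal.mem_antidiagonal.2 (by simp only; omega)) hc
    · rw [if_neg fun h => hd h.2]
      refine sum_eq_zero fun q hq => if_neg ?_
      rw [HasAntidiagonal.mem_antidiagonal] at hq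
      rintro ⟨h3, h4⟩
      rw [← hi] at h4
      omega
  · rw [if_neg fun h => hu h.1]
    refine sum_eq_zero fun q _ => ?_
    rw [AddSubmonoidClass.coe_finsetSum, map_sum]
    refine sum_eq_zero fun lam _ => ?_
    rw [Subalgebra.coe_smul, map_smul, coeff_m_eq_zero (by simpa using hu), smul_zero]

theorem h_zero : h 0 = 1 := eq_of_coeffOn fun u => by
  rw [coeffOn_apply, coeffOn_apply, coeff_h, Subalgebra.coe_one, coeff_one]
  simp only [Finsupp.degree_eq_zero_iff]

theorem degree_sub_single {e : ℕ →₀ ℕ} {i r : ℕ} (h : r ≤ e i) :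
    (e - Finsupp.single i r).degree + r = e.degree := by
  have h1 : e - Finsupp.single i r + Finsupp.single i r = e :=
    tsub_add_cancel_of_le (Finsupp.single_le_iff.2 h)
  conv_rhs => rw [← h1, map_add, Finsupp.degree_single]

/-- Newton's identity. -/
theorem newton (r : ℕ) : ((r : ℚ) + 1) • h (r + 1) = ∑ k ∈ range (r + 1), psum (k + 1) * h (r - k) :=
  eq_of_coeffOn fun u => by
    rw [map_smul, map_sum, coeffOn_apply, coeff_h, smul_eq_mul]
    have h1 : ∀ k ∈ range (r + 1), coeffOn sSym u (psum (k + 1) * h (r - k)) =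
        ∑ i ∈ u.2.support, if k < u.2 i then if u.1 = ∅ ∧ u.2.degree = r + 1 then (1 : ℚ) else 0
          else 0 := by
      intro k hk
      rw [mem_range] at hk
      refine (coeff_psumSeries_mul k.succ_pos _ u).trans ?_
      rw [sum_filter]
      refine sum_congr rfl fun i _ => ?_
      by_cases hi : k < u.2 i
      · rw [if_pos (Nat.succ_le_of_lt hi), if_pos hi]
        refine (coeff_h (r - k) (u.1, u.2 - Finsupp.single i (k + 1))).trans ?_
        have := degree_sub_single (r := k + 1) (Nat.succ_le_of_lt hi)
        congr 1
        refine propext (and_congr_right fun _ => ?_)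
        simp only
        omega
      · rw [if_neg (mt Nat.lt_of_succ_le hi), if_neg hi]
    rw [sum_congr rfl h1, sum_comm]
    by_cases hu : u.1 = ∅ ∧ u.2.degree = r + 1
    · have h2 : ∀ i ∈ u.2.support, (∑ k ∈ range (r + 1), if k < u.2 i then
          if u.1 = ∅ ∧ u.2.degree = r + 1 then (1 : ℚ) else 0 else 0) = u.2 i := by
        intro i _
        -- A variable `x_i` is counted once for each `k` below its exponent; the range of `k` is
        -- long enough since exponents are at most the degree `r + 1`. Summed over `i` this gives
        -- the degree.
        have h3 : (range (r + 1)).filter (· < u.2 i) = range (u.2 i) := by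
          have := Finsupp.le_degree i u.2
          ext k
          simp only [mem_filter, mem_range]
          omega
        rw [if_pos hu, ← sum_filter, h3]
        simp
      rw [sum_congr rfl h2, ← Nat.cast_sum, ← Finsupp.degree_apply, if_pos hu, mul_one, hu.2]
      push_cast
      rfl
    · simp [hu]

/-- The odd analogue of Newton's identity: a monomial with the single `θ_i` contains `θ_i x_i^k` for
each `k` from `0` to its exponent at `i`, which accounts for the weight `Λ_1 + 1`. -/
theorem hTilde_eq_sum (n : ℕ) :
    hTilde n = ∑ q ∈ antidiagonal n, psumTilde q.1 * h q.2 := eq_of_coeffOn fun u => by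
  rw [map_sum, coeffOn_apply, coeff_hTilde]
  have h1 (q : ℕ × ℕ) : coeffOn sSym u (psumTilde q.1 * h q.2) = ∑ i ∈ u.1, if q.1 ≤ u.2 i then
      if u.1.card = 1 ∧ u.2.degree = q.1 + q.2 then (1 : ℚ) else 0 else 0 := by
    refine (coeff_psumTildeSeries_mul q.1 _ u).trans ?_
    rw [sum_filter]
    refine sum_congr rfl fun i hi => ?_
    by_cases hq : q.1 ≤ u.2 i
    · rw [if_pos hq, if_pos hq]
      have h2 := coeff_h q.2 (u.1.erase i, u.2 - Finsupp.single i q.1)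
      simp only at h2
      rw [h2]
      have h3 := degree_sub_single hq
      have h4 := card_erase_add_one hi
      by_cases hc : u.1.erase i = ∅
      · rw [hc, card_empty] at h4
        rw [hc, crossSign]
        simp only [prod_empty, prod_const_one, one_mul, true_and, ← h4]
        congr 1
        refine propext ?_
        omega
      · rw [if_neg fun h => hc h.1, if_neg, mul_zero]
        rintro ⟨h5, -⟩
        exact hc (card_eq_zero.1 (by omega))
    · rw [if_neg hq, if_neg hq]
  rw [sum_congr rfl fun q _ => h1 q, sum_comm]
  by_cases hu : u.1.card = 1 ∧ u.2.degree = n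
  · rw [if_pos hu]
    refine sum_congr rfl fun i _ => ?_
    rw [Nat.sum_antidiagonal_eq_sum_range_succ_mk]
    have h3 : (range n.succ).filter (· ≤ u.2 i) = range (u.2 i + 1) := by
      have := Finsupp.le_degree i u.2
      ext k
      simp only [mem_filter, mem_range]
      omega
    have h4 : ∀ k ∈ range (u.2 i + 1),
        (if u.1.card = 1 ∧ u.2.degree = k + (n - k) then (1 : ℚ) else 0) = 1 := fun k hk => by
      have := Finsupp.le_degree i u.2
      have := mem_range.1 hk
      exact if_pos ⟨hu.1, by omega⟩
    rw [← sum_filter, h3, sum_congr rfl h4]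
    simp
  · rw [if_neg hu, eq_comm]
    refine sum_eq_zero fun i _ => sum_eq_zero fun q hq => ?_
    rw [HasAntidiagonal.mem_antidiagonal] at hq
    rw [hq, if_neg hu, ite_self]

/-! ### The elements `h r` and `hTilde n` represent coefficients at one variable. -/

/-- The coefficient of `x_0^r`. -/
noncomputable abbrev evenCoeff (r : ℕ) : sSym →ₗ[ℚ] ℚ := coeffOn sSym (∅, Finsupp.single 0 r)

/-- The coefficient of `θ_0 x_0^n`. -/
noncomputable abbrev oddCoeff (n : ℕ) : sSym →ₗ[ℚ] ℚ := coeffOn sSym ({0}, Finsupp.single 0 n)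

theorem sum_single_filter (g : ℕ → ℚ) (r : ℕ) {s : ℕ} (hs : 0 < s) :
    ∑ i ∈ (Finsupp.single 0 r).support.filter (s ≤ Finsupp.single 0 r ·), g i =
      if s ≤ r then g 0 else 0 := by
  have h : (Finsupp.single 0 r).support.filter (s ≤ Finsupp.single 0 r ·) =
      if s ≤ r then {0} else ∅ := by
    ext i
    rw [mem_filter, Finsupp.mem_support_iff]
    rcases Nat.eq_zero_or_pos i with rfl | hi
    · rw [Finsupp.single_eq_same]
      split_ifs with h
      · simp only [mem_singleton, iff_true]; exact ⟨(hs.trans_le h).ne', h⟩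
      · simp [h]
    · rw [Finsupp.single_eq_of_ne hi.ne']
      split_ifs with h
      · simp only [mem_singleton]; omega
      · simp
  rw [h]
  split_ifs
  · exact sum_singleton _ _
  · rfl

theorem evenCoeff_psum_mul (r : ℕ) {s : ℕ} (hs : 0 < s) (f : sSym) :
    evenCoeff r (psum s * f) = if s ≤ r then evenCoeff (r - s) f else 0 := by
  refine (coeff_psumSeries_mul hs _ (∅, Finsupp.single 0 r)).trans ?_
  simp only
  rw [sum_single_filter _ _ hs, ← Finsupp.single_tsub]
  rfl

theorem evenCoeff_psumTilde_mul (r k : ℕ) (f : sSym) : evenCoeff r (psumTilde k * f) = 0 :=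
  (coeff_psumTildeSeries_mul k _ (∅, Finsupp.single 0 r)).trans rfl

theorem oddCoeff_psum_mul (n : ℕ) {s : ℕ} (hs : 0 < s) (f : sSym) :
    oddCoeff n (psum s * f) = if s ≤ n then oddCoeff (n - s) f else 0 := by
  refine (coeff_psumSeries_mul hs _ ({0}, Finsupp.single 0 n)).trans ?_
  simp only
  rw [sum_single_filter _ _ hs, ← Finsupp.single_tsub]
  rfl

theorem oddCoeff_psumTilde_mul (n k : ℕ) (f : sSym) :
    oddCoeff n (psumTilde k * f) = if k ≤ n then evenCoeff (n - k) f else 0 := by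
  refine (coeff_psumTildeSeries_mul k _ ({0}, Finsupp.single 0 n)).trans ?_
  simp only
  rw [filter_singleton, Finsupp.single_eq_same]
  split_ifs
  · rw [sum_singleton, erase_singleton, crossSign, prod_singleton, prod_empty, one_mul,
      ← Finsupp.single_tsub]
    rfl
  · rfl

theorem evenCoeff_p (r : ℕ) (Λ : SPar) :
    evenCoeff r (p Λ) = if Λ.anti = ∅ ∧ Λ.sym.sum = r then 1 else 0 := by
  induction Λ using SPar.induction generalizing r with
  | h0 =>
    rw [p_empty, coeffOn_apply, Subalgebra.coe_one, coeff_one]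
    simp [SPar.empty, eq_comm]
  | hs Λ s hs ih =>
    rw [← psum_mul_p hs, evenCoeff_psum_mul r hs, ih, ← ite_and]
    congr 1
    refine propext ?_
    have : (Λ.consSym s hs).sym.sum = s + Λ.sym.sum := Multiset.sum_cons s Λ.sym
    rw [this, and_left_comm]
    exact and_congr_right fun _ => by omega
  | ha Λ k hk _ =>
    rw [← psumTilde_mul_p_of_lt hk, evenCoeff_psumTilde_mul, if_neg]
    exact fun h => insert_ne_empty k Λ.anti h.1

/-- Strong induction through Newton's identity. Against `p_λ`, adjointness turns the term of
`p_{k+1}` into `k + 1` times the multiplicity of `k + 1` in `λ`; these add up to the sum of the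
parts, `r + 1`, which cancels the factor of `h (r + 1)`. -/
theorem form_h (r : ℕ) : form (h r) = evenCoeff r := by
  induction r using Nat.strong_induction_on with
  | _ r ih =>
    rcases r with _ | r
    · rw [h_zero, form_one]
      rw [evenCoeff, Finsupp.single_zero]
      rfl
    · refine hom_ext fun Ω => ?_
      have h1 := congrArg (fun f => form f (p Ω)) (newton r)
      simp only [map_smul, map_sum, LinearMap.smul_apply, LinearMap.sum_apply, smul_eq_mul] at h1
      have h2 : ∀ k ∈ range (r + 1), form (psum (k + 1) * h (r - k)) (p Ω) =
          if Ω.anti = ∅ ∧ Ω.sym.sum = r + 1 then ((Ω.sym.count (k + 1) * (k + 1) : ℕ) : ℚ) else 0 := by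
        intro k hk
        rw [mem_range] at hk
        rw [form_psum_mul k.succ_pos, ih (r - k) (by omega), skew_psum_p k.succ_pos, map_smul,
          evenCoeff_p, smul_eq_mul, mul_ite, mul_one, mul_zero]
        by_cases hm : k + 1 ∈ Ω.sym
        · have h3 := Multiset.sum_erase hm
          have h4 : Ω.anti = ∅ ∧ Ω.sym.sum = r + 1 ↔
              (Ω.eraseSym (k + 1)).anti = ∅ ∧ (Ω.eraseSym (k + 1)).sym.sum = r - k :=
            and_congr_right fun _ => by
              simp only [SPar.eraseSym]
              omega
          simp only [h4]
          congr 1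
          push_cast
          ring
        · rw [Multiset.count_eq_zero_of_notMem hm]
          simp
      rw [sum_congr rfl h2] at h1
      have hr : (r : ℚ) + 1 ≠ 0 := by positivity
      refine mul_left_cancel₀ hr (h1.trans ?_)
      rw [evenCoeff_p]
      by_cases h3 : Ω.anti = ∅ ∧ Ω.sym.sum = r + 1
      · simp only [if_pos h3, mul_one]
        have h4 : ∑ k ∈ range (r + 1), Ω.sym.count (k + 1) * (k + 1) = Ω.sym.sum := by
          have h5 : Ω.sym.toFinset ⊆ range (r + 2) := fun n hn => by
            have := Multiset.le_sum_of_mem (Multiset.mem_toFinset.1 hn)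
            rw [mem_range]
            omega
          rw [sum_multiset_count_of_subset _ _ h5, sum_range_succ' _ (r + 1)]
          simp
        rw [← Nat.cast_sum, h4, h3.2]
        push_cast
        rfl
      · simp [h3]

/-- By `hTilde_eq_sum` and adjointness the left side is the sum over `k` of the coefficient of
`x_0^{n-k}` after `∂/∂p̃_k`. If the argument starts with `p̃_j`, that factor itself must be
differentiated, since a surviving odd factor has no such coefficient; so only `k = j` contributes.
-/
theorem form_hTilde (n : ℕ) : form (hTilde n) = oddCoeff n := by
  have h1 (f : sSym) : form (hTilde n) f =
      ∑ k ∈ range (n + 1), evenCoeff (n - k) (skew (form (psumTilde k)) f) := by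
    rw [hTilde_eq_sum, Nat.sum_antidiagonal_eq_sum_range_succ_mk, map_sum, LinearMap.sum_apply]
    exact sum_congr rfl fun k _ => by rw [form_psumTilde_mul, form_h]
  refine hom_ext fun Ω => (h1 _).trans ?_
  clear h1
  induction Ω using SPar.induction generalizing n with
  | h0 =>
    rw [p_empty, coeffOn_apply, Subalgebra.coe_one, coeff_one, if_neg (by simp)]
    refine sum_eq_zero fun k _ => ?_
    rw [skew_one, form_psumTilde_one, zero_smul, map_zero]
  | hs Λ s hs ih =>
    rw [← psum_mul_p hs, oddCoeff_psum_mul n hs, ← ih]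
    have h2 : ∀ k ∈ range (n + 1),
        evenCoeff (n - k) (skew (form (psumTilde k)) (psum s * p Λ)) =
        if s + k ≤ n then evenCoeff (n - s - k) (skew (form (psumTilde k)) (p Λ)) else 0 := by
      intro k hk
      rw [mem_range] at hk
      rw [skew_psum_mul hs (form_psumTilde_comp_psum k hs), zero_smul, zero_add,
        evenCoeff_psum_mul _ hs, Nat.sub_right_comm]
      congr 1
      refine propext ?_
      omega
    rw [sum_congr rfl h2, ← sum_filter]
    split_ifs with hn
    · refine sum_congr ?_ fun _ _ => rfl
      ext k
      rw [mem_filter, mem_range, mem_range]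
      omega
    · refine sum_eq_zero fun k hk => ?_
      have := (mem_filter.1 hk).2
      omega
  | ha Λ j hj _ =>
    rw [← psumTilde_mul_p_of_lt hj, oddCoeff_psumTilde_mul]
    have h2 : ∀ k ∈ range (n + 1),
        evenCoeff (n - k) (skew (form (psumTilde k)) (psumTilde j * p Λ)) =
        if j = k then evenCoeff (n - k) (p Λ) else 0 := by
      intro k _
      rw [skew_psumTilde_mul j (form_psumTilde_comp_psumTilde j k) (form_psumTilde_comp_parity k),
        map_add, map_smul, map_smul, evenCoeff_psumTilde_mul, smul_zero, add_zero, smul_eq_mul,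
        ite_mul, one_mul, zero_mul]
    rw [sum_congr rfl h2, sum_ite_eq]
    simp only [mem_range, Nat.lt_succ_iff]

end sSym

/-! ### The morphism `toSym` and its adjointness to the inclusion. -/

namespace sSym

theorem lead_incl_inl (m : ℕ+) (g : sSym) :
    sQSym.lead (FreeMonoid.of (Sum.inl m)) (incl g) = evenCoeff m g := by
  rw [← (shape_eq_of_iff (Sum.inl m) (∅, Finsupp.single 0 (m : ℕ))).2 ⟨0, rfl⟩,
    ← sQSym.coeffOn_eq_lead]
  rfl

theorem lead_incl_inr (n : ℕ) (g : sSym) :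
    sQSym.lead (FreeMonoid.of (Sum.inr n)) (incl g) = oddCoeff n g := by
  rw [← (shape_eq_of_iff (Sum.inr n) ({0}, Finsupp.single 0 n)).2 ⟨0, rfl⟩,
    ← sQSym.coeffOn_eq_lead]
  rfl

/-- Both coproducts are determined by the same series `split g` in two alphabets. -/
theorem comul_incl (g : sSym) :
    sQSym.comul (incl g) = TensorProduct.map incl.toLinearMap incl.toLinearMap (comul g) := by
  have h (t : sSym ⊗[ℚ] sSym) :
      twoAlphabet sQSym (TensorProduct.map incl.toLinearMap incl.toLinearMap t) =
        twoAlphabet sSym t := by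
    induction t with
    | zero => simp only [map_zero]
    | add x y hx hy => simp only [map_add, hx, hy]
    | tmul x y => rfl
  refine twoAlphabet_injective sQSym ?_
  rw [h]
  exact (twoAlphabet_comul splitClosed_sQSym _).trans (twoAlphabet_comul splitClosed_sSym g).symm

end sSym

theorem tensorEval_map {A B : Type} [AddCommGroup A] [Module ℚ A] [AddCommGroup B] [Module ℚ B]
    (φ ψ : B →ₗ[ℚ] ℚ) (D E : A →ₗ[ℚ] B) (t : A ⊗[ℚ] A) :
    tensorEval φ ψ (TensorProduct.map D E t) = tensorEval (φ ∘ₗ D) (ψ ∘ₗ E) t := by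
  induction t with
  | zero => simp only [map_zero]
  | add x y hx hy => simp only [map_add, hx, hy]
  | tmul x y => rfl

namespace sNSym

/-- The algebra morphism with `H_m ↦ h_m` and `H̃_n ↦ h̃_n`. -/
noncomputable def toSym : sNSym →ₐ[ℚ] sSym :=
  MonoidAlgebra.lift ℚ sSym DComp (FreeMonoid.lift (Sum.elim (fun m => sSym.h m) sSym.hTilde))

theorem toSym_H_of (a : DPart) :
    toSym (H (FreeMonoid.of a)) = Sum.elim (fun m : ℕ+ => sSym.h m) sSym.hTilde a := by
  rw [toSym, H, MonoidAlgebra.lift_single, FreeMonoid.lift_eval_of, one_smul]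

theorem sendsGenerators_toSym : SendsGenerators toSym :=
  ⟨fun m => toSym_H_of (Sum.inl m), fun n => toSym_H_of (Sum.inr n)⟩

theorem eq_toSym {π : sNSym →ₐ[ℚ] sSym} (hπ : SendsGenerators π) : π = toSym := by
  have h : ((π : sNSym →* sSym).comp (MonoidAlgebra.of ℚ DComp)) =
      ((toSym : sNSym →* sSym).comp (MonoidAlgebra.of ℚ DComp)) := FreeMonoid.hom_eq fun a => ?_
  · exact (MonoidAlgebra.lift ℚ sSym DComp).symm.injective h
  refine Eq.trans ?_ (toSym_H_of a).symm
  rcases a with m | n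
  · exact hπ.1 m
  · exact hπ.2 n

theorem form_toSym_H_of (a : DPart) (g : sSym) :
    sSym.form (toSym (H (FreeMonoid.of a))) g = pairing (H (FreeMonoid.of a)) (sSym.incl g) := by
  rw [toSym_H_of, pairing_H]
  rcases a with m | n
  · rw [sSym.lead_incl_inl, ← sSym.form_h]
    rfl
  · rw [sSym.lead_incl_inr, ← sSym.form_hTilde]
    rfl

/-- `toSym` is adjoint to the inclusion. -/
theorem form_toSym (F : sNSym) (g : sSym) :
    sSym.form (toSym F) g = pairing F (sSym.incl g) := by
  -- Induction on the length of `α`: the first part is split off, both pairings turn the product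
  -- into a coproduct, and the inclusion respects coproducts.
  have key (α : DComp) : ∀ g, sSym.form (toSym (H α)) g = pairing (H α) (sSym.incl g) := by
    induction α using FreeMonoid.inductionOn' with
    | one =>
      intro g
      rw [← one_eq_H, map_one, sSym.form_one, pairing_one_left]
      rfl
    | of_mul a α ih =>
      intro g
      rw [← H_mul_H, map_mul, sSym.form_mul, pairing_mul, sSym.comul_incl,
        tensorPairing_tmul_left, tensorEval_map]
      congr 2
      · exact LinearMap.ext fun g => form_toSym_H_of a g
      · exact LinearMap.ext ih
  have : sSym.form.flip g ∘ₗ toSym.toLinearMap = pairing.flip (sSym.incl g) :=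
    hom_ext fun α => key α g
  exact LinearMap.congr_fun this F

/-- The form is nondegenerate, so it suffices to pair with `f ⊗ g`. Both sides then become the
pairing of `F` with `ι (f * g) = ι f * ι g`. -/
theorem comul_toSym (F : sNSym) :
    sSym.comul (toSym F) = TensorProduct.map toSym.toLinearMap toSym.toLinearMap (comul F) := by
  refine tensor_ext (φ := fun g => sSym.form g) (ψ := fun g => sSym.form g)
    (fun f h => sSym.eq_zero_of_form f fun g => by rw [sSym.form_symm, h])
    (fun f h => sSym.eq_zero_of_form f fun g => by rw [sSym.form_symm, h]) fun f g => ?_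
  have h (g : sSym) : sSym.form g ∘ₗ toSym.toLinearMap = pairWith (sSym.incl g) :=
    LinearMap.ext fun F => (sSym.form_symm _ _).trans (form_toSym F g)
  rw [← sSym.form_mul, tensorEval_map, h, h, tensorEval_comul, sSym.form_symm, form_toSym, map_mul]

theorem counit_toSym (F : sNSym) : sSym.counit (toSym F) = counit F := by
  rw [← sSym.form_one, sSym.form_symm, form_toSym, map_one, pairing_one_right]

theorem h_mem_range (r : ℕ) : sSym.h r ∈ toSym.range := by
  rcases r with _ | r
  · rw [sSym.h_zero]
    exact one_mem _
  · exact ⟨_, sendsGenerators_toSym.1 r.succPNat⟩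

theorem hTilde_mem_range (n : ℕ) : sSym.hTilde n ∈ toSym.range :=
  ⟨_, sendsGenerators_toSym.2 n⟩

/-- The last term of Newton's identity is `p_{r+1} h_0 = p_{r+1}`, so the identity can be solved for
it; `hTilde_eq_sum` is solved for `p̃_n` in the same way below. -/
theorem psum_mem_range (r : ℕ) : sSym.psum (r + 1) ∈ toSym.range := by
  induction r using Nat.strong_induction_on with
  | _ r ih =>
    have h := sSym.newton r
    rw [sum_range_succ, Nat.sub_self, sSym.h_zero, mul_one, ← sub_eq_iff_eq_add'] at h
    rw [← h]
    exact sub_mem (Subalgebra.smul_mem _ (h_mem_range _) _)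
      (sum_mem fun k hk => mul_mem (ih k (mem_range.1 hk)) (h_mem_range _))

theorem psumTilde_mem_range (n : ℕ) : sSym.psumTilde n ∈ toSym.range := by
  induction n using Nat.strong_induction_on with
  | _ n ih =>
    have h := sSym.hTilde_eq_sum n
    rw [Nat.sum_antidiagonal_eq_sum_range_succ_mk, sum_range_succ] at h
    simp only [Nat.sub_self] at h
    rw [sSym.h_zero, mul_one, ← sub_eq_iff_eq_add'] at h
    rw [← h]
    exact sub_mem (hTilde_mem_range n)
      (sum_mem fun k hk => mul_mem (ih k (mem_range.1 hk)) (h_mem_range _))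

theorem p_mem_range (Λ : SPar) : sSym.p Λ ∈ toSym.range := by
  induction Λ using SPar.induction with
  | h0 => rw [sSym.p_empty]; exact one_mem _
  | hs Λ r hr ih =>
    obtain ⟨r, rfl⟩ := Nat.exists_eq_add_one.2 hr
    rw [← sSym.psum_mul_p hr]
    exact mul_mem (psum_mem_range r) ih
  | ha Λ k hk ih =>
    rw [← sSym.psumTilde_mul_p_of_lt hk]
    exact mul_mem (psumTilde_mem_range k) ih

theorem surjective_toSym : Function.Surjective toSym := by
  intro f
  have h : Submodule.span ℚ (Set.range sSym.p) ≤ Subalgebra.toSubmodule toSym.range :=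
    Submodule.span_le.2 (Set.range_subset_iff.2 p_mem_range)
  rw [sSym.span_p] at h
  exact h (Submodule.mem_top (x := f))

end sNSym

theorem sQSym.exists_isSuperHopf : ∃ S, IsSuperHopf sQSym.parity sQSym.comul sQSym.counit S :=
  SSeries.exists_isSuperHopf splitClosed_sQSym homog_mem_sQSym fun _ => rfl

end SuperSym

theorem mainTheorem9 :
    ∃ (SQ : sQSym →ₗ[ℚ] sQSym) (SN : sNSym →ₗ[ℚ] sNSym) (SL : sSym →ₗ[ℚ] sSym)
      (B : sSym →ₗ[ℚ] sSym →ₗ[ℚ] ℚ) (π : sNSym →ₐ[ℚ] sSym),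
      -- the three Hopf algebras, with their antipodes
      IsSuperHopf sQSym.parity sQSym.comul sQSym.counit SQ ∧
      IsSuperHopf sNSym.parity sNSym.comul sNSym.counit SN ∧
      IsSuperHopf sSym.parity sSym.comul sSym.counit SL ∧
      -- the dual pairing
      sNSym.IsHopfDual SN SQ ∧
      (∀ α β : DComp, sNSym.pairing (sNSym.H α) (sQSym.M β) = if α = β then 1 else 0) ∧
      -- the scalar product on symmetric functions in superspace
      (sSym.IsHallForm B ∧ ∀ B', sSym.IsHallForm B' → B' = B) ∧
      -- the algebra morphism `π`
      (sNSym.SendsGenerators π ∧ ∀ π', sNSym.SendsGenerators π' → π' = π) ∧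
      Function.Surjective π ∧
      IsHopfHom sNSym.comul sNSym.counit SN sSym.comul sSym.counit SL π ∧
      ∀ (F : sNSym) (g : sSym), B (π F) g = sNSym.pairing F (sSym.incl g) := by
  obtain ⟨SQ, hQ⟩ := sQSym.exists_isSuperHopf
  obtain ⟨SN, hN⟩ := sNSym.exists_isSuperHopf
  obtain ⟨SL, hL⟩ := sSym.exists_isSuperHopf
  exact ⟨SQ, SN, SL, sSym.form, sNSym.toSym, hQ, hN, hL, sNSym.isHopfDual hN hQ,
    sNSym.pairing_H_M, ⟨sSym.form_p, fun _ h => sSym.eq_form h⟩,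
    ⟨sNSym.sendsGenerators_toSym, fun _ h => sNSym.eq_toSym h⟩, sNSym.surjective_toSym,
    ⟨sNSym.comul_toSym, sNSym.counit_toSym,
      hN.antipode_map hL sNSym.toSym sNSym.comul_toSym sNSym.counit_toSym⟩, sNSym.form_toSym⟩
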